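/- **Corollary 4.3 (Imploding trios and quartets).** *Point vortices.* Let $M\ge 3$. A configuration of $M$ point vortices is $\Lambda=(z_1,\dots,z_M,\gamma_1,\dots,\gamma_M,\boldsymbol\Omega)\in\mathbb P:=\mathbb C^M\times\mathbb R^M\times\mathbb C$, where $\boldsymbol\Omega=\Omega-\frac{i}{2\kappa}$, i.e. $i\boldsymbol\Omega=i\Omega+\frac1{2\kappa}$. It collapses self-similarly to the origin at time $\kappa\in(0,\infty)$ if the $z_k$ are distinct, the $\gamma_k$ are non-zero, $\operatorname{Im}\boldsymbol\Omega<0$ and $\mathcal V(\Lambda)=0$, where $$\mathcal V_k(\Lambda)=\sum_{j\ne k}\frac{\gamma_j}{2\pi i}\frac1{z_k-z_j}+i\boldsymbol\Omega\,\overline{z_k},\qquad k=1,\dots,M.$$ It is non-degenerate if the real Jacobian $D_\Lambda\mathcal V(\Lambda)$ has full rank. Consider the two configurations * trio: $(z_1,z_2,z_3)=(-2,\,1,\,\sqrt7\,i)-z_{\rm c}$ with $z_{\rm c}=-\tfrac{2}{\sqrt7}i$, $(\gamma_1,\gamma_2,\gamma_3)=(1,2,-\tfrac23)$, $\Omega=\tfrac{35}{264\pi}$,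 $\tfrac1\kappa=\tfrac{\sqrt7}{132\pi}$; * quartet: $z_1=\tfrac{\sqrt3}2-\tfrac i2$, $z_2=1+\tfrac{\sqrt3}2-\tfrac i2$, $z_3=-z_2$, $z_4=-z_1$, $\gamma_1=\gamma_4=(2\sqrt3+5)\pi$, $\gamma_2=\gamma_3=(\sqrt3-4)\pi$, $\boldsymbol\Omega=2\sqrt3-\tfrac34-\tfrac i2$. *Imploding hollow vortices.* In the frame $t=\kappa(1-e^{-T/\kappa})$, $\mathbf x=e^{-T/(2\kappa)}R(\Omega T)\boldsymbol\xi$, which shrinks to the origin as $t\nearrow\kappa<\infty$ ($R$ denotes rotation), an imploding hollow vortex configuration with strengths $\gamma_k$ is steady. It consists of bounded connected open cores $\mathscr V_1,\dots,\mathscr V_M$ with disjoint closures and boundaries $\Gamma_k$ that are regular $C^1$ Jordan curves, and of a relative velocity $\mathbf U$ and pressure $P$, which are $C^1$ in $\mathscr D=\mathbb R^2\setminus\bigcup_k\overline{\mathscr V_k}$ and continuous on $\overline{\mathscr D}$, with $$\mathbf U\cdot\nabla\mathbf U+2\Omega\mathbf U^\perp-\Big(\frac1{4\kappa^2}+\Omega^2\Big)\boldsymbol\xi=-\nabla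 P,\quad \nabla\cdot\mathbf U=\frac1\kappa,\quad \nabla^\perp\cdot\mathbf U=-2\Omega\quad\text{in }\mathscr D,$$ such that $\mathbf n\cdot\mathbf U=0$ and $P$ is constant on each $\Gamma_k$, and such that the initial inertial-frame velocity $\mathbf u=\mathbf U+\Omega\boldsymbol\xi^\perp-\frac1{2\kappa}\boldsymbol\xi$ tends to $0$ at infinity and has (counterclockwise) circulation $\int_{\Gamma_k}\mathbf t\cdot\mathbf u\,ds=\gamma_k$. *Statement.* Fix an integer $\ell\ge1$ and $\alpha\in(0,1)$. Let $\Lambda_0$ be the trio ($M=3$) or the quartet ($M=4$) above. Then $\Lambda_0$ is a non-degenerate self-similarly collapsing point vortex configuration. Moreover, for every real subspace $\mathcal P\subset\mathbb P$ for which the restriction of $D_\Lambda\mathcal V(\Lambda_0)$ to $\mathcal P$ is an isomorphism onto $\mathbb C^M$, there are $\rho_1>0$ and a real-analytic curve $$(-\rho_1,\rho_1)\ni\rho\mapsto(\mu^\rho,\nu^\rho,Q^\rho,\beta^\rho,\Lambda^\rho)\in C^{\ell+\alpha}(\mathbb T)^M\times C^{\ell+\alpha}(\mathbb T)^M\times\mathbb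 R^M\times\mathbb R^M\times(\Lambda_0+\mathcal P)$$ with $(\mu^0,\nu^0,Q^0,\beta^0,\Lambda^0)=(0,0,0,0,\Lambda_0)$, such that all $\mu_k^\rho,\nu_k^\rho$ are real-valued with mean zero, all strengths in $\Lambda^\rho$ are non-zero, the collapse time of $\Lambda^\rho$ lies in $(0,\infty)$, and for $0<|\rho|<\rho_1$ the following holds. Write $\Lambda^\rho=(\zeta_1,\dots,\zeta_M,\gamma_1,\dots,\gamma_M,\boldsymbol\Omega)$, $\mathcal D_\rho=\mathbb C\setminus\overline{\bigcup_kB_{|\rho|}(\zeta_k)}$, and $$\mathcal Z^\rho[\mu](\zeta)=\frac1{2\pi i}\sum_k\int_{\mathbb T}\frac{\mu_k(\sigma)}{\rho\sigma+\zeta_k-\zeta}\,\rho\,d\sigma .$$ The closed disks $\overline{B_{|\rho|}(\zeta_k)}$ are disjoint, and the functions $$f=\mathrm{id}+\rho^2\mathcal Z^\rho[\mu^\rho],\qquad w_\zeta=\sum_k\frac{\gamma_k+i\beta_k^\rho}{2\pi i}\frac1{\zeta-\zeta_k}+\rho\,\partial_\zeta\mathcal Z^\rho[\nu^\rho]$$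 are such that $f,f_\zeta,w_\zeta$ extend continuously to $\overline{\mathcal D_\rho}$, $f$ is injective with $f_\zeta\ne0$ there, $f-\mathrm{id}$ and $w_\zeta$ vanish at infinity, and, for each $k$, $$\operatorname{Re}\int_{\partial B_{|\rho|}(\zeta_k)}w_\zeta\,d\zeta=\gamma_k,$$ $$\operatorname{Re}\Big((\zeta-\zeta_k)f_\zeta\Big(\frac{w_\zeta}{f_\zeta}+i\boldsymbol\Omega\bar f\Big)\Big)=0,\qquad \frac12\Big|\frac{w_\zeta}{f_\zeta}+i\boldsymbol\Omega\bar f\Big|^2-\frac12|\boldsymbol\Omega|^2|f|^2=\frac{\gamma_k^2}{8\pi^2\rho^2}+\frac{Q_k^\rho}{2\rho}\quad\text{on }\partial B_{|\rho|}(\zeta_k).$$ Finally, there is an imploding hollow vortex configuration with parameters $\kappa,\Omega$ given by $\boldsymbol\Omega$ and strengths $\gamma_k$ whose fluid domain is $f(\mathcal D_\rho)$, whose core boundaries are $\Gamma_k=f(\partial B_{|\rho|}(\zeta_k))$ and whose velocity $\mathbf U=(U,V)$ is given by $(U-iV)\circ f=\frac{w_\zeta}{f_\zeta}+i\boldsymbol\Omega\bar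 f$ on $\overline{\mathcal D_\rho}$. -/

import Mathlib

open Complex Filter Topology Set MeasureTheory

/-! ### Hölder spaces on the unit circle -/

/-- A function on the unit circle, as a `2π`-periodic function of the angle. -/
noncomputable def circleLift (φ : Circle → ℝ) : ℝ → ℝ := fun θ => φ (Circle.exp θ)

/-- The Hölder difference quotient of the `ℓ`-th angular derivative. -/
noncomputable def holderQuotient (ℓ : ℕ) (α : ℝ) (φ : Circle → ℝ) (p : ℝ × ℝ) : ℝ :=
  |iteratedDeriv ℓ (circleLift φ) p.1 - iteratedDeriv ℓ (circleLift φ) p.2| / |p.1 - p.2| ^ α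

/-- Membership in `C^{ℓ+α}(𝕋)` (real-valued functions): `ℓ` times continuously differentiable
in the angle, with an `ℓ`-th derivative that is Hölder continuous of exponent `α`. -/
def IsHolder (ℓ : ℕ) (α : ℝ) (φ : Circle → ℝ) : Prop :=
  ContDiff ℝ ℓ (circleLift φ) ∧ BddAbove (range (holderQuotient ℓ α φ))

/-- The usual `C^{ℓ+α}` norm: the sum of the sup norms of the derivatives up to order `ℓ` and of
the Hölder seminorm of the `ℓ`-th derivative. -/
noncomputable def holderNorm (ℓ : ℕ) (α : ℝ) (φ : Circle → ℝ) : ℝ :=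
  (∑ j ∈ Finset.range (ℓ + 1), ⨆ θ : ℝ, |iteratedDeriv j (circleLift φ) θ|)
    + ⨆ p : ℝ × ℝ, holderQuotient ℓ α φ p

theorem circleLift_zero : circleLift 0 = 0 := rfl

theorem circleLift_add (φ ψ : Circle → ℝ) :
    circleLift (φ + ψ) = circleLift φ + circleLift ψ := rfl

theorem circleLift_smul (c : ℝ) (φ : Circle → ℝ) :
    circleLift (c • φ) = c • circleLift φ := rfl

theorem holderQuotient_nonneg (ℓ : ℕ) (α : ℝ) (φ : Circle → ℝ) (p : ℝ × ℝ) :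
    0 ≤ holderQuotient ℓ α φ p :=
  div_nonneg (abs_nonneg _) (Real.rpow_nonneg (abs_nonneg _) _)

theorem IsHolder.iteratedDeriv_add {ℓ : ℕ} {α : ℝ} {φ ψ : Circle → ℝ}
    (hφ : IsHolder ℓ α φ) (hψ : IsHolder ℓ α ψ) {j : ℕ} (hj : j ≤ ℓ) (θ : ℝ) :
    iteratedDeriv j (circleLift (φ + ψ)) θ
      = iteratedDeriv j (circleLift φ) θ + iteratedDeriv j (circleLift ψ) θ := by
  have hj' : (j : WithTop ℕ∞) ≤ ℓ := by exact_mod_cast hj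
  rw [circleLift_add]
  exact _root_.iteratedDeriv_add (hφ.1.contDiffAt.of_le hj') (hψ.1.contDiffAt.of_le hj')

theorem iteratedDeriv_circleLift_smul (c : ℝ) (φ : Circle → ℝ) (j : ℕ) (θ : ℝ) :
    iteratedDeriv j (circleLift (c • φ)) θ = c * iteratedDeriv j (circleLift φ) θ := by
  rw [circleLift_smul, iteratedDeriv_const_smul_field]
  rfl

theorem holderQuotient_smul (ℓ : ℕ) (α c : ℝ) (φ : Circle → ℝ) (p : ℝ × ℝ) :
    holderQuotient ℓ α (c • φ) p = |c| * holderQuotient ℓ α φ p := by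
  unfold holderQuotient
  rw [iteratedDeriv_circleLift_smul, iteratedDeriv_circleLift_smul, ← mul_sub, abs_mul,
    mul_div_assoc]

theorem IsHolder.holderQuotient_add_le {ℓ : ℕ} {α : ℝ} {φ ψ : Circle → ℝ}
    (hφ : IsHolder ℓ α φ) (hψ : IsHolder ℓ α ψ) (p : ℝ × ℝ) :
    holderQuotient ℓ α (φ + ψ) p ≤ holderQuotient ℓ α φ p + holderQuotient ℓ α ψ p := by
  unfold holderQuotient
  rw [hφ.iteratedDeriv_add hψ le_rfl, hφ.iteratedDeriv_add hψ le_rfl, ← add_div]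
  refine div_le_div_of_nonneg_right ?_ (Real.rpow_nonneg (abs_nonneg _) _)
  rw [add_sub_add_comm]
  exact abs_add_le _ _

theorem IsHolder.bddAbove_iteratedDeriv {ℓ : ℕ} {α : ℝ} {φ : Circle → ℝ}
    (hφ : IsHolder ℓ α φ) {j : ℕ} (hj : j ≤ ℓ) :
    BddAbove (range fun θ : ℝ => |iteratedDeriv j (circleLift φ) θ|) := by
  have hc : Continuous (iteratedDeriv j (circleLift φ)) :=
    hφ.1.continuous_iteratedDeriv j (by exact_mod_cast hj)
  have hp : Function.Periodic (iteratedDeriv j (circleLift φ)) (2 * Real.pi) := by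
    intro θ
    have h0 : (fun z => circleLift φ (z + 2 * Real.pi)) = circleLift φ := by
      funext z
      simp [circleLift]
    have h := congrFun (iteratedDeriv_comp_add_const j (circleLift φ) (2 * Real.pi)) θ
    rw [h0] at h
    exact h.symm
  have hp' : Function.Periodic (fun θ => |iteratedDeriv j (circleLift φ) θ|) (2 * Real.pi) :=
    fun θ => by simp only [hp θ]
  exact (hp'.isBounded_of_continuous (by positivity) hc.abs).bddAbove

/-- The Hölder functions form a vector space. -/
def holderSubmodule (ℓ : ℕ) (α : ℝ) : Submodule ℝ (Circle → ℝ) where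
  carrier := {φ | IsHolder ℓ α φ}
  zero_mem' := by
    refine ⟨by rw [circleLift_zero]; exact contDiff_const, 0, ?_⟩
    rintro _ ⟨p, rfl⟩
    have h := holderQuotient_smul ℓ α 0 0 p
    simp only [smul_zero, abs_zero, zero_mul] at h
    exact h.le
  add_mem' := by
    intro φ ψ hφ hψ
    refine ⟨by rw [circleLift_add]; exact hφ.1.add hψ.1, ?_⟩
    obtain ⟨a, ha⟩ := hφ.2
    obtain ⟨b, hb⟩ := hψ.2
    refine ⟨a + b, ?_⟩
    rintro _ ⟨p, rfl⟩
    exact (hφ.holderQuotient_add_le hψ p).trans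
      (add_le_add (ha (mem_range_self p)) (hb (mem_range_self p)))
  smul_mem' := by
    intro c φ hφ
    refine ⟨by rw [circleLift_smul]; exact contDiff_const.smul hφ.1, ?_⟩
    obtain ⟨a, ha⟩ := hφ.2
    refine ⟨|c| * a, ?_⟩
    rintro _ ⟨p, rfl⟩
    rw [holderQuotient_smul]
    exact mul_le_mul_of_nonneg_left (ha (mem_range_self p)) (abs_nonneg c)

/-- The Hölder space `C^{ℓ+α}(𝕋)` of real-valued functions on the unit circle. -/
def HolderCircle (ℓ : ℕ) (α : ℝ) : Type := ↥(holderSubmodule ℓ α)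

namespace HolderCircle

variable {ℓ : ℕ} {α : ℝ}

noncomputable instance : AddCommGroup (HolderCircle ℓ α) :=
  inferInstanceAs (AddCommGroup ↥(holderSubmodule ℓ α))

noncomputable instance : Module ℝ (HolderCircle ℓ α) :=
  inferInstanceAs (Module ℝ ↥(holderSubmodule ℓ α))

instance : CoeFun (HolderCircle ℓ α) (fun _ => Circle → ℝ) := ⟨fun φ => φ.1⟩

theorem isHolder (φ : HolderCircle ℓ α) : IsHolder ℓ α φ := φ.2

noncomputable instance : Norm (HolderCircle ℓ α) := ⟨fun φ => holderNorm ℓ α φ⟩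

theorem norm_def (φ : HolderCircle ℓ α) : ‖φ‖ = holderNorm ℓ α φ := rfl

theorem coe_add (φ ψ : HolderCircle ℓ α) : (φ + ψ).1 = φ.1 + ψ.1 := rfl

theorem coe_smul (c : ℝ) (φ : HolderCircle ℓ α) : (c • φ).1 = c • φ.1 := rfl

theorem normedCore : NormedSpace.Core ℝ (HolderCircle ℓ α) where
  norm_nonneg φ := by
    rw [norm_def]
    exact add_nonneg
      (Finset.sum_nonneg fun j _ => Real.iSup_nonneg fun θ => abs_nonneg _)
      (Real.iSup_nonneg fun p => holderQuotient_nonneg _ _ _ p)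
  norm_smul c φ := by
    rw [norm_def, norm_def, coe_smul]
    unfold holderNorm
    simp only [holderQuotient_smul, iteratedDeriv_circleLift_smul, abs_mul, Real.norm_eq_abs]
    rw [← Real.mul_iSup_of_nonneg (abs_nonneg c), mul_add, Finset.mul_sum]
    congr 1
    exact Finset.sum_congr rfl fun j _ => (Real.mul_iSup_of_nonneg (abs_nonneg c) _).symm
  norm_triangle φ ψ := by
    rw [norm_def, norm_def, norm_def, coe_add]
    unfold holderNorm
    rw [add_add_add_comm, ← Finset.sum_add_distrib]
    refine add_le_add (Finset.sum_le_sum fun j hj => ?_) ?_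
    · have hj' : j ≤ ℓ := Nat.lt_succ_iff.mp (Finset.mem_range.mp hj)
      refine ciSup_le fun θ => ?_
      rw [φ.isHolder.iteratedDeriv_add ψ.isHolder hj']
      exact (abs_add_le _ _).trans (add_le_add
        (le_ciSup (φ.isHolder.bddAbove_iteratedDeriv hj') θ)
        (le_ciSup (ψ.isHolder.bddAbove_iteratedDeriv hj') θ))
    · refine ciSup_le fun p => ?_
      exact (φ.isHolder.holderQuotient_add_le ψ.isHolder p).trans (add_le_add
        (le_ciSup φ.isHolder.2 p) (le_ciSup ψ.isHolder.2 p))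
  norm_eq_zero_iff φ := by
    constructor
    · intro h
      rw [norm_def] at h
      unfold holderNorm at h
      have hs : ∀ j ∈ Finset.range (ℓ + 1),
          0 ≤ ⨆ θ : ℝ, |iteratedDeriv j (circleLift φ) θ| :=
        fun j _ => Real.iSup_nonneg fun θ => abs_nonneg _
      have hq : 0 ≤ ⨆ p : ℝ × ℝ, holderQuotient ℓ α φ p :=
        Real.iSup_nonneg fun p => holderQuotient_nonneg _ _ _ p
      have h1 := (add_eq_zero_iff_of_nonneg (Finset.sum_nonneg hs) hq).mp h
      have h2 := (Finset.sum_eq_zero_iff_of_nonneg hs).mp h1.1 0 (by simp)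
      apply Subtype.ext
      funext z
      have h3 := le_ciSup (φ.isHolder.bddAbove_iteratedDeriv (Nat.zero_le ℓ)) (Complex.arg z)
      rw [h2] at h3
      have h4 : circleLift φ (Complex.arg z) = 0 := by
        simpa using abs_nonpos_iff.mp h3
      unfold circleLift at h4
      rw [Circle.exp_arg] at h4
      exact h4
    · rintro rfl
      have h0 : ∀ p, holderQuotient ℓ α ((0 : HolderCircle ℓ α) : Circle → ℝ) p = 0 := by
        intro p
        have h := holderQuotient_smul ℓ α 0 0 p
        simp only [smul_zero, abs_zero, zero_mul] at h
        exact h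
      have h1 : ∀ j θ,
          iteratedDeriv j (circleLift ((0 : HolderCircle ℓ α) : Circle → ℝ)) θ = 0 := by
        intro j θ
        have h := iteratedDeriv_circleLift_smul 0 0 j θ
        simp only [smul_zero, zero_mul] at h
        exact h
      rw [norm_def]
      unfold holderNorm
      simp [h0, h1]

noncomputable instance : NormedAddCommGroup (HolderCircle ℓ α) :=
  NormedAddCommGroup.ofCore normedCore

noncomputable instance : NormedSpace ℝ (HolderCircle ℓ α) :=
  NormedSpace.ofCore normedCore

end HolderCircle

/-! ### Point vortices -/

/-- The parameters `Λ = (z₁, …, z_M, γ₁, …, γ_M, 𝛀)` of a configuration of `M` point vortices: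
centers, strengths, and the complex number `𝛀 = Ω - i / (2κ)`, that is `i𝛀 = iΩ + 1 / (2κ)`. -/
abbrev VortexParams (M : ℕ) : Type := (Fin M → ℂ) × (Fin M → ℝ) × ℂ

namespace VortexParams

variable {M : ℕ}

/-- The vortex centers. -/
def center (Λ : VortexParams M) : Fin M → ℂ := Λ.1

/-- The vortex strengths. -/
def strength (Λ : VortexParams M) : Fin M → ℝ := Λ.2.1

/-- The complex constant `𝛀 = Ω - i / (2κ)`. -/
def cOmega (Λ : VortexParams M) : ℂ := Λ.2.2

/-- The angular velocity `Ω`. -/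
def angular (Λ : VortexParams M) : ℝ := Λ.cOmega.re

/-- The collapse time `κ`; it is positive and finite when `𝛀` has negative imaginary part. -/
noncomputable def collapseTime (Λ : VortexParams M) : ℝ := -1 / (2 * Λ.cOmega.im)

end VortexParams

/-- The map `𝓥` whose zeros are the self-similar point vortex configurations:
`𝓥ₖ(Λ) = ∑_{j ≠ k} γⱼ / (2πi) · 1 / (zₖ - zⱼ) + i 𝛀 conj zₖ`. -/
noncomputable def vortexMap {M : ℕ} (Λ : VortexParams M) : Fin M → ℂ := fun k =>
  (∑ j ∈ Finset.univ.erase k,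
      (Λ.strength j : ℂ) / (2 * Real.pi * I) * (1 / (Λ.center k - Λ.center j)))
    + I * Λ.cOmega * (starRingEnd ℂ) (Λ.center k)

/-- A configuration of distinct point vortices with non-zero strengths that collapses
self-similarly to the origin at the time `κ ∈ (0, ∞)`. -/
structure IsCollapsingPointVortex {M : ℕ} (Λ : VortexParams M) : Prop where
  distinct : Function.Injective Λ.center
  strength_ne_zero : ∀ k, Λ.strength k ≠ 0
  collapsing : Λ.cOmega.im < 0
  vortexMap_eq_zero : vortexMap Λ = 0

/-- Non-degeneracy: the (real) Jacobian of `𝓥` has full rank. -/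
def IsNondegenerate {M : ℕ} (Λ : VortexParams M) : Prop :=
  DifferentiableAt ℝ vortexMap Λ ∧ Function.Surjective (fderiv ℝ vortexMap Λ)

/-- `E` is a subspace of the parameter space such that the partial derivative of `𝓥` at `Λ` along
`E` is invertible (so that `E` has real dimension `2M`). -/
def IsAdmissibleSubspace {M : ℕ} (Λ : VortexParams M) (E : Submodule ℝ (VortexParams M)) : Prop :=
  Function.Bijective fun v : E => fderiv ℝ vortexMap Λ (v : VortexParams M)

/-- The collapsing trio: `(-2, 1, √7 i)` minus the collapse point `-(2 / √7) i`, with strengths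
`1, 2, -2/3`, `Ω = 35 / (264 π)` and `1 / κ = √7 / (132 π)`. -/
noncomputable def pointVortexTrio : VortexParams 3 :=
  (fun k => (![-2, 1, (Real.sqrt 7 : ℂ) * I] : Fin 3 → ℂ) k - (-(2 / (Real.sqrt 7 : ℂ)) * I),
    ![1, 2, -2 / 3],
    ((35 / (264 * Real.pi) : ℝ) : ℂ) - I / 2 * ((Real.sqrt 7 / (132 * Real.pi) : ℝ) : ℂ))

/-- The collapsing quartet, with centers at the corners of a parallelogram. -/
noncomputable def pointVortexQuartet : VortexParams 4 :=
  (![(Real.sqrt 3 : ℂ) / 2 - I / 2, 1 + (Real.sqrt 3 : ℂ) / 2 - I / 2,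
      -(Real.sqrt 3 : ℂ) / 2 - 1 + I / 2, -(Real.sqrt 3 : ℂ) / 2 + I / 2],
    ![(2 * Real.sqrt 3 + 5) * Real.pi, (Real.sqrt 3 - 4) * Real.pi,
      (Real.sqrt 3 - 4) * Real.pi, (2 * Real.sqrt 3 + 5) * Real.pi],
    2 * (Real.sqrt 3 : ℂ) - 3 / 4 - I / 2)

/-! ### The hollow vortex problem in the self-similar frame -/

/-- A configuration of `M` imploding hollow vortices, in the contracting and rotating frame
`x = exp(-T / (2κ)) R(ΩT) ξ`, `t = κ (1 - exp(-T / κ))`, in which it is steady. The plane is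
identified with `ℂ`, so that `ξ^⊥ = i ξ`. The vortex cores are `𝒱 k`, the relative velocity is `U`
and the relative pressure is `P`. The field `U + Ω ξ^⊥ - ξ / (2κ)` is the velocity in the
inertial frame at time zero; its circulation around the `k`-th core is `γ k`. -/
structure IsImplodingHollowVortex {M : ℕ} (κ Ω : ℝ) (γ : Fin M → ℝ) (𝒱 : Fin M → Set ℂ)
    (U : ℂ → ℂ) (P : ℂ → ℝ) : Prop where
  collapseTime_pos : 0 < κ
  core_isOpen : ∀ k, IsOpen (𝒱 k)
  core_isConnected : ∀ k, IsConnected (𝒱 k)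
  core_isBounded : ∀ k, Bornology.IsBounded (𝒱 k)
  core_disjoint : Pairwise fun j k => Disjoint (closure (𝒱 j)) (closure (𝒱 k))
  velocity_contDiffOn : ContDiffOn ℝ 1 U (⋃ k, closure (𝒱 k))ᶜ
  pressure_contDiffOn : ContDiffOn ℝ 1 P (⋃ k, closure (𝒱 k))ᶜ
  velocity_continuousOn : ContinuousOn U (closure (⋃ k, closure (𝒱 k))ᶜ)
  pressure_continuousOn : ContinuousOn P (closure (⋃ k, closure (𝒱 k))ᶜ)
  /-- `(U · ∇) U + 2 Ω U^⊥ - (1 / (4κ²) + Ω²) ξ = -∇P` in the fluid domain. -/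
  momentum : ∀ ξ ∈ (⋃ k, closure (𝒱 k))ᶜ,
    fderiv ℝ U ξ (U ξ) + 2 * (Ω : ℂ) * (I * U ξ) - ((1 / (4 * κ ^ 2) + Ω ^ 2 : ℝ) : ℂ) * ξ
      = -gradient P ξ
  /-- `∇ · U = 1 / κ` in the fluid domain. -/
  divergence : ∀ ξ ∈ (⋃ k, closure (𝒱 k))ᶜ,
    (fderiv ℝ U ξ 1).re + (fderiv ℝ U ξ I).im = 1 / κ
  /-- `∇^⊥ · U = -2 Ω` in the fluid domain. -/
  curl : ∀ ξ ∈ (⋃ k, closure (𝒱 k))ᶜ,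
    (fderiv ℝ U ξ 1).im - (fderiv ℝ U ξ I).re = -2 * Ω
  /-- The velocity in the inertial frame vanishes at infinity. -/
  velocity_infinity :
    Tendsto (fun ξ => U ξ + Ω * (I * ξ) - ξ / (2 * κ)) (cocompact ℂ) (𝓝 0)
  /-- The boundary of each core is a regular `C¹` Jordan curve `c`, positively oriented (the core
  lies on the left of `c`); the relative velocity is tangential there, and the circulation of the
  velocity in the inertial frame is `γ k`. -/
  boundary : ∀ k, ∃ c : ℝ → ℂ, ContDiff ℝ 1 c ∧ Function.Periodic c (2 * Real.pi) ∧
    InjOn c (Ico 0 (2 * Real.pi)) ∧ range c = frontier (𝒱 k) ∧ (∀ θ, deriv c θ ≠ 0) ∧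
    (∀ θ, ∀ᶠ ε : ℝ in 𝓝[>] 0, c θ + ε * (I * deriv c θ) ∈ 𝒱 k) ∧
    (∀ θ, inner ℝ (I * deriv c θ) (U (c θ)) = 0) ∧
    ∫ θ in (0 : ℝ)..(2 * Real.pi),
      inner ℝ (deriv c θ) (U (c θ) + Ω * (I * c θ) - c θ / (2 * κ)) = γ k
  /-- The pressure is constant on the boundary of each core. -/
  pressure_boundary : ∀ k, ∃ p : ℝ, ∀ ξ ∈ frontier (𝒱 k), P ξ = p

/-! ### The conformal formulation -/

/-- The circular domain `𝒟_ρ`: the complement of the closed disks of radius `|ρ|` about `ζ k`. -/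
def circularDomain {M : ℕ} (ζ : Fin M → ℂ) (ρ : ℝ) : Set ℂ := {η | ∀ k, |ρ| < ‖η - ζ k‖}

/-- The complement of the open disks; it is the closure of `𝒟_ρ` when `ρ ≠ 0` and the closed disks
are disjoint. -/
def closedCircularDomain {M : ℕ} (ζ : Fin M → ℂ) (ρ : ℝ) : Set ℂ := {η | ∀ k, |ρ| ≤ ‖η - ζ k‖}

/-- The relative velocity in conformal variables, `U - iV = w_ζ / f_ζ + i 𝛀 conj f`. Here and below
`f'` stands for `f_ζ` and `w'` for `w_ζ`; the potential `w` itself may be multivalued. -/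
noncomputable def conformalVelocity (cΩ : ℂ) (f f' w' : ℂ → ℂ) (η : ℂ) : ℂ :=
  w' η / f' η + I * cΩ * (starRingEnd ℂ) (f η)

/-- `(f, w)` solves the conformal formulation of the hollow vortex problem with parameters `Λ`,
conformal radius `|ρ|` and Bernoulli constants `q`. -/
structure IsConformalSolution {M : ℕ} (Λ : VortexParams M) (ρ : ℝ) (q : Fin M → ℝ)
    (f f' w' : ℂ → ℂ) : Prop where
  disks_disjoint : Pairwise fun j k => 2 * |ρ| < ‖Λ.center j - Λ.center k‖
  hasDerivAt : ∀ η ∈ circularDomain Λ.center ρ, HasDerivAt f (f' η) η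
  continuousOn_map : ContinuousOn f (closedCircularDomain Λ.center ρ)
  continuousOn_deriv : ContinuousOn f' (closedCircularDomain Λ.center ρ)
  deriv_ne_zero : ∀ η ∈ closedCircularDomain Λ.center ρ, f' η ≠ 0
  injOn : InjOn f (closedCircularDomain Λ.center ρ)
  map_infinity : Tendsto (fun η => f η - η) (cocompact ℂ) (𝓝 0)
  potential_differentiableOn : DifferentiableOn ℂ w' (circularDomain Λ.center ρ)
  potential_continuousOn : ContinuousOn w' (closedCircularDomain Λ.center ρ)
  potential_infinity : Tendsto w' (cocompact ℂ) (𝓝 0)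
  circulation : ∀ k, (∮ η in C(Λ.center k, |ρ|), w' η).re = Λ.strength k
  kinematic : ∀ k, ∀ η ∈ Metric.sphere (Λ.center k) |ρ|,
    ((η - Λ.center k) * f' η * conformalVelocity Λ.cOmega f f' w' η).re = 0
  dynamic : ∀ k, ∀ η ∈ Metric.sphere (Λ.center k) |ρ|,
    1 / 2 * ‖conformalVelocity Λ.cOmega f f' w' η‖ ^ 2 - 1 / 2 * ‖Λ.cOmega‖ ^ 2 * ‖f η‖ ^ 2 = q k

/-- The layer potential
`𝓩^ρ[μ](η) = 1 / (2πi) ∑ₖ ∫_𝕋 μₖ(σ) / (ρσ + ζₖ - η) ρ dσ`, with `σ = exp(iθ)`. -/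
noncomputable def layerPotential {M : ℕ} {ℓ : ℕ} {α : ℝ} (ρ : ℝ) (ζ : Fin M → ℂ)
    (μ : Fin M → HolderCircle ℓ α) (η : ℂ) : ℂ :=
  1 / (2 * Real.pi * I) * ∑ k, ∫ θ in (0 : ℝ)..(2 * Real.pi),
    (μ k (Circle.exp θ) : ℂ) / (ρ * (Circle.exp θ : ℂ) + ζ k - η)
      * (ρ * (I * (Circle.exp θ : ℂ)))

/-- A real-analytic curve, parameterized by the signed conformal radius `ρ ∈ (-ρ₁, ρ₁)`, of
imploding hollow vortex configurations that bifurcates from the point vortex configuration `Λ₀`,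
with parameters varying in `Λ₀ + E`. The unknowns are densities `μ, ν` in the space
`C^{ℓ+α}(𝕋)^M` of mean zero functions, normalized Bernoulli constants `Q`, the parameters `Λ`, and
the imaginary parts `β` of the complex circulations of `w` around the vortices. -/
structure IsImplodingCurve {M : ℕ} (ℓ : ℕ) (α : ℝ) (Λ₀ : VortexParams M)
    (E : Submodule ℝ (VortexParams M)) (ρ₁ : ℝ) (μ ν : ℝ → Fin M → HolderCircle ℓ α)
    (Q β : ℝ → Fin M → ℝ) (Λ : ℝ → VortexParams M) : Prop where
  pos : 0 < ρ₁
  analytic_μ : AnalyticOnNhd ℝ μ (Ioo (-ρ₁) ρ₁)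
  analytic_ν : AnalyticOnNhd ℝ ν (Ioo (-ρ₁) ρ₁)
  analytic_Q : AnalyticOnNhd ℝ Q (Ioo (-ρ₁) ρ₁)
  analytic_β : AnalyticOnNhd ℝ β (Ioo (-ρ₁) ρ₁)
  analytic_Λ : AnalyticOnNhd ℝ Λ (Ioo (-ρ₁) ρ₁)
  μ_zero : μ 0 = 0
  ν_zero : ν 0 = 0
  Q_zero : Q 0 = 0
  β_zero : β 0 = 0
  Λ_zero : Λ 0 = Λ₀
  mean_μ : ∀ ρ ∈ Ioo (-ρ₁) ρ₁, ∀ k, ∫ θ in (0 : ℝ)..(2 * Real.pi), μ ρ k (Circle.exp θ) = 0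
  mean_ν : ∀ ρ ∈ Ioo (-ρ₁) ρ₁, ∀ k, ∫ θ in (0 : ℝ)..(2 * Real.pi), ν ρ k (Circle.exp θ) = 0
  Λ_mem : ∀ ρ ∈ Ioo (-ρ₁) ρ₁, Λ ρ - Λ₀ ∈ E
  imploding : ∀ ρ ∈ Ioo (-ρ₁) ρ₁, (Λ ρ).cOmega.im < 0
  strength_ne_zero : ∀ ρ ∈ Ioo (-ρ₁) ρ₁, ∀ k, (Λ ρ).strength k ≠ 0
  /-- For `ρ ≠ 0`, the data represent an imploding hollow vortex configuration through
  `f = id + ρ² 𝓩^ρ[μ]` and `w = ∑ₖ (γₖ + i βₖ) / (2πi) log(· - ζₖ) + ρ 𝓩^ρ[ν]`, both in conformal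
  variables and in the self-similar frame, where the fluid domain is `f(𝒟_ρ)`. -/
  solution : ∀ ρ ∈ Ioo (-ρ₁) ρ₁, ρ ≠ 0 →
    ∃ (f f' w' : ℂ → ℂ) (𝒱 : Fin M → Set ℂ) (U : ℂ → ℂ) (P : ℂ → ℝ),
      (∀ η ∈ circularDomain (Λ ρ).center ρ,
        f η = η + ρ ^ 2 * layerPotential ρ (Λ ρ).center (μ ρ) η) ∧
      (∀ η ∈ circularDomain (Λ ρ).center ρ,
        w' η = (∑ k, (((Λ ρ).strength k : ℂ) + I * β ρ k) / (2 * Real.pi * I)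
            * (1 / (η - (Λ ρ).center k)))
          + ρ * deriv (layerPotential ρ (Λ ρ).center (ν ρ)) η) ∧
      IsConformalSolution (Λ ρ) ρ
        (fun k => (Λ ρ).strength k ^ 2 / (8 * Real.pi ^ 2 * ρ ^ 2) + Q ρ k / (2 * ρ)) f f' w' ∧
      (⋃ k, closure (𝒱 k))ᶜ = f '' circularDomain (Λ ρ).center ρ ∧
      (∀ k, frontier (𝒱 k) = f '' Metric.sphere ((Λ ρ).center k) |ρ|) ∧
      (∀ η ∈ closedCircularDomain (Λ ρ).center ρ,
        U (f η) = (starRingEnd ℂ) (conformalVelocity (Λ ρ).cOmega f f' w' η)) ∧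
      IsImplodingHollowVortex (Λ ρ).collapseTime (Λ ρ).angular (Λ ρ).strength 𝒱 U P

/-! A small hollow vortex is a perturbation of a point vortex, and the curve is found by an implicit
function theorem at radius `ρ = 0`. On the `k`-th circle, `ρσ f_ζ` times the relative velocity
equals `γ / (2πi) + ρ g` with `g` regular at `ρ = 0`. The kinematic condition becomes `Re g = 0`.
The Bernoulli condition, multiplied by `2ρ|f_ζ|² / γ`, loses its singular terms and becomes `Re (i g
/ π) + ... = 0`, where every nonlinear term carries a factor `ρ`. The unknowns attached to a vortex
are the pole coefficients `C` of the velocity and `D` of `f_ζ`, the Bernoulli constant `Q`, the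
imaginary circulation `b` and the velocity defect `v = 𝓥ₖ(Λ)`. Replacing `Λ` by `v` is legitimate
because the derivative of `𝓥` is invertible on the chosen subspace (`exists_analytic_vortexParams`).
At `ρ = 0` the circles decouple and both conditions become linear with constant coefficients
(`opKin_zero_vac`, `opDyn_zero_vac`). The operator `decode` inverts them mode by mode
(`decode_linear`). The equation therefore reads `F (ρ, x) = 0` with `F (0, x) = x` near the origin,
and `exists_analytic_curve` solves it. Analyticity is cheap because the Hölder space is left aside.
Boundary functions are Laurent series with weights `2^|n|`, and multiplications are bounded
operators on `ℓ¹`. The interaction of distinct vortices is then made of inverses and power series in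
a Banach algebra. Evaluation at points of the circle (`HasSymbol`) translates operator identities
back into boundary identities. Thanks to the weights, the coefficients map boundedly into every
`C^{ℓ+α}(𝕋)` (`holderDensity`), and the layer potentials of these densities are exactly the pole
series (`layerPotential_holderDensity`). For the physical flow, the conformal map is extended by a
Lipschitz reflection to a homeomorphism of the plane close to the identity (`norm_confExt_sub_le`),
so that the cores are images of disks. Bernoulli's law defines the pressure
(`momentum_frameVelocity`). All this works for any collapsing configuration with an admissible
subspace (`IsCollapsingPointVortex.exists_isImplodingCurve`). For the trio and the quartet it
remains to check `𝓥 = 0` and non-degeneracy. The latter holds because a functional that kills the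
range of the derivative solves a linear system with only the zero solution
(`surjective_of_annihilator`). -/

/-! ### Absolutely summable sequences -/

/-- The space of absolutely summable complex families. -/
abbrev Ell (ι : Type) : Type := lp (fun _ : ι => ℂ) 1

namespace Ell

variable {ι : Type} {E F : Type*} [NormedAddCommGroup E] [NormedSpace ℝ E]
  [NormedAddCommGroup F] [NormedSpace ℝ F]

theorem hasSum_norm (a : Ell ι) : HasSum (fun i => ‖a i‖) ‖a‖ := by
  simpa using lp.hasSum_norm (p := 1) (by simp) a

theorem summable_norm (a : Ell ι) : Summable fun i => ‖a i‖ := a.hasSum_norm.summable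

/-- The inclusion of the `i`-th coordinate. -/
noncomputable def single [DecidableEq ι] (i : ι) : ℂ →L[ℝ] Ell ι :=
  lp.singleContinuousLinearMap ℝ (fun _ : ι => ℂ) 1 i

theorem norm_single_le [DecidableEq ι] (i : ι) : ‖single i‖ ≤ 1 := by
  refine ContinuousLinearMap.opNorm_le_bound _ zero_le_one fun c => ?_
  rw [one_mul]
  exact (lp.norm_single (E := fun _ : ι => ℂ) (p := 1) (by simp) i c).le

theorem single_apply [DecidableEq ι] (i j : ι) (c : ℂ) : single i c j = if j = i then c else 0 := by
  by_cases h : j = i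
  · subst h; simp [single]
  · simp [single, h]

theorem hasSum_single [DecidableEq ι] (a : Ell ι) : HasSum (fun i => single i (a i)) a :=
  lp.hasSum_single (E := fun _ : ι => ℂ) (p := 1) (by simp) a

/-- Finite families are dense in `ℓ¹`, so an identity of bounded operators can be tested on one mode
at a time. Most operator identities below are proved this way. -/
theorem continuousLinearMap_ext [DecidableEq ι]
    {S T : Ell ι →L[ℝ] E} (h : ∀ i c, S (single i c) = T (single i c)) :
    S = T := by
  ext a
  have hS := (a.hasSum_single).mapL S
  have hT := (a.hasSum_single).mapL T
  simp only [h] at hS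
  exact hS.unique hT

/-- The `i`-th coordinate. -/
noncomputable def coord (i : ι) : Ell ι →L[ℝ] ℂ :=
  LinearMap.mkContinuous
    { toFun := fun a => a i, map_add' := fun _ _ => rfl, map_smul' := fun _ _ => rfl } 1
    fun a => by
      rw [one_mul]
      exact lp.norm_apply_le_norm (by simp) a i

@[simp] theorem coord_apply (i : ι) (a : Ell ι) : coord i a = a i := rfl

theorem norm_coord_le (i : ι) : ‖coord i‖ ≤ 1 :=
  LinearMap.mkContinuous_norm_le _ zero_le_one _

theorem summable_lift {v : ι → ℂ →L[ℝ] E} {K : ℝ} (hv : ∀ i, ‖v i‖ ≤ K) (a : Ell ι) :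
    Summable fun i => ‖v i (a i)‖ :=
  (a.summable_norm.mul_left K).of_nonneg_of_le (fun _ => norm_nonneg _) fun i =>
    (v i).le_of_opNorm_le (hv i) _

/-- The universal property: a bounded family of linear maps extends to the summable families. -/
noncomputable def lift [CompleteSpace E] (v : ι → ℂ →L[ℝ] E) (K : ℝ)
    (hv : ∀ i, ‖v i‖ ≤ K) : Ell ι →L[ℝ] E :=
  LinearMap.mkContinuous
    { toFun := fun a => ∑' i, v i (a i)
      map_add' := fun a b => by
        rw [← ((summable_lift hv a).of_norm).tsum_add ((summable_lift hv b).of_norm)]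
        simp
      map_smul' := fun c a => by
        rw [RingHom.id_apply, ← ((summable_lift hv a).of_norm).tsum_const_smul c]
        exact tsum_congr fun i => (v i).map_smul c (a i) } K
    fun a => by
      have h1 := norm_tsum_le_tsum_norm (summable_lift hv a)
      have h2 := (summable_lift hv a).tsum_le_tsum
        (fun i => (v i).le_of_opNorm_le (hv i) (a i)) (a.summable_norm.mul_left K)
      rw [tsum_mul_left, a.hasSum_norm.tsum_eq] at h2
      exact h1.trans h2

theorem lift_apply [CompleteSpace E] (v : ι → ℂ →L[ℝ] E) (K : ℝ)
    (hv : ∀ i, ‖v i‖ ≤ K) (a : Ell ι) :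
    lift v K hv a = ∑' i, v i (a i) := rfl

theorem hasSum_lift [CompleteSpace E] (v : ι → ℂ →L[ℝ] E) (K : ℝ)
    (hv : ∀ i, ‖v i‖ ≤ K) (a : Ell ι) :
    HasSum (fun i => v i (a i)) (lift v K hv a) :=
  (summable_lift hv a).of_norm.hasSum

theorem norm_lift_le [CompleteSpace E] (v : ι → ℂ →L[ℝ] E) (K : ℝ) (hK : 0 ≤ K)
    (hv : ∀ i, ‖v i‖ ≤ K) :
    ‖lift v K hv‖ ≤ K :=
  LinearMap.mkContinuous_norm_le _ hK _

theorem lift_single [CompleteSpace E] [DecidableEq ι] (v : ι → ℂ →L[ℝ] E)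
    (K : ℝ) (hv : ∀ i, ‖v i‖ ≤ K) (i : ι) (c : ℂ) :
    lift v K hv (single i c) = v i c := by
  rw [lift_apply, tsum_eq_single i]
  · simp [single_apply]
  · intro j hj
    simp [single_apply, hj]

end Ell

/-! ### Power series with summable coefficients -/

/-- The sum of the power series `∑ₙ cₙ w ^ (n + 1)`. -/
noncomputable def psum (c : Ell ℕ) (w : ℂ) : ℂ := ∑' n, c n * w ^ (n + 1)

theorem summable_norm_psum (c : Ell ℕ) {w : ℂ} (hw : ‖w‖ ≤ 1) :
    Summable fun n => ‖c n * w ^ (n + 1)‖ :=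
  c.summable_norm.of_nonneg_of_le (fun _ => norm_nonneg _) fun n => by
    rw [norm_mul, norm_pow]
    exact mul_le_of_le_one_right (norm_nonneg _) (pow_le_one₀ (norm_nonneg _) hw)

theorem hasSum_psum (c : Ell ℕ) {w : ℂ} (hw : ‖w‖ ≤ 1) :
    HasSum (fun n => c n * w ^ (n + 1)) (psum c w) :=
  (summable_norm_psum c hw).of_norm.hasSum

/-! ### Power series evaluated in a Banach algebra. -/

section BanachAlgebra

variable {A : Type*} [NormedRing A] [NormedAlgebra ℝ A] {ι : ℂ →L[ℝ] A}

variable (ι) in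
/-- The sum of the power series `∑ₙ ι cₙ w ^ (n + 1)` in a Banach algebra. -/
noncomputable def bsum (c : Ell ℕ) (w : A) : A := ∑' n, ι (c n) * w ^ (n + 1)

theorem norm_pow_succ_le_one {w : A} (hw : ‖w‖ ≤ 1) (n : ℕ) : ‖w ^ (n + 1)‖ ≤ 1 :=
  (norm_pow_le' w n.succ_pos).trans (pow_le_one₀ (norm_nonneg _) hw)

theorem norm_mul_pow_succ_le (hι : ‖ι‖ ≤ 1) {w : A} (hw : ‖w‖ ≤ 1) (n : ℕ) (c : ℂ) :
    ‖ι c * w ^ (n + 1)‖ ≤ ‖c‖ := by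
  refine (norm_mul_le _ _).trans ((mul_le_of_le_one_right (norm_nonneg _)
    (norm_pow_succ_le_one hw n)).trans ?_)
  simpa using ι.le_of_opNorm_le hι c

variable [CompleteSpace A]

theorem hasSum_bsum (hι : ‖ι‖ ≤ 1) (c : Ell ℕ) {w : A} (hw : ‖w‖ ≤ 1) :
    HasSum (fun n => ι (c n) * w ^ (n + 1)) (bsum ι c w) :=
  (Summable.of_norm (c.summable_norm.of_nonneg_of_le (fun _ => norm_nonneg _)
    fun n => norm_mul_pow_succ_le hι hw n _)).hasSum

/-- The sum of the power series as a linear function of the coefficients. -/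
noncomputable def bsumCLM (hι : ‖ι‖ ≤ 1) (w : A) (hw : ‖w‖ ≤ 1) : Ell ℕ →L[ℝ] A :=
  Ell.lift (fun n => ((ContinuousLinearMap.mul ℝ A).flip (w ^ (n + 1))) ∘L ι) 1
    fun n => ContinuousLinearMap.opNorm_le_bound _ zero_le_one fun c => by
      rw [one_mul]
      exact norm_mul_pow_succ_le hι hw n c

variable (ι) in
/-- The power series, with values in the linear functions of the coefficients. -/
noncomputable def bsumSeries : FormalMultilinearSeries ℝ A (Ell ℕ →L[ℝ] A)
  | 0 => 0
  | n + 1 => ((ContinuousLinearMap.mul ℝ A) ∘L ι ∘L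
      Ell.coord n).flip.compContinuousMultilinearMap
        (ContinuousMultilinearMap.mkPiAlgebraFin ℝ (n + 1) A)

theorem norm_bsumSeries_le (hι : ‖ι‖ ≤ 1) (n : ℕ) : ‖bsumSeries ι n‖ ≤ 1 := by
  cases n with
  | zero =>
    exact (norm_zero (E := ContinuousMultilinearMap ℝ (fun _ : Fin 0 => A)
      (Ell ℕ →L[ℝ] A))).trans_le zero_le_one
  | succ n =>
    refine (ContinuousLinearMap.norm_compContinuousMultilinearMap_le _ _).trans ?_
    refine mul_le_one₀ ?_ (norm_nonneg _) ContinuousMultilinearMap.norm_mkPiAlgebraFin_succ_le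
    rw [ContinuousLinearMap.opNorm_flip]
    refine (ContinuousLinearMap.opNorm_comp_le _ _).trans ?_
    refine mul_le_one₀ (ContinuousLinearMap.opNorm_mul_le ℝ A) (norm_nonneg _) ?_
    exact (ContinuousLinearMap.opNorm_comp_le _ _).trans
      (mul_le_one₀ hι (norm_nonneg _) (Ell.norm_coord_le n))

theorem one_le_radius_bsumSeries (hι : ‖ι‖ ≤ 1) : 1 ≤ (bsumSeries ι).radius := by
  have := (bsumSeries ι).le_radius_of_bound (r := 1) 1 fun n => by
    simpa using norm_bsumSeries_le hι n
  simpa using this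

theorem bsumSeries_sum_apply (hι : ‖ι‖ ≤ 1) {w : A} (hw : ‖w‖ < 1) (c : Ell ℕ) :
    (bsumSeries ι).sum w c = bsum ι c w := by
  have hw' : w ∈ Metric.eball (0 : A) (bsumSeries ι).radius := by
    refine Metric.eball_subset_eball (one_le_radius_bsumSeries hι) ?_
    rw [← ENNReal.ofReal_one, Metric.eball_ofReal]
    simpa using hw
  have h1 := ((bsumSeries ι).hasSum hw').mapL (ContinuousLinearMap.apply ℝ A c)
  -- The zeroth term of the formal series is zero, so a shift of the index by one aligns it with
  -- `bsum`.
  have h2 := (hasSum_nat_add_iff' 1).mpr h1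
  refine HasSum.unique ?_ (hasSum_bsum hι c hw.le)
  simpa [bsumSeries, pow_succ'] using h2

/-- Joint analyticity: the sum is a power series in `w` alone, of radius at least one, with values
in the linear functions of `c`, and evaluation at `c` is bilinear. The point `w = 0` is enough,
since the arguments used later vanish with `ρ`. -/
theorem analyticAt_bsum (hι : ‖ι‖ ≤ 1) (c : Ell ℕ) :
    AnalyticAt ℝ (fun p : Ell ℕ × A => bsum ι p.1 p.2) (c, 0) := by
  have h1 : AnalyticAt ℝ (bsumSeries ι).sum 0 :=
    ((bsumSeries ι).hasFPowerSeriesOnBall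
      (zero_lt_one.trans_le (one_le_radius_bsumSeries hι))).analyticAt
  have h2 : AnalyticAt ℝ (fun p : Ell ℕ × A => (bsumSeries ι).sum p.2) (c, 0) :=
    AnalyticAt.fun_comp (f := Prod.snd) h1 analyticAt_snd
  have h3 : AnalyticAt ℝ (fun p : Ell ℕ × A => (bsumSeries ι).sum p.2 p.1) (c, 0) :=
    ((ContinuousLinearMap.id ℝ (Ell ℕ →L[ℝ] A)).analyticAt_bilinear
      ((bsumSeries ι).sum (0 : A), c)).fun_comp
        (f := fun p : Ell ℕ × A => ((bsumSeries ι).sum p.2, p.1))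
      (h2.prod analyticAt_fst)
  refine h3.congr ?_
  have : ∀ᶠ p : Ell ℕ × A in 𝓝 (c, 0), ‖p.2‖ < 1 :=
    (continuous_snd.norm.tendsto (c, (0 : A))).eventually_lt_const (by simp)
  filter_upwards [this] with p hp
  exact bsumSeries_sum_apply hι hp p.1

end BanachAlgebra

/-! ### Operators on the weighted Wiener algebra -/

namespace Wiener

/-- The bounded operators on the space of Laurent coefficients. -/
abbrev Op : Type := Ell ℤ →L[ℝ] Ell ℤ

/-- The weighted shift, that is the multiplication by `σ`. -/
noncomputable def shift : Op :=
  -- The coordinate `n` stands for the function `2^(-|n|) σ^n`. Passing to `n + 1` therefore costs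
  -- `2` when `|n|` increases and `1/2` when it decreases.
  Ell.lift (fun n => (if 0 ≤ n then 2 else 1 / 2 : ℝ) • Ell.single (n + 1)) 2 fun n => by
    rw [norm_smul]
    refine (mul_le_mul (b := 2) ?_ (Ell.norm_single_le _) (norm_nonneg _) two_pos.le).trans
      (by norm_num)
    split_ifs <;> norm_num

/-- The multiplication by `σ⁻¹`. -/
noncomputable def unshift : Op :=
  Ell.lift (fun n => (if 1 ≤ n then 1 / 2 else 2 : ℝ) • Ell.single (n - 1)) 2 fun n => by
    rw [norm_smul]
    refine (mul_le_mul (b := 2) ?_ (Ell.norm_single_le _) (norm_nonneg _) two_pos.le).trans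
      (by norm_num)
    split_ifs <;> norm_num

theorem norm_unshift_le : ‖unshift‖ ≤ 2 := Ell.norm_lift_le _ _ two_pos.le _

/-- The complex conjugation of functions on the circle. -/
noncomputable def flip : Op :=
  Ell.lift (fun n => Ell.single (-n) ∘L (conjCLE : ℂ →L[ℝ] ℂ)) 1 fun n => by
    refine ContinuousLinearMap.opNorm_le_bound _ zero_le_one fun c => ?_
    rw [one_mul, ContinuousLinearMap.comp_apply]
    refine ((Ell.single (-n)).le_of_opNorm_le (Ell.norm_single_le _) _).trans ?_
    simp

/-- The multiplication by a complex number. -/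
noncomputable def cmul : ℂ →L[ℝ] Op := ContinuousLinearMap.lsmul ℝ ℂ

theorem norm_cmul_le (c : ℂ) : ‖cmul c‖ ≤ ‖c‖ :=
  ContinuousLinearMap.opNorm_le_bound _ (norm_nonneg _) fun a => (norm_smul c a).le

theorem cmul_apply (c : ℂ) (a : Ell ℤ) : cmul c a = c • a := rfl

theorem cmul_single (c d : ℂ) (n : ℤ) : cmul c (Ell.single n d) = Ell.single n (c * d) := by
  refine lp.ext (funext fun j => ?_)
  rw [cmul_apply]
  change c * Ell.single n d j = _
  simp only [Ell.single_apply, mul_ite, mul_zero]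

theorem shift_single (c : ℂ) (n : ℤ) :
    shift (Ell.single n c) = (if 0 ≤ n then 2 else 1 / 2 : ℝ) • Ell.single (n + 1) c := by
  rw [shift, Ell.lift_single]; rfl

theorem unshift_single (c : ℂ) (n : ℤ) :
    unshift (Ell.single n c) = (if 1 ≤ n then 1 / 2 else 2 : ℝ) • Ell.single (n - 1) c := by
  rw [unshift, Ell.lift_single]; rfl

theorem flip_single (c : ℂ) (n : ℤ) :
    flip (Ell.single n c) = Ell.single (-n) ((starRingEnd ℂ) c) := by
  rw [flip, Ell.lift_single]; rfl

theorem shift_mul_unshift : shift * unshift = 1 := by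
  refine Ell.continuousLinearMap_ext fun n c => ?_
  rw [mul_apply_eq_comp, unshift_single, map_smul, shift_single, smul_smul,
    sub_add_cancel]
  have : ((if 1 ≤ n then 1 / 2 else 2 : ℝ) * if 0 ≤ n - 1 then 2 else 1 / 2) = 1 := by
    split_ifs <;> first | omega | norm_num
  rw [this, one_smul]; rfl

/-- The evaluation at a point of the circle of the function with given coefficients. -/
noncomputable def ev (σ : Circle) : Ell ℤ →L[ℝ] ℂ :=
  Ell.lift (fun n => (ContinuousLinearMap.mul ℝ ℂ) ((1 / 2 : ℂ) ^ n.natAbs * (σ : ℂ) ^ n)) 1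
    fun n => by
      refine (ContinuousLinearMap.opNorm_mul_apply_le ℝ ℂ _).trans ?_
      rw [norm_mul, norm_zpow, Circle.norm_coe, one_zpow, mul_one, norm_pow]
      exact pow_le_one₀ (norm_nonneg _) (by norm_num)

theorem ev_single (σ : Circle) (n : ℤ) (c : ℂ) :
    ev σ (Ell.single n c) = (1 / 2 : ℂ) ^ n.natAbs * (σ : ℂ) ^ n * c := by
  rw [ev, Ell.lift_single]; rfl

/-- The operator `T` acts as the multiplication by `τ` on the values at `σ`. -/
def HasSymbol (σ : Circle) (T : Op) (τ : ℂ) : Prop := ∀ a, ev σ (T a) = τ * ev σ a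

namespace HasSymbol

variable {σ : Circle} {T U : Op} {τ υ : ℂ}

theorem of_single (h : ∀ n c, ev σ (T (Ell.single n c)) = τ * ev σ (Ell.single n c)) :
    HasSymbol σ T τ := by
  have : ev σ ∘L T = (ContinuousLinearMap.mul ℝ ℂ τ) ∘L ev σ :=
    Ell.continuousLinearMap_ext h
  exact fun a => DFunLike.congr_fun this a

theorem one : HasSymbol σ 1 1 := fun a => by simp

theorem add (hT : HasSymbol σ T τ) (hU : HasSymbol σ U υ) : HasSymbol σ (T + U) (τ + υ) :=
  fun a => by rw [add_apply, map_add, hT, hU, add_mul]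

theorem sub (hT : HasSymbol σ T τ) (hU : HasSymbol σ U υ) : HasSymbol σ (T - U) (τ - υ) :=
  fun a => by rw [sub_apply, map_sub, hT, hU, sub_mul]

theorem mul (hT : HasSymbol σ T τ) (hU : HasSymbol σ U υ) : HasSymbol σ (T * U) (τ * υ) :=
  fun a => by rw [mul_apply_eq_comp, hT, hU, mul_assoc]

theorem pow (hT : HasSymbol σ T τ) (n : ℕ) : HasSymbol σ (T ^ n) (τ ^ n) := by
  induction n with
  | zero => simpa using one
  | succ n ih => rw [pow_succ, pow_succ]; exact ih.mul hT

theorem smul (hT : HasSymbol σ T τ) (r : ℝ) : HasSymbol σ (r • T) (r * τ) :=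
  fun a => by
    rw [smul_apply, map_smul, hT, real_smul, mul_assoc]

theorem sum {κ : Type*} {s : Finset κ} {T : κ → Op} {τ : κ → ℂ}
    (h : ∀ k ∈ s, HasSymbol σ (T k) (τ k)) : HasSymbol σ (∑ k ∈ s, T k) (∑ k ∈ s, τ k) :=
  fun a => by
    rw [sum_apply, map_sum, Finset.sum_mul]
    exact Finset.sum_congr rfl fun k hk => h k hk a

theorem cmul (c : ℂ) : HasSymbol σ (cmul c) c :=
  of_single fun n d => by rw [cmul_single, ev_single, ev_single]; ring

theorem shift : HasSymbol σ shift σ := by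
  refine of_single fun n c => ?_
  have hσ : (σ : ℂ) ≠ 0 := Circle.coe_ne_zero σ
  rw [shift_single, map_smul, ev_single, ev_single, real_smul, zpow_add_one₀ hσ]
  have : (((if 0 ≤ n then 2 else 1 / 2 : ℝ) : ℝ) : ℂ) * (1 / 2 : ℂ) ^ (n + 1).natAbs
      = (1 / 2 : ℂ) ^ n.natAbs := by
    split_ifs with h
    · rw [show (n + 1).natAbs = n.natAbs + 1 by omega, pow_succ]; push_cast; ring
    · rw [show n.natAbs = (n + 1).natAbs + 1 by omega, pow_succ]; push_cast; ring
  linear_combination (σ : ℂ) ^ n * σ * c * this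

theorem of_mul_eq_one (h : T * U = 1) (hT : HasSymbol σ T τ) :
    HasSymbol σ U τ⁻¹ := by
  have key : ∀ a, τ * ev σ (U a) = ev σ a := fun a => by
    rw [← hT, ← mul_apply_eq_comp, h]; rfl
  -- The evaluation is a nonzero functional: it takes the value `1` on the zeroth mode.
  have hτ : τ ≠ 0 := by
    rintro rfl
    have := key (Ell.single 0 1)
    rw [ev_single] at this
    simp at this
  intro a
  rw [← key a, inv_mul_cancel_left₀ hτ]

theorem inverse (hT : HasSymbol σ T τ) (h : IsUnit T) : HasSymbol σ (Ring.inverse T) τ⁻¹ :=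
  of_mul_eq_one (Ring.mul_inverse_cancel T h) hT

theorem unshift : HasSymbol σ unshift (σ : ℂ)⁻¹ := by
  refine of_single fun n c => ?_
  have hσ : (σ : ℂ) ≠ 0 := Circle.coe_ne_zero σ
  rw [unshift_single, map_smul, ev_single, ev_single, real_smul, zpow_sub_one₀ hσ]
  have : (((if 1 ≤ n then 1 / 2 else 2 : ℝ) : ℝ) : ℂ) * (1 / 2 : ℂ) ^ (n - 1).natAbs
      = (1 / 2 : ℂ) ^ n.natAbs := by
    split_ifs with h
    · rw [show n.natAbs = (n - 1).natAbs + 1 by omega, pow_succ]; push_cast; ring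
    · rw [show (n - 1).natAbs = n.natAbs + 1 by omega, pow_succ]; push_cast; ring
  linear_combination (σ : ℂ) ^ n * (σ : ℂ)⁻¹ * c * this

theorem ev_flip (a : Ell ℤ) : ev σ (Wiener.flip a) = (starRingEnd ℂ) (ev σ a) := by
  have : ev σ ∘L Wiener.flip = (conjCLE : ℂ →L[ℝ] ℂ) ∘L ev σ := by
    refine Ell.continuousLinearMap_ext fun n c => ?_
    change ev σ (Wiener.flip (Ell.single n c)) = (starRingEnd ℂ) (ev σ (Ell.single n c))
    rw [flip_single, ev_single, ev_single, map_mul, map_mul, map_pow, map_zpow₀,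
      ← Circle.coe_inv_eq_conj, Int.natAbs_neg, zpow_neg, Circle.coe_inv, inv_zpow, map_div₀,
      map_one, map_ofNat]
  exact DFunLike.congr_fun this a

theorem conj (hT : HasSymbol σ T τ) :
    HasSymbol σ (Wiener.flip * T * Wiener.flip) ((starRingEnd ℂ) τ) := fun a => by
  rw [mul_apply_eq_comp, mul_apply_eq_comp, ev_flip, hT, ev_flip, map_mul,
    conj_conj]

end HasSymbol

theorem norm_cmul_clm_le : ‖cmul‖ ≤ 1 :=
  ContinuousLinearMap.opNorm_le_bound _ zero_le_one fun c => by
    rw [one_mul]; exact norm_cmul_le c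

/-- The power series `∑ₙ cₙ T ^ (n + 1)` at an operator. -/
noncomputable def opsum (c : Ell ℕ) (T : Op) : Op := bsum cmul c T

theorem HasSymbol.opsum {σ : Circle} {T : Op} {τ : ℂ} (c : Ell ℕ) (hT : ‖T‖ ≤ 1) (hτ : ‖τ‖ ≤ 1)
    (h : HasSymbol σ T τ) : HasSymbol σ (opsum c T) (psum c τ) := fun a => by
  have h1 := ((hasSum_bsum norm_cmul_clm_le c hT).mapL
    (ContinuousLinearMap.apply ℝ (Ell ℤ) a)).mapL (ev σ)
  have h2 := (hasSum_psum c hτ).mul_right (ev σ a)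
  have h3 : (fun n => ev σ ((Wiener.cmul (c n) * T ^ (n + 1)) a))
      = fun n => c n * τ ^ (n + 1) * ev σ a :=
    funext fun n => ((HasSymbol.cmul (c n)).mul (h.pow (n + 1))) a
  exact h1.unique (h3 ▸ h2)

end Wiener

/-! ### Modes -/

namespace Ell

/-- The termwise integration of a power series: division of the `n`-th coefficient by `n + 1`. -/
noncomputable def integ : Ell ℕ →L[ℝ] Ell ℕ :=
  lift (fun n => ((n + 1 : ℝ)⁻¹) • single n) 1 fun n => by
    rw [norm_smul]
    refine mul_le_one₀ ?_ (norm_nonneg _) (norm_single_le n)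
    rw [norm_inv, Real.norm_of_nonneg (by positivity)]
    exact inv_le_one_of_one_le₀ (by simp)

theorem coord_integ (n : ℕ) (a : Ell ℕ) : integ a n = a n / (n + 1) := by
  have : coord n ∘L integ = ((n + 1 : ℝ)⁻¹) • coord n := by
    refine continuousLinearMap_ext fun i c => ?_
    simp only [ContinuousLinearMap.comp_apply, integ, lift_single, coord_apply]
    change (((i + 1 : ℝ)⁻¹) • single i c) n = ((n + 1 : ℝ)⁻¹) • (single i c n)
    change ((i + 1 : ℝ)⁻¹) • (single i c n) = _
    rw [single_apply]
    split_ifs with h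
    · rw [h]
    · simp
  have h := DFunLike.congr_fun this a
  change integ a n = ((n + 1 : ℝ)⁻¹) • a n at h
  rw [h, real_smul]
  push_cast
  ring

/-- The removal of the first coefficient. -/
noncomputable def tail : Ell ℕ →L[ℝ] Ell ℕ :=
  lift (fun n => if n = 0 then 0 else single (n - 1)) 1 fun n => by
    split_ifs
    · simp
    · exact norm_single_le _

theorem coord_tail (n : ℕ) (a : Ell ℕ) : tail a n = a (n + 1) := by
  have : coord n ∘L tail = coord (n + 1) := by
    refine continuousLinearMap_ext fun i c => ?_
    simp only [ContinuousLinearMap.comp_apply, tail, lift_single, coord_apply]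
    cases i with
    | zero => simp [single_apply]
    | succ i => simp [single_apply]
  exact DFunLike.congr_fun this a

theorem tail_single_zero (c : ℂ) : tail (single 0 c) = 0 := by simp [tail, lift_single]

theorem tail_single_succ (n : ℕ) (c : ℂ) : tail (single (n + 1) c) = single n c := by
  simp [tail, lift_single]

/-- The positive modes of twice the real part of a Laurent series. -/
noncomputable def halfModes : Ell ℤ →L[ℝ] Ell ℕ :=
  lift (fun n => if n < 0 then single (n.natAbs - 1) else if n = 0 then 0 else
    single (n.natAbs - 1) ∘L (conjCLE : ℂ →L[ℝ] ℂ)) 1 fun n => by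
    split_ifs
    · exact norm_single_le _
    · simp
    · refine ContinuousLinearMap.opNorm_le_bound _ zero_le_one fun c => ?_
      refine ((single _).le_of_opNorm_le (norm_single_le _) _).trans ?_
      simp

theorem halfModes_single_zero (c : ℂ) : halfModes (single 0 c) = 0 := by
  simp [halfModes, lift_single]

theorem halfModes_single_pos (n : ℕ) (c : ℂ) :
    halfModes (single ((n : ℤ) + 1) c) = single n ((starRingEnd ℂ) c) := by
  rw [halfModes, lift_single, if_neg (by omega), if_neg (by omega)]
  have : ((n : ℤ) + 1).natAbs - 1 = n := by omega
  rw [this]; rfl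

theorem halfModes_single_neg (n : ℕ) (c : ℂ) :
    halfModes (single (-((n : ℤ) + 1)) c) = single n c := by
  rw [halfModes, lift_single, if_pos (by omega)]
  have : (-((n : ℤ) + 1)).natAbs - 1 = n := by omega
  rw [this]

theorem coord_halfModes (n : ℕ) (a : Ell ℤ) :
    halfModes a n = a (-((n : ℤ) + 1)) + (starRingEnd ℂ) (a ((n : ℤ) + 1)) := by
  have : coord n ∘L halfModes = coord (-((n : ℤ) + 1)) +
      (conjCLE : ℂ →L[ℝ] ℂ) ∘L coord ((n : ℤ) + 1) := by
    refine continuousLinearMap_ext fun i c => ?_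
    change halfModes (single i c) n = single i c (-((n : ℤ) + 1)) +
      (starRingEnd ℂ) (single i c ((n : ℤ) + 1))
    obtain ⟨m, rfl | rfl⟩ | rfl : (∃ m : ℕ, i = (m : ℤ) + 1 ∨ i = -((m : ℤ) + 1)) ∨ i = 0 := by
      rcases lt_trichotomy i 0 with h | h | h
      · exact Or.inl ⟨(-i - 1).toNat, Or.inr (by omega)⟩
      · exact Or.inr h
      · exact Or.inl ⟨(i - 1).toNat, Or.inl (by omega)⟩
    · rw [halfModes_single_pos]
      simp only [single_apply]
      rw [if_neg (show ¬ (-((n : ℤ) + 1) = m + 1) by omega)]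
      by_cases h : n = m
      · simp [h]
      · rw [if_neg h, if_neg (by omega)]; simp
    · rw [halfModes_single_neg]
      simp only [single_apply]
      rw [if_neg (show ¬ ((n : ℤ) + 1 = -(m + 1)) by omega)]
      by_cases h : n = m
      · simp [h]
      · rw [if_neg h, if_neg (by omega)]; simp
    · rw [halfModes_single_zero]
      simp only [single_apply]
      rw [if_neg (by omega), if_neg (by omega)]
      simp
  exact DFunLike.congr_fun this a

end Ell

/-! ### Real parts of Laurent series and their modes. -/

namespace Wiener

theorem coord_flip (n : ℤ) (a : Ell ℤ) : flip a n = (starRingEnd ℂ) (a (-n)) := by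
  have : Ell.coord n ∘L flip = (conjCLE : ℂ →L[ℝ] ℂ) ∘L Ell.coord (-n) := by
    refine Ell.continuousLinearMap_ext fun i c => ?_
    change flip (Ell.single i c) n = (starRingEnd ℂ) (Ell.single i c (-n))
    rw [flip_single, Ell.single_apply, Ell.single_apply]
    by_cases h : n = -i
    · rw [if_pos h, if_pos (by omega)]
    · rw [if_neg h, if_neg (by omega), map_zero]
  exact DFunLike.congr_fun this a

/-- A Laurent series without mean and modes has vanishing real part on the circle. -/
theorem re_ev_eq_zero {a : Ell ℤ} (h0 : (a 0).re = 0) (h : Ell.halfModes a = 0) (σ : Circle) :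
    (ev σ a).re = 0 := by
  have hn : ∀ n : ℕ, a (-((n : ℤ) + 1)) + (starRingEnd ℂ) (a ((n : ℤ) + 1)) = 0 := fun n => by
    rw [← Ell.coord_halfModes, h]; rfl
  -- A function plus its conjugate is twice its real part. The two hypotheses say that all its
  -- coordinates vanish.
  have key : a + flip a = 0 := by
    refine lp.ext (funext fun i => ?_)
    change a i + flip a i = 0
    rw [coord_flip]
    obtain ⟨m, rfl | rfl⟩ | rfl : (∃ m : ℕ, i = (m : ℤ) + 1 ∨ i = -((m : ℤ) + 1)) ∨ i = 0 := by
      rcases lt_trichotomy i 0 with h | h | h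
      · exact Or.inl ⟨(-i - 1).toNat, Or.inr (by omega)⟩
      · exact Or.inr h
      · exact Or.inl ⟨(i - 1).toNat, Or.inl (by omega)⟩
    · have := congrArg (starRingEnd ℂ) (hn m)
      rw [map_add, conj_conj, map_zero] at this
      linear_combination this
    · rw [neg_neg]; exact hn m
    · rw [neg_zero, add_conj, h0]; simp
  have h2 := congrArg (ev σ) key
  rw [map_add, HasSymbol.ev_flip, map_zero, add_conj] at h2
  exact_mod_cast (mul_eq_zero.mp
    (by exact_mod_cast h2 : 2 * (ev σ a).re = 0)).resolve_left two_ne_zero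

/-- The vacuum vector, whose function is the constant one. -/
noncomputable def vac : Ell ℤ := Ell.single 0 1

/-- A multiplication operator applied to the constant function returns its multiplier. This is the
passage from operators to boundary functions. -/
theorem HasSymbol.ev_vac {σ : Circle} {T : Op} {τ : ℂ} (h : HasSymbol σ T τ) :
    ev σ (T vac) = τ := by
  rw [h, vac, ev_single]; simp

/-- The Laurent series with the given negative modes. -/
noncomputable def negModes : Ell ℕ →L[ℝ] Ell ℤ :=
  Ell.lift (fun n : ℕ => Ell.single (-((n : ℤ) + 1))) 1 fun _ => Ell.norm_single_le _

theorem negModes_single (n : ℕ) (c : ℂ) :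
    negModes (Ell.single n c) = Ell.single (-((n : ℤ) + 1)) c := by
  rw [negModes, Ell.lift_single]

theorem norm_half_unshift_le : ‖(1 / 2 : ℝ) • unshift‖ ≤ 1 := by
  rw [norm_smul]
  refine (mul_le_mul_of_nonneg_left norm_unshift_le (norm_nonneg _)).trans ?_
  norm_num

/-- The factor `1/2` cancels the weight of `unshift` on nonpositive modes, so the `n`-th power sends
the vacuum to the unit vector of mode `-n`. The series of a vortex on its own circle is thus a
relabelling of its coefficients. -/
theorem opsum_unshift_vac (c : Ell ℕ) : opsum c ((1 / 2 : ℝ) • unshift) vac = negModes c := by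
  have hpow : ∀ n : ℕ, (((1 / 2 : ℝ) • unshift) ^ n) vac = Ell.single (-(n : ℤ)) 1 := fun n => by
    induction n with
    | zero => simp [vac]
    | succ n ih =>
      rw [pow_succ', mul_apply_eq_comp, ih, smul_apply, unshift_single, if_neg (by omega),
        smul_smul]
      have h1 : (1 / 2 * 2 : ℝ) = 1 := by norm_num
      have h2 : -(n : ℤ) - 1 = -((n + 1 : ℕ) : ℤ) := by push_cast; ring
      rw [h1, one_smul, h2]
  have h1 := (hasSum_bsum norm_cmul_clm_le c norm_half_unshift_le).mapL
    (ContinuousLinearMap.apply ℝ (Ell ℤ) vac)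
  have h2 := Ell.hasSum_lift (fun n : ℕ => Ell.single (-((n : ℤ) + 1))) 1
      (fun _ => Ell.norm_single_le _) c
  refine h1.unique ?_
  have h3 : (fun n : ℕ => Ell.single (-((n : ℤ) + 1)) (c n)) = fun n =>
      (ContinuousLinearMap.apply ℝ (Ell ℤ)) vac
        (cmul (c n) * ((1 / 2 : ℝ) • unshift) ^ (n + 1)) := funext fun n => by
    change _ = cmul (c n) ((((1 / 2 : ℝ) • unshift) ^ (n + 1)) vac)
    rw [hpow, cmul_single, mul_one, Nat.cast_succ]
  exact h3 ▸ h2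

theorem halfModes_negModes (c : Ell ℕ) : Ell.halfModes (negModes c) = c := by
  have : Ell.halfModes ∘L negModes = ContinuousLinearMap.id ℝ _ := by
    refine Ell.continuousLinearMap_ext fun n c => ?_
    rw [ContinuousLinearMap.comp_apply, negModes_single, Ell.halfModes_single_neg]; rfl
  exact DFunLike.congr_fun this c

theorem negModes_zero_mode (c : Ell ℕ) : negModes c 0 = 0 := by
  have : Ell.coord 0 ∘L negModes = 0 := by
    refine Ell.continuousLinearMap_ext fun n c => ?_
    rw [ContinuousLinearMap.comp_apply, negModes_single, Ell.coord_apply, Ell.single_apply,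
      if_neg (by omega)]; rfl
  exact DFunLike.congr_fun this c

theorem unshift_negModes_single (n : ℕ) (c : ℂ) :
    unshift (negModes (Ell.single n c)) = (2 : ℝ) • Ell.single (-(((n + 1 : ℕ) : ℤ) + 1)) c := by
  rw [negModes_single, unshift_single, if_neg (by omega)]
  congr 3

theorem unshift_negModes_zero_mode (c : Ell ℕ) : unshift (negModes c) 0 = 0 := by
  have : Ell.coord 0 ∘L unshift ∘L negModes = 0 := by
    refine Ell.continuousLinearMap_ext fun n c => ?_
    rw [ContinuousLinearMap.comp_apply, ContinuousLinearMap.comp_apply, unshift_negModes_single,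
      map_smul, Ell.coord_apply, Ell.single_apply, if_neg (by omega), smul_zero]; rfl
  exact DFunLike.congr_fun this c

/-- The additional factor `σ⁻¹` empties the first harmonic. The conformal map is therefore absent
from the first harmonic of the limiting Bernoulli equation, which leaves room there for the velocity
defect. -/
theorem halfModes_unshift_negModes_zero (c : Ell ℕ) :
    Ell.halfModes (unshift (negModes c)) 0 = 0 := by
  have : Ell.coord 0 ∘L Ell.halfModes ∘L unshift ∘L negModes = 0 := by
    refine Ell.continuousLinearMap_ext fun n c => ?_
    rw [ContinuousLinearMap.comp_apply, ContinuousLinearMap.comp_apply,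
      ContinuousLinearMap.comp_apply, unshift_negModes_single,
      map_smul, Ell.halfModes_single_neg, map_smul, Ell.coord_apply, Ell.single_apply,
      if_neg (by omega), smul_zero]; rfl
  exact DFunLike.congr_fun this c

theorem tail_halfModes_unshift_negModes (c : Ell ℕ) :
    Ell.tail (Ell.halfModes (unshift (negModes c))) = (2 : ℝ) • c := by
  have : Ell.tail ∘L Ell.halfModes ∘L unshift ∘L negModes =
      (2 : ℝ) • ContinuousLinearMap.id ℝ _ := by
    refine Ell.continuousLinearMap_ext fun n c => ?_
    rw [ContinuousLinearMap.comp_apply, ContinuousLinearMap.comp_apply,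
      ContinuousLinearMap.comp_apply, unshift_negModes_single,
      map_smul, Ell.halfModes_single_neg, map_smul, Ell.tail_single_succ]; rfl
  exact DFunLike.congr_fun this c

/-! ### The linearized problem and its solution operator. -/

/-- The unknowns attached to one vortex: the coefficients of the densities of the potential and of
the conformal map, the Bernoulli constant, the imaginary circulation and the velocity defect. -/
abbrev Unknown : Type := Ell ℕ × Ell ℕ × ℝ × ℝ × ℂ

/-- Multiplication by a complex number on coefficients. -/
noncomputable def cscale {ι : Type} (c : ℂ) : Ell ι →L[ℝ] Ell ι := ContinuousLinearMap.lsmul ℝ ℂ c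

theorem cscale_apply {ι : Type} (c : ℂ) (a : Ell ι) (i : ι) : cscale c a i = c * a i := rfl

theorem cscale_single {ι : Type} [DecidableEq ι] (c d : ℂ) (i : ι) :
    cscale c (Ell.single i d) = Ell.single i (c * d) := by
  refine lp.ext (funext fun j => ?_)
  rw [cscale_apply]
  simp only [Ell.single_apply, mul_ite, mul_zero]

theorem negModes_cscale (c : ℂ) (a : Ell ℕ) : negModes (cscale c a) = cscale c (negModes a) := by
  have : negModes ∘L cscale c = cscale c ∘L negModes := by
    refine Ell.continuousLinearMap_ext fun n d => ?_
    simp only [ContinuousLinearMap.comp_apply, cscale_single, negModes_single]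
  exact DFunLike.congr_fun this a

/-- The solution operator of the linearized problem. -/
noncomputable def decode : Ell ℤ × Ell ℤ →L[ℝ] Unknown :=
  let R₁ : Ell ℤ × Ell ℤ →L[ℝ] Ell ℕ := Ell.halfModes ∘L ContinuousLinearMap.fst ℝ _ _
  let R₂ : Ell ℤ × Ell ℤ →L[ℝ] Ell ℕ := Ell.halfModes ∘L ContinuousLinearMap.snd ℝ _ _
  let m : Ell ℤ × Ell ℤ →L[ℝ] ℂ := Ell.coord 0 ∘L R₁ +
    (ContinuousLinearMap.mul ℝ ℂ (I * Real.pi)) ∘L Ell.coord 0 ∘L R₂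
  ContinuousLinearMap.prod (-R₁ + (1 / 2 : ℝ) • (Ell.single 0 ∘L m))
    (ContinuousLinearMap.prod (Ell.tail ∘L (Real.pi ^ 2 • R₂ - cscale (I * Real.pi) ∘L R₁))
      (ContinuousLinearMap.prod
        (-(reCLM ∘L Ell.coord 0 ∘L ContinuousLinearMap.snd ℝ (Ell ℤ) (Ell ℤ)))
        (ContinuousLinearMap.prod
          ((2 * Real.pi) • (reCLM ∘L Ell.coord 0 ∘L ContinuousLinearMap.fst ℝ (Ell ℤ) (Ell ℤ)))
          ((1 / 4 : ℝ) • ((conjCLE : ℂ →L[ℝ] ℂ) ∘L m)))))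

theorem decode_apply (a₁ a₂ : Ell ℤ) : decode (a₁, a₂) =
    (-Ell.halfModes a₁ + (1 / 2 : ℝ) • Ell.single 0
        (Ell.halfModes a₁ 0 + I * Real.pi * Ell.halfModes a₂ 0),
      Ell.tail (Real.pi ^ 2 • Ell.halfModes a₂ - cscale (I * Real.pi) (Ell.halfModes a₁)),
      -(a₂ 0).re, 2 * Real.pi * (a₁ 0).re,
      (1 / 4 : ℝ) • (starRingEnd ℂ) (Ell.halfModes a₁ 0 + I * Real.pi * Ell.halfModes a₂ 0)) := rfl

/-- The system is triangular. The last component removes the correction in the first one, which then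
gives the modes of `a₁`. The second gives the modes of `a₂` beyond the first, and the last gives the
first one. -/
theorem decode_eq_zero {a₁ a₂ : Ell ℤ} (h : decode (a₁, a₂) = 0) :
    (a₁ 0).re = 0 ∧ Ell.halfModes a₁ = 0 ∧ (a₂ 0).re = 0 ∧ Ell.halfModes a₂ = 0 := by
  have hpi : (Real.pi : ℂ) ≠ 0 := by exact_mod_cast Real.pi_ne_zero
  rw [decode_apply] at h
  simp only [Prod.mk_eq_zero, neg_eq_zero, mul_eq_zero, OfNat.ofNat_ne_zero, Real.pi_ne_zero,
    false_or, smul_eq_zero, map_eq_zero, one_div, inv_eq_zero] at h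
  obtain ⟨h1, h2, h3, h4, h5⟩ := h
  rw [h5, map_zero, smul_zero, add_zero, neg_eq_zero] at h1
  refine ⟨h4, h1, h3, ?_⟩
  rw [h1, map_zero, sub_zero, map_smul, smul_eq_zero] at h2
  have h2' := h2.resolve_left (pow_ne_zero 2 Real.pi_ne_zero)
  rw [h1] at h5
  refine lp.ext (funext fun n => ?_)
  cases n with
  | zero =>
    have : I * Real.pi * Ell.halfModes a₂ 0 = 0 := by simpa using h5
    exact (mul_eq_zero.mp this).resolve_left (mul_ne_zero I_ne_zero hpi)
  | succ n =>
    rw [← Ell.coord_tail, h2']; rfl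

/-- The hypotheses describe the two defects at radius zero. Their first harmonics involve `v` and `C
0` with different relative signs, because `v` passes through a conjugation that turns `i` into `-i`.
Adding `iπ` times the second to the first cancels `C 0` and leaves four times the conjugate of `v`.
The higher harmonics determine `C` and then `D`, and the means give `b` and `Q`. -/
theorem decode_linear (C D : Ell ℕ) (Q b : ℝ) (v : ℂ) (a₁ a₂ : Ell ℤ)
    (h₁ : a₁ = Ell.single 0 (b / (2 * Real.pi)) + Ell.single 1 (2 * v) - negModes C)
    (h₂ : a₂ = cscale (I / Real.pi) a₁ - Ell.single 0 (Q : ℂ) +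
      (1 / (2 * Real.pi ^ 2)) • unshift (negModes D)) :
    decode (a₁, a₂) = (C, D, Q, b, v) := by
  have hpi : (Real.pi : ℂ) ≠ 0 := by exact_mod_cast Real.pi_ne_zero
  have e1 : Ell.halfModes a₁ = Ell.single 0 ((starRingEnd ℂ) (2 * v)) - C := by
    rw [h₁, map_sub, map_add, Ell.halfModes_single_zero, zero_add, halfModes_negModes]
    exact congrArg (· - C) (Ell.halfModes_single_pos 0 _)
  have e2 : a₂ = Ell.single 0 (I / Real.pi * (b / (2 * Real.pi))) +
      Ell.single 1 (I / Real.pi * (2 * v)) - negModes (cscale (I / Real.pi) C)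
      - Ell.single 0 (Q : ℂ) + (1 / (2 * Real.pi ^ 2)) • unshift (negModes D) := by
    rw [h₂, h₁, map_sub, map_add, cscale_single, cscale_single, negModes_cscale]
  have e3 : Ell.halfModes a₂ = Ell.single 0 ((starRingEnd ℂ) (I / Real.pi * (2 * v)))
      - cscale (I / Real.pi) C
      + (1 / (2 * Real.pi ^ 2)) • Ell.halfModes (unshift (negModes D)) := by
    rw [e2, map_add, map_sub, map_sub, map_add, Ell.halfModes_single_zero,
      Ell.halfModes_single_zero, zero_add, sub_zero, halfModes_negModes, map_smul]
    exact congrArg (· - _ + _) (Ell.halfModes_single_pos 0 _)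
  have z1 : a₁ 0 = b / (2 * Real.pi) := by
    rw [h₁]
    change Ell.single 0 _ 0 + Ell.single 1 _ 0 - negModes C 0 = _
    rw [negModes_zero_mode, Ell.single_apply, Ell.single_apply]
    simp
  have z2 : a₂ 0 = I / Real.pi * (b / (2 * Real.pi)) - Q := by
    rw [e2]
    change Ell.single 0 (I / Real.pi * (b / (2 * Real.pi))) 0
      + Ell.single 1 (I / Real.pi * (2 * v)) 0 - negModes (cscale (I / Real.pi) C) 0
      - Ell.single 0 (Q : ℂ) 0 + (1 / (2 * Real.pi ^ 2)) • (unshift (negModes D) 0) = _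
    rw [negModes_zero_mode, unshift_negModes_zero_mode, Ell.single_apply, Ell.single_apply,
      Ell.single_apply]
    simp
  have m1 : Ell.halfModes a₁ 0 = (starRingEnd ℂ) (2 * v) - C 0 := by
    rw [e1]
    change Ell.single 0 _ 0 - C 0 = _
    rw [Ell.single_apply, if_pos rfl]
  have m2 : Ell.halfModes a₂ 0 = (starRingEnd ℂ) (I / Real.pi * (2 * v)) - I / Real.pi * C 0 := by
    rw [e3]
    change Ell.single 0 _ 0 - I / Real.pi * C 0
      + (1 / (2 * Real.pi ^ 2)) • (Ell.halfModes (unshift (negModes D)) 0) = _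
    rw [Ell.single_apply, if_pos rfl, halfModes_unshift_negModes_zero, smul_zero, add_zero]
  have m : Ell.halfModes a₁ 0 + I * Real.pi * Ell.halfModes a₂ 0 = 4 * (starRingEnd ℂ) v := by
    rw [m1, m2]
    simp only [map_mul, map_div₀, conj_I, conj_ofReal, map_ofNat]
    field_simp
    linear_combination (2 * (starRingEnd ℂ) v) * (-1 : ℂ) * I_sq - (C 0) * I_sq
  rw [decode_apply, m]
  refine Prod.ext ?_ (Prod.ext ?_ (Prod.ext ?_ (Prod.ext ?_ ?_)))
  · change -Ell.halfModes a₁ + (1 / 2 : ℝ) • Ell.single 0 (4 * (starRingEnd ℂ) v) = C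
    rw [e1, ← map_smul]
    have : (1 / 2 : ℝ) • (4 * (starRingEnd ℂ) v) = (starRingEnd ℂ) (2 * v) := by
      rw [real_smul, map_mul, map_ofNat]; push_cast; ring
    rw [this]
    abel
  · change Ell.tail (Real.pi ^ 2 • Ell.halfModes a₂ - cscale (I * Real.pi) (Ell.halfModes a₁)) = D
    rw [e1, e3, smul_add, smul_sub, map_sub, map_add, map_sub, map_sub, map_sub, ← map_smul,
      Ell.tail_single_zero, cscale_single, Ell.tail_single_zero, smul_smul, map_smul _ (_ * _),
      tail_halfModes_unshift_negModes, smul_smul]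
    have e4 : Real.pi ^ 2 • cscale (I / Real.pi) C = cscale (I * Real.pi) C := by
      refine lp.ext (funext fun n => ?_)
      change Real.pi ^ 2 • (I / Real.pi * C n) = I * Real.pi * C n
      rw [real_smul]
      push_cast
      field_simp
    rw [e4]
    have : Real.pi ^ 2 * (1 / (2 * Real.pi ^ 2)) * 2 = 1 := by field_simp
    rw [this, one_smul]
    abel
  · change -(a₂ 0).re = Q
    rw [z2]
    have : (I / Real.pi * (b / (2 * Real.pi)) : ℂ) =
        I * ((1 / Real.pi * (b / (2 * Real.pi)) : ℝ) : ℂ) := by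
      push_cast; ring
    rw [this, sub_re, I_mul_re, ofReal_im, ofReal_re]
    ring
  · change 2 * Real.pi * (a₁ 0).re = b
    rw [z1]
    have : (b / (2 * Real.pi) : ℂ) = ((b / (2 * Real.pi) : ℝ) : ℂ) := by push_cast; ring
    rw [this, ofReal_re]
    field_simp
  · change (1 / 4 : ℝ) • (starRingEnd ℂ) (4 * (starRingEnd ℂ) v) = v
    rw [map_mul, map_ofNat, conj_conj, real_smul]
    push_cast
    ring

end Wiener

/-! ### Analytic inverse and implicit functions -/

theorem exists_analytic_right_inverse {E F : Type*} [NormedAddCommGroup E] [NormedSpace ℝ E]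
    [CompleteSpace E] [NormedAddCommGroup F] [NormedSpace ℝ F] [CompleteSpace F] {f : E → F} {a : E}
    (hf : AnalyticAt ℝ f a) (h : Function.Bijective (fderiv ℝ f a)) :
    ∃ g : F → E, AnalyticAt ℝ g (f a) ∧ g (f a) = a ∧ ∀ᶠ y in 𝓝 (f a), f (g y) = y := by
  obtain ⟨e, he⟩ : ∃ e : E ≃L[ℝ] F, (e : E →L[ℝ] F) = fderiv ℝ f a :=
    ⟨ContinuousLinearEquiv.ofBijective (fderiv ℝ f a) (LinearMap.ker_eq_bot.mpr h.1)
      (LinearMap.range_eq_top.mpr h.2), ContinuousLinearEquiv.coe_ofBijective _ _ _⟩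
  have hs : HasStrictFDerivAt f (e : E →L[ℝ] F) a := he ▸ hf.hasStrictFDerivAt
  exact ⟨hs.localInverse f e a,
    hs.toOpenPartialHomeomorph.analyticAt_symm' hs.mem_toOpenPartialHomeomorph_source hf he.symm,
    hs.localInverse_apply_image, hs.eventually_right_inverse⟩

/-- The implicit function theorem, as the inverse function theorem for `(ρ, x) ↦ (ρ, F (ρ, x))`.
Since `F (0, ·)` is the identity near the origin, the derivative of this map is triangular with
identities on the diagonal. -/
theorem exists_analytic_curve {X : Type*} [NormedAddCommGroup X] [NormedSpace ℝ X]
    [CompleteSpace X] {F : ℝ × X → X} (hF : AnalyticAt ℝ F (0, 0))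
    (h0 : ∀ᶠ x in 𝓝 (0 : X), F (0, x) = x) :
    ∃ x : ℝ → X, AnalyticAt ℝ x 0 ∧ x 0 = 0 ∧ ∀ᶠ ρ in 𝓝 (0 : ℝ), F (ρ, x ρ) = 0 := by
  have hΦ : AnalyticAt ℝ (fun p : ℝ × X => (p.1, F p)) (0, 0) := analyticAt_fst.prod hF
  have hFd := hF.differentiableAt.hasFDerivAt
  have hΦd : HasFDerivAt (fun p : ℝ × X => (p.1, F p))
      ((ContinuousLinearMap.fst ℝ ℝ X).prod (fderiv ℝ F (0, 0))) (0, 0) :=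
    hasFDerivAt_fst.prodMk hFd
  have hpart : ∀ x, fderiv ℝ F (0, 0) (0, x) = x := fun x => by
    have h1 : HasFDerivAt (fun x : X => F (0, x))
        ((fderiv ℝ F (0, 0)) ∘L (ContinuousLinearMap.inr ℝ ℝ X)) 0 :=
      HasFDerivAt.comp (f := fun x : X => ((0 : ℝ), x)) 0 hFd (hasFDerivAt_prodMk_right 0 0)
    have h2 : HasFDerivAt (fun x : X => F (0, x)) (ContinuousLinearMap.id ℝ X) 0 :=
      (hasFDerivAt_id (0 : X)).congr_of_eventuallyEq h0
    exact DFunLike.congr_fun (h1.unique h2) x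
  have hF0 : F (0, 0) = 0 := h0.self_of_nhds
  obtain ⟨g, hg, hg0, hgr⟩ := exists_analytic_right_inverse hΦ (by
    rw [hΦd.fderiv]
    constructor
    · rw [← ContinuousLinearMap.coe_coe, ← LinearMap.ker_eq_bot, LinearMap.ker_eq_bot']
      rintro ⟨r, x⟩ h
      obtain ⟨h1, h2⟩ := Prod.ext_iff.mp h
      change r = 0 at h1
      subst h1
      have : x = 0 := (hpart x).symm.trans h2
      rw [this]; rfl
    · rintro ⟨r, y⟩
      -- Back substitution in the triangular system: the contribution of `r` is subtracted from the
      -- second component.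
      refine ⟨(r, y - fderiv ℝ F (0, 0) (r, 0)), Prod.ext rfl ?_⟩
      change fderiv ℝ F (0, 0) (r, y - fderiv ℝ F (0, 0) (r, 0)) = y
      have : (r, y - fderiv ℝ F (0, 0) (r, 0))
          = (r, (0 : X)) + ((0 : ℝ), y - fderiv ℝ F (0, 0) (r, 0)) := by simp
      rw [this, map_add, hpart]
      abel)
  simp only [hF0] at hg hg0 hgr
  have hl : AnalyticAt ℝ (fun ρ : ℝ => ((ρ, 0) : ℝ × X)) 0 := analyticAt_id.prod analyticAt_const
  refine ⟨fun ρ => (g (ρ, 0)).2, ?_, congrArg Prod.snd hg0, ?_⟩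
  · exact analyticAt_snd.fun_comp (f := fun ρ : ℝ => g (ρ, 0))
      (hg.fun_comp (f := fun ρ : ℝ => (ρ, (0 : X))) hl)
  · have := hl.continuousAt.eventually (p := fun y => ((g y).1, F (g y)) = y) hgr
    filter_upwards [this] with ρ hρ
    obtain ⟨h1, h2⟩ := Prod.ext_iff.mp hρ
    dsimp only at h1 h2
    have h3 : (ρ, (g (ρ, 0)).2) = g (ρ, 0) := Prod.ext h1.symm rfl
    rw [h3, h2]

/-! ### The conformal map and the velocity -/

section Conformal

variable {M : ℕ}

/-- The sum over the vortices of power series in `ρ / (η - ζ j)`. -/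
noncomputable def poleSum (ρ : ℝ) (ζ : Fin M → ℂ) (a : Fin M → Ell ℕ) (η : ℂ) : ℂ :=
  ∑ j, psum (a j) (ρ / (η - ζ j) / 2)

/-- The sum over the vortices of power series in `ρ / (η - ζ j)` that vanish to second order. -/
noncomputable def poleDer (ρ : ℝ) (ζ : Fin M → ℂ) (a : Fin M → Ell ℕ) (η : ℂ) : ℂ :=
  ∑ j, ρ / (η - ζ j) * psum (a j) (ρ / (η - ζ j) / 2)

/-- The conformal map with derivative coefficients `D`. -/
noncomputable def confMap (ρ : ℝ) (ζ : Fin M → ℂ) (D : Fin M → Ell ℕ) (η : ℂ) : ℂ :=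
  η + ρ ^ 2 * poleSum ρ ζ (fun j => Ell.integ (D j)) η

/-- The derivative of the conformal map. -/
noncomputable def confDer (ρ : ℝ) (ζ : Fin M → ℂ) (D : Fin M → Ell ℕ) (η : ℂ) : ℂ :=
  1 - ρ * poleDer ρ ζ D η

/-- The complex velocity in conformal variables. -/
noncomputable def confVel (ρ : ℝ) (ζ : Fin M → ℂ) (γ β : Fin M → ℝ) (C : Fin M → Ell ℕ) (η : ℂ) :
    ℂ :=
  (∑ j, ((γ j : ℂ) + I * β j) / (2 * Real.pi * I) * (1 / (η - ζ j))) - poleDer ρ ζ C η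

end Conformal

/-! ### The boundary conditions as operators on the circles. -/

namespace Wiener

variable {M : ℕ}

/-- The complex conjugation of multiplication operators. -/
noncomputable def conjOp (T : Op) : Op := flip * T * flip

theorem HasSymbol.conjOp {σ : Circle} {T : Op} {τ : ℂ} (h : HasSymbol σ T τ) :
    HasSymbol σ (conjOp T) ((starRingEnd ℂ) τ) := h.conj

/-- The operator of multiplication by `1 / (ζ k - ζ j + ρ σ)`. -/
noncomputable def opInv (ρ : ℝ) (ζ : Fin M → ℂ) (k j : Fin M) : Op :=
  Ring.inverse (cmul (ζ k - ζ j) + ρ • shift)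

/-- `poleSum` on the `k`-th circle. -/
noncomputable def opPoleSum (ρ : ℝ) (ζ : Fin M → ℂ) (a : Fin M → Ell ℕ) (k : Fin M) : Op :=
  opsum (a k) ((1 / 2 : ℝ) • unshift) +
    ∑ j ∈ Finset.univ.erase k, opsum (a j) ((ρ / 2) • opInv ρ ζ k j)

/-- `poleDer` on the `k`-th circle. -/
noncomputable def opPoleDer (ρ : ℝ) (ζ : Fin M → ℂ) (a : Fin M → Ell ℕ) (k : Fin M) : Op :=
  unshift * opsum (a k) ((1 / 2 : ℝ) • unshift) +
    ∑ j ∈ Finset.univ.erase k, (ρ • opInv ρ ζ k j) * opsum (a j) ((ρ / 2) • opInv ρ ζ k j)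

/-- `confMap` on the `k`-th circle. -/
noncomputable def opMap (ρ : ℝ) (ζ : Fin M → ℂ) (D : Fin M → Ell ℕ) (k : Fin M) : Op :=
  cmul (ζ k) + ρ • shift + ρ ^ 2 • opPoleSum ρ ζ (fun j => Ell.integ (D j)) k

/-- `confDer` on the `k`-th circle. -/
noncomputable def opDer (ρ : ℝ) (ζ : Fin M → ℂ) (D : Fin M → Ell ℕ) (k : Fin M) : Op :=
  1 - ρ • opPoleDer ρ ζ D k

/-- The kinematic defect on the `k`-th circle. -/
noncomputable def opKin (ρ : ℝ) (Λ : VortexParams M) (C D : Fin M → Ell ℕ) (b : Fin M → ℝ)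
    (k : Fin M) : Op :=
  cmul ((b k / (2 * Real.pi) : ℝ) : ℂ) + shift * (∑ j ∈ Finset.univ.erase k,
      cmul (((Λ.strength j : ℂ) + I * ((ρ * b j : ℝ) : ℂ)) / (2 * Real.pi * I))
        * opInv ρ Λ.center k j)
    - shift * opPoleDer ρ Λ.center C k
    + shift * opDer ρ Λ.center D k * cmul (I * Λ.cOmega) * conjOp (opMap ρ Λ.center D k)

/-- The Bernoulli defect on the `k`-th circle. -/
noncomputable def opDyn (ρ : ℝ) (Λ : VortexParams M) (C D : Fin M → Ell ℕ) (Q b : Fin M → ℝ)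
    (k : Fin M) : Op :=
  cmul (I / Real.pi) * opKin ρ Λ C D b k
    + (ρ / Λ.strength k) • (opKin ρ Λ C D b k * conjOp (opKin ρ Λ C D b k))
    - (ρ / Λ.strength k * normSq Λ.cOmega) • (opDer ρ Λ.center D k * conjOp (opDer ρ Λ.center D k)
        * (opMap ρ Λ.center D k * conjOp (opMap ρ Λ.center D k)))
    - Q k • (opDer ρ Λ.center D k * conjOp (opDer ρ Λ.center D k))
    + (Λ.strength k / (4 * Real.pi ^ 2)) • ((2 : ℝ) • opPoleDer ρ Λ.center D k
        - ρ • (opPoleDer ρ Λ.center D k * conjOp (opPoleDer ρ Λ.center D k)))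

/-! ### Symbols -/

/-- The operators of multiplication by the functions of `poleSum` are well defined. -/
def Admissible (ρ : ℝ) (ζ : Fin M → ℂ) : Prop :=
  ρ ≠ 0 ∧ ∀ k j, j ≠ k → 2 * |ρ| < ‖ζ k - ζ j‖ ∧ IsUnit (cmul (ζ k - ζ j) + ρ • shift) ∧
    ‖(ρ / 2) • opInv ρ ζ k j‖ ≤ 1

theorem norm_pole_le_one {ρ : ℝ} {ζ η : ℂ} (h : |ρ| ≤ ‖η - ζ‖) : ‖(ρ : ℂ) / (η - ζ)‖ ≤ 1 := by
  rw [norm_div, norm_real, Real.norm_eq_abs]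
  exact div_le_one_of_le₀ h (norm_nonneg _)

theorem norm_half_pole_le {ρ : ℝ} {ζ η : ℂ} (h : |ρ| ≤ ‖η - ζ‖) :
    ‖(ρ : ℂ) / (η - ζ) / 2‖ ≤ 1 / 2 := by
  rw [norm_div, Complex.norm_ofNat]
  linarith [norm_pole_le_one h]

section Symbols

variable {ρ : ℝ} {ζ : Fin M → ℂ} (h : Admissible ρ ζ) (k : Fin M) (σ : Circle)

include h

theorem Admissible.abs_le (j : Fin M) : |ρ| ≤ ‖ζ k + ρ * σ - ζ j‖ := by
  have hn : ‖(ρ : ℂ) * σ‖ = |ρ| := by rw [norm_mul, Circle.norm_coe, norm_real]; simp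
  by_cases hj : j = k
  · subst hj
    rw [add_sub_cancel_left, hn]
  · have h1 := (h.2 k j hj).1
    have h2 := norm_sub_le (ζ k + ρ * σ - ζ j) (ρ * σ)
    rw [hn, show ζ k + ρ * σ - ζ j - ρ * σ = ζ k - ζ j by ring] at h2
    linarith

theorem Admissible.symbol_opInv {j : Fin M} (hj : j ≠ k) :
    HasSymbol σ (opInv ρ ζ k j) (ζ k + ρ * σ - ζ j)⁻¹ := by
  have := ((HasSymbol.cmul (σ := σ) (ζ k - ζ j)).add (HasSymbol.shift.smul ρ)).inverse
    (h.2 k j hj).2.1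
  rw [show ζ k + ρ * σ - ζ j = ζ k - ζ j + ρ * σ by ring]
  exact this

theorem Admissible.pole_self : (ρ : ℂ) / (ζ k + ρ * σ - ζ k) = (σ : ℂ)⁻¹ := by
  have h1 : (ρ : ℂ) ≠ 0 := by exact_mod_cast h.1
  have h2 : (σ : ℂ) ≠ 0 := Circle.coe_ne_zero σ
  rw [add_sub_cancel_left]
  field_simp

theorem Admissible.symbol_opsum_self (a : Ell ℕ) :
    HasSymbol σ (opsum a ((1 / 2 : ℝ) • unshift)) (psum a (ρ / (ζ k + ρ * σ - ζ k) / 2)) := by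
  refine HasSymbol.opsum a norm_half_unshift_le ((norm_half_pole_le (h.abs_le k σ k)).trans
    (by norm_num)) ?_
  have := (HasSymbol.unshift (σ := σ)).smul (1 / 2)
  rw [h.pole_self]
  convert this using 1
  push_cast
  ring

theorem Admissible.symbol_opsum_of_ne {j : Fin M} (hj : j ≠ k) (a : Ell ℕ) :
    HasSymbol σ (opsum a ((ρ / 2) • opInv ρ ζ k j)) (psum a (ρ / (ζ k + ρ * σ - ζ j) / 2)) := by
  refine HasSymbol.opsum a (h.2 k j hj).2.2 ((norm_half_pole_le (h.abs_le k σ j)).trans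
    (by norm_num)) ?_
  convert (h.symbol_opInv k σ hj).smul (ρ / 2) using 1
  push_cast
  ring

theorem Admissible.symbol_opPoleSum (a : Fin M → Ell ℕ) :
    HasSymbol σ (opPoleSum ρ ζ a k) (poleSum ρ ζ a (ζ k + ρ * σ)) := by
  rw [poleSum, ← Finset.add_sum_erase _ _ (Finset.mem_univ k)]
  exact (h.symbol_opsum_self k σ _).add
    (HasSymbol.sum fun j hj => h.symbol_opsum_of_ne k σ (Finset.ne_of_mem_erase hj) _)

theorem Admissible.symbol_opPoleDer (a : Fin M → Ell ℕ) :
    HasSymbol σ (opPoleDer ρ ζ a k) (poleDer ρ ζ a (ζ k + ρ * σ)) := by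
  rw [poleDer, ← Finset.add_sum_erase _ _ (Finset.mem_univ k)]
  refine HasSymbol.add ?_ (HasSymbol.sum fun j hj => ?_)
  · rw [h.pole_self]
    refine HasSymbol.unshift.mul ?_
    rw [← h.pole_self k σ]
    exact h.symbol_opsum_self k σ _
  · have hj := Finset.ne_of_mem_erase hj
    exact ((h.symbol_opInv k σ hj).smul ρ).mul (h.symbol_opsum_of_ne k σ hj _)

theorem Admissible.symbol_opMap (D : Fin M → Ell ℕ) :
    HasSymbol σ (opMap ρ ζ D k) (confMap ρ ζ D (ζ k + ρ * σ)) := by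
  have := ((HasSymbol.cmul (σ := σ) (ζ k)).add (HasSymbol.shift.smul ρ)).add
    ((h.symbol_opPoleSum k σ (fun j => Ell.integ (D j))).smul (ρ ^ 2))
  rw [ofReal_pow] at this
  exact this

theorem Admissible.symbol_opDer (D : Fin M → Ell ℕ) :
    HasSymbol σ (opDer ρ ζ D k) (confDer ρ ζ D (ζ k + ρ * σ)) :=
  HasSymbol.one.sub ((h.symbol_opPoleDer k σ D).smul ρ)

end Symbols

/-- The function of the kinematic defect. -/
noncomputable def kinSymbol (ρ : ℝ) (Λ : VortexParams M) (C D : Fin M → Ell ℕ) (b : Fin M → ℝ)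
    (k : Fin M) (s : ℂ) : ℂ :=
  ((b k / (2 * Real.pi) : ℝ) : ℂ) + s * (∑ j ∈ Finset.univ.erase k,
      ((Λ.strength j : ℂ) + I * ((ρ * b j : ℝ) : ℂ)) / (2 * Real.pi * I)
        * (Λ.center k + ρ * s - Λ.center j)⁻¹)
    - s * poleDer ρ Λ.center C (Λ.center k + ρ * s)
    + s * confDer ρ Λ.center D (Λ.center k + ρ * s) * (I * Λ.cOmega)
      * (starRingEnd ℂ) (confMap ρ Λ.center D (Λ.center k + ρ * s))

theorem symbol_opKin {ρ : ℝ} {Λ : VortexParams M} (h : Admissible ρ Λ.center)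
    (C D : Fin M → Ell ℕ) (b : Fin M → ℝ) (k : Fin M) (σ : Circle) :
    HasSymbol σ (opKin ρ Λ C D b k) (kinSymbol ρ Λ C D b k σ) :=
  (((HasSymbol.cmul _).add (HasSymbol.shift.mul (HasSymbol.sum fun _ hj =>
    (HasSymbol.cmul _).mul (h.symbol_opInv k σ (Finset.ne_of_mem_erase hj))))).sub
      (HasSymbol.shift.mul (h.symbol_opPoleDer k σ C))).add
    (((HasSymbol.shift.mul (h.symbol_opDer k σ D)).mul (HasSymbol.cmul _)).mul
      (h.symbol_opMap k σ D).conjOp)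

/-- On its own circle, the pole of a vortex contributes the constant `γ / (2πi)` after
multiplication by `ρσ`. Everything else keeps a factor `ρ`, because the imaginary circulation is
taken of the form `ρ b`. This isolates the singular part of the velocity. -/
theorem mul_confVel_eq {ρ : ℝ} (hρ : ρ ≠ 0) (Λ : VortexParams M) (C D : Fin M → Ell ℕ)
    (b : Fin M → ℝ) (k : Fin M) (σ : Circle) :
    (ρ : ℂ) * σ * (confVel ρ Λ.center Λ.strength (fun j => ρ * b j) C (Λ.center k + ρ * σ)
      + confDer ρ Λ.center D (Λ.center k + ρ * σ) * (I * Λ.cOmega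
        * (starRingEnd ℂ) (confMap ρ Λ.center D (Λ.center k + ρ * σ))))
      = Λ.strength k / (2 * Real.pi * I) + ρ * kinSymbol ρ Λ C D b k σ := by
  have hpi : (Real.pi : ℂ) ≠ 0 := by exact_mod_cast Real.pi_ne_zero
  have h1 : (ρ : ℂ) ≠ 0 := by exact_mod_cast hρ
  have h2 : (σ : ℂ) ≠ 0 := Circle.coe_ne_zero σ
  rw [confVel, ← Finset.add_sum_erase _ _ (Finset.mem_univ k), add_sub_cancel_left, kinSymbol]
  simp only [one_div]
  generalize (∑ j ∈ Finset.univ.erase k,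
    ((Λ.strength j : ℂ) + I * ((ρ * b j : ℝ) : ℂ)) / (2 * Real.pi * I)
        * (Λ.center k + ρ * σ - Λ.center j)⁻¹) = S
  push_cast
  field_simp
  ring

/-- Let `g` be the kinematic symbol and write `f' = 1 - ρ H`. Then `ρσ f'` times the velocity is
`-iγ / (2π) + ρ g`, whose first term is imaginary, so the kinematic condition is `Re g = 0`. Taking
squared moduli, the real part of the symbol of `opDyn` is the difference of the two sides of
Bernoulli's equation, times `2ρ|f'|² / γ`. The terms in `1/ρ` are combined through `1 - |f'|² = 2ρ
Re H - ρ²|H|²`. -/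
theorem kinematic_and_dynamic {ρ : ℝ} {Λ : VortexParams M} (h : Admissible ρ Λ.center)
    {C D : Fin M → Ell ℕ} {Q b : Fin M → ℝ} {k : Fin M} (hγ : Λ.strength k ≠ 0)
    (hzero : decode (opKin ρ Λ C D b k vac, opDyn ρ Λ C D Q b k vac) = 0) (σ : Circle)
    (hf : confDer ρ Λ.center D (Λ.center k + ρ * σ) ≠ 0) :
    ((Λ.center k + ρ * σ - Λ.center k) * confDer ρ Λ.center D (Λ.center k + ρ * σ) *
        conformalVelocity Λ.cOmega (confMap ρ Λ.center D) (confDer ρ Λ.center D)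
          (confVel ρ Λ.center Λ.strength (fun j => ρ * b j) C) (Λ.center k + ρ * σ)).re = 0 ∧
      1 / 2 * ‖conformalVelocity Λ.cOmega (confMap ρ Λ.center D) (confDer ρ Λ.center D)
          (confVel ρ Λ.center Λ.strength (fun j => ρ * b j) C) (Λ.center k + ρ * σ)‖ ^ 2
        - 1 / 2 * ‖Λ.cOmega‖ ^ 2 * ‖confMap ρ Λ.center D (Λ.center k + ρ * σ)‖ ^ 2
        = Λ.strength k ^ 2 / (8 * Real.pi ^ 2 * ρ ^ 2)
          + (Λ.strength k * Q k) / (2 * ρ) := by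
  obtain ⟨h1, h2, h3, h4⟩ := decode_eq_zero hzero
  have hρ := h.1
  have sK := symbol_opKin h C D b k σ
  have sD := h.symbol_opDer k σ D
  have sM := h.symbol_opMap k σ D
  have sP := h.symbol_opPoleDer k σ D
  have sDyn := ((((HasSymbol.cmul (σ := σ) (I / Real.pi)).mul sK).add
    ((sK.mul sK.conjOp).smul (ρ / Λ.strength k))).sub
    (((sD.mul sD.conjOp).mul (sM.mul sM.conjOp)).smul (ρ / Λ.strength k * normSq Λ.cOmega))).sub
    ((sD.mul sD.conjOp).smul (Q k)) |>.add
    (((sP.smul 2).sub ((sP.mul sP.conjOp).smul ρ)).smul (Λ.strength k / (4 * Real.pi ^ 2)))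
  have eK := re_ev_eq_zero h1 h2 σ
  have eD := re_ev_eq_zero h3 h4 σ
  rw [sK.ev_vac] at eK
  rw [opDyn, HasSymbol.ev_vac sDyn] at eD
  have key := mul_confVel_eq hρ Λ C D b k σ
  have hD : confDer ρ Λ.center D (Λ.center k + ρ * σ)
    = 1 - ρ * poleDer ρ Λ.center D (Λ.center k + ρ * σ) := rfl
  rw [conformalVelocity, add_sub_cancel_left]
  generalize kinSymbol ρ Λ C D b k σ = g at *
  generalize confMap ρ Λ.center D (Λ.center k + ρ * σ) = f at *
  generalize confVel ρ Λ.center Λ.strength (fun j => ρ * b j) C (Λ.center k + ρ * σ) = w at *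
  generalize poleDer ρ Λ.center D (Λ.center k + ρ * σ) = H at *
  generalize confDer ρ Λ.center D (Λ.center k + ρ * σ) = f' at *
  generalize Λ.strength k = γ at *
  generalize Λ.cOmega = cΩ at *
  have hpi := Real.pi_ne_zero
  have hI : (γ : ℂ) / (2 * Real.pi * I) = -I * ((γ / (2 * Real.pi) : ℝ) : ℂ) := by
    have : (Real.pi : ℂ) ≠ 0 := by exact_mod_cast hpi
    push_cast
    field_simp
    rw [I_sq]
    ring
  have key2 : (ρ : ℂ) * σ * f' * (w / f' + I * cΩ * (starRingEnd ℂ) f)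
      = -I * ((γ / (2 * Real.pi) : ℝ) : ℂ) + ρ * g := by
    rw [← hI, ← key]
    field_simp
  constructor
  · rw [key2, add_re, re_ofReal_mul, eK, neg_mul, neg_re, I_mul_re, ofReal_im]
    simp
  · have n1 : ρ ^ 2 * normSq f' * normSq (w / f' + I * cΩ * (starRingEnd ℂ) f)
        = (γ / (2 * Real.pi)) ^ 2 - (γ / Real.pi) * ρ * g.im + ρ ^ 2 * normSq g := by
      have := congrArg normSq key2
      rw [normSq_mul, normSq_mul, normSq_mul, normSq_ofReal, Circle.normSq_coe, mul_one] at this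
      rw [pow_two ρ, this, normSq_apply, normSq_apply]
      simp only [add_re, mul_re, neg_re, I_re, ofReal_re, neg_im, I_im, ofReal_im, add_im, mul_im]
      field_simp
      ring
    have n2 : normSq f' = 1 - 2 * ρ * H.re + ρ ^ 2 * normSq H := by
      rw [hD, normSq_apply, normSq_apply]
      simp only [sub_re, mul_re, ofReal_re, ofReal_im, sub_im, mul_im, one_re, one_im]
      ring
    have n3 : -g.im / Real.pi + ρ / γ * normSq g
        - ρ / γ * normSq cΩ * (normSq f' * normSq f) - Q k * normSq f'
        + γ / (4 * Real.pi ^ 2) * (2 * H.re - ρ * normSq H) = 0 := by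
      rw [← eD]
      simp only [mul_conj, ← ofReal_mul, add_re, sub_re, re_ofReal_mul, ofReal_re]
      have : (I / Real.pi * g).re = -g.im / Real.pi := by
        rw [div_mul_eq_mul_div, div_ofReal_re, I_mul_re]
      rw [this]
    have hf' : normSq f' ≠ 0 := by simpa using hf
    simp only [← normSq_eq_norm_sq]
    have e : normSq (w / f' + I * cΩ * (starRingEnd ℂ) f)
        = ((γ / (2 * Real.pi)) ^ 2 - (γ / Real.pi) * ρ * g.im + ρ ^ 2 * normSq g)
          / (ρ ^ 2 * normSq f') := by
      rw [← n1]; field_simp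
    rw [e]
    have n4 : -g.im / Real.pi = - (ρ / γ * normSq g
        - ρ / γ * normSq cΩ * (normSq f' * normSq f) - Q k * normSq f'
        + γ / (4 * Real.pi ^ 2) * (2 * H.re - ρ * normSq H)) := by linarith
    have n5 : (γ / Real.pi) * ρ * g.im = γ * ρ * ((ρ / γ * normSq g
        - ρ / γ * normSq cΩ * (normSq f' * normSq f) - Q k * normSq f'
        + γ / (4 * Real.pi ^ 2) * (2 * H.re - ρ * normSq H))) := by
      linear_combination (-γ * ρ) * n4
    rw [n5]
    have n6 : ρ ^ 2 * normSq H = normSq f' - 1 + 2 * ρ * H.re := by linarith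
    field_simp
    linear_combination (32 * γ ^ 2) * n6

end Wiener

namespace Wiener

variable {M : ℕ}

theorem cmul_mul_cmul (z w : ℂ) : cmul z * cmul w = cmul (z * w) := by
  refine Ell.continuousLinearMap_ext fun n c => ?_
  rw [mul_apply_eq_comp, cmul_single, cmul_single, cmul_single, mul_assoc]

theorem cmul_one : cmul 1 = 1 := by
  refine Ell.continuousLinearMap_ext fun n c => ?_
  rw [cmul_single, one_mul]; rfl

theorem isUnit_cmul {z : ℂ} (hz : z ≠ 0) : IsUnit (cmul z) :=
  ⟨⟨cmul z, cmul z⁻¹, by rw [cmul_mul_cmul, mul_inv_cancel₀ hz, cmul_one],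
    by rw [cmul_mul_cmul, inv_mul_cancel₀ hz, cmul_one]⟩, rfl⟩

/-! ### Analytic dependence of the operators -/

section Analytic

variable {P : Type*} [NormedAddCommGroup P] [NormedSpace ℝ P] {p₀ : P}

theorem analyticAt_cmul {z : P → ℂ} (hz : AnalyticAt ℝ z p₀) :
    AnalyticAt ℝ (fun p => cmul (z p)) p₀ :=
  (cmul.analyticAt _).fun_comp hz

theorem analyticAt_conjOp {T : P → Op} (hT : AnalyticAt ℝ T p₀) :
    AnalyticAt ℝ (fun p => conjOp (T p)) p₀ :=
  (analyticAt_const.mul hT).mul analyticAt_const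

theorem analyticAt_apply {ι : Type*} [Fintype ι] {E : Type*} [NormedAddCommGroup E]
    [NormedSpace ℝ E] {f : P → ι → E} (hf : AnalyticAt ℝ f p₀) (i : ι) :
    AnalyticAt ℝ (fun p => f p i) p₀ :=
  ((ContinuousLinearMap.proj (R := ℝ) (φ := fun _ : ι => E) i).analyticAt _).fun_comp hf

theorem analyticAt_ofReal {f : P → ℝ} (hf : AnalyticAt ℝ f p₀) :
    AnalyticAt ℝ (fun p => (f p : ℂ)) p₀ :=
  (ofRealCLM.analyticAt _).fun_comp hf

variable {ρ : P → ℝ} {ζ : P → Fin M → ℂ} (hρ : AnalyticAt ℝ ρ p₀) (hζ : AnalyticAt ℝ ζ p₀)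
  (hρ₀ : ρ p₀ = 0) (hinj : Function.Injective (ζ p₀))

-- At zero radius the operator to invert is the multiplication by a nonzero number. It is a unit of
-- the Banach algebra, and inversion is analytic at units.
include hρ hζ hρ₀ hinj in
theorem analyticAt_opInv {k j : Fin M} (hj : j ≠ k) :
    AnalyticAt ℝ (fun p => opInv (ρ p) (ζ p) k j) p₀ := by
  have h1 : AnalyticAt ℝ (fun p => cmul (ζ p k - ζ p j) + ρ p • shift) p₀ :=
    (analyticAt_cmul ((analyticAt_apply hζ k).sub (analyticAt_apply hζ j))).add
      (hρ.smul analyticAt_const)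
  have hu : IsUnit (cmul (ζ p₀ k - ζ p₀ j) + ρ p₀ • shift) := by
    rw [hρ₀, zero_smul, add_zero]
    exact isUnit_cmul (sub_ne_zero.mpr fun h => hj (hinj h).symm)
  obtain ⟨u, hu⟩ := hu
  have h2 := analyticAt_inverse (𝕜 := ℝ) u
  rw [hu] at h2
  exact h2.fun_comp (f := fun p => cmul (ζ p k - ζ p j) + ρ p • shift) h1

theorem analyticAt_opsum_self {a : P → Ell ℕ} (ha : AnalyticAt ℝ a p₀) :
    AnalyticAt ℝ (fun p => opsum (a p) ((1 / 2 : ℝ) • unshift)) p₀ :=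
  ((bsumCLM norm_cmul_clm_le _ norm_half_unshift_le).analyticAt _).fun_comp ha

-- The argument of the series vanishes together with `ρ`, so analyticity of `bsum` at the zero
-- operator suffices.
include hρ hζ hρ₀ hinj in
theorem analyticAt_opsum_of_ne {k j : Fin M} (hj : j ≠ k) {a : P → Ell ℕ}
    (ha : AnalyticAt ℝ a p₀) :
    AnalyticAt ℝ (fun p => opsum (a p) ((ρ p / 2) • opInv (ρ p) (ζ p) k j)) p₀ := by
  have h1 : AnalyticAt ℝ (fun p => (a p, (ρ p / 2) • opInv (ρ p) (ζ p) k j)) p₀ :=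
    ha.prod ((hρ.div_const).smul (analyticAt_opInv hρ hζ hρ₀ hinj hj))
  have h2 := analyticAt_bsum norm_cmul_clm_le (a p₀)
  have h3 : (a p₀, (0 : Op)) = (a p₀, (ρ p₀ / 2) • opInv (ρ p₀) (ζ p₀) k j) := by
    rw [hρ₀, zero_div, zero_smul]
  rw [h3] at h2
  exact h2.fun_comp (f := fun p => (a p, (ρ p / 2) • opInv (ρ p) (ζ p) k j)) h1

include hρ hζ hρ₀ hinj in
theorem analyticAt_opPoleSum {a : P → Fin M → Ell ℕ} (ha : AnalyticAt ℝ a p₀) (k : Fin M) :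
    AnalyticAt ℝ (fun p => opPoleSum (ρ p) (ζ p) (a p) k) p₀ :=
  (analyticAt_opsum_self (analyticAt_apply ha k)).add
    (Finset.analyticAt_fun_sum _ fun j hj => analyticAt_opsum_of_ne hρ hζ hρ₀ hinj
      (Finset.ne_of_mem_erase hj) (analyticAt_apply ha j))

include hρ hζ hρ₀ hinj in
theorem analyticAt_opPoleDer {a : P → Fin M → Ell ℕ} (ha : AnalyticAt ℝ a p₀) (k : Fin M) :
    AnalyticAt ℝ (fun p => opPoleDer (ρ p) (ζ p) (a p) k) p₀ :=
  (analyticAt_const.mul (analyticAt_opsum_self (analyticAt_apply ha k))).add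
    (Finset.analyticAt_fun_sum _ fun j hj =>
      (hρ.smul (analyticAt_opInv hρ hζ hρ₀ hinj (Finset.ne_of_mem_erase hj))).mul
        (analyticAt_opsum_of_ne hρ hζ hρ₀ hinj (Finset.ne_of_mem_erase hj)
          (analyticAt_apply ha j)))

include hρ hζ hρ₀ hinj in
theorem analyticAt_opMap {D : P → Fin M → Ell ℕ} (hD : AnalyticAt ℝ D p₀) (k : Fin M) :
    AnalyticAt ℝ (fun p => opMap (ρ p) (ζ p) (D p) k) p₀ := by
  have hI : AnalyticAt ℝ (fun p j => Ell.integ (D p j)) p₀ :=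
    AnalyticAt.pi fun j => (Ell.integ.analyticAt _).fun_comp (analyticAt_apply hD j)
  exact ((analyticAt_cmul (analyticAt_apply hζ k)).add (hρ.smul analyticAt_const)).add
    ((hρ.pow 2).smul (analyticAt_opPoleSum hρ hζ hρ₀ hinj hI k))

include hρ hζ hρ₀ hinj in
theorem analyticAt_opDer {D : P → Fin M → Ell ℕ} (hD : AnalyticAt ℝ D p₀) (k : Fin M) :
    AnalyticAt ℝ (fun p => opDer (ρ p) (ζ p) (D p) k) p₀ :=
  analyticAt_const.sub (hρ.smul (analyticAt_opPoleDer hρ hζ hρ₀ hinj hD k))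

variable {Λ : P → VortexParams M} {C D : P → Fin M → Ell ℕ} {Q b : P → Fin M → ℝ}
  (hΛ : AnalyticAt ℝ Λ p₀) (hΛinj : Function.Injective (Λ p₀).center)
  (hC : AnalyticAt ℝ C p₀) (hD : AnalyticAt ℝ D p₀) (hQ : AnalyticAt ℝ Q p₀)
  (hb : AnalyticAt ℝ b p₀)

include hΛ

theorem analyticAt_center : AnalyticAt ℝ (fun p => (Λ p).center) p₀ :=
  analyticAt_fst.fun_comp hΛ

theorem analyticAt_strength : AnalyticAt ℝ (fun p => (Λ p).strength) p₀ :=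
  analyticAt_fst.fun_comp (f := fun p => (Λ p).2) (analyticAt_snd.fun_comp hΛ)

theorem analyticAt_cOmega : AnalyticAt ℝ (fun p => (Λ p).cOmega) p₀ :=
  analyticAt_snd.fun_comp (f := fun p => (Λ p).2) (analyticAt_snd.fun_comp hΛ)

include hρ hρ₀ hΛinj hC hD hb in
theorem analyticAt_opKin (k : Fin M) :
    AnalyticAt ℝ (fun p => opKin (ρ p) (Λ p) (C p) (D p) (b p) k) p₀ := by
  have hζ := analyticAt_center hΛ
  have hγ := analyticAt_strength hΛ
  refine AnalyticAt.add (AnalyticAt.sub (AnalyticAt.add ?_ ?_) ?_) ?_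
  · exact analyticAt_cmul (analyticAt_ofReal ((analyticAt_apply hb k).div_const))
  · refine analyticAt_const.mul (Finset.analyticAt_fun_sum _ fun j hj => AnalyticAt.mul ?_
      (analyticAt_opInv hρ hζ hρ₀ hΛinj (Finset.ne_of_mem_erase hj)))
    exact analyticAt_cmul (((analyticAt_ofReal (analyticAt_apply hγ j)).add
      (analyticAt_const.mul (analyticAt_ofReal (hρ.mul (analyticAt_apply hb j))))).div_const)
  · exact analyticAt_const.mul (analyticAt_opPoleDer hρ hζ hρ₀ hΛinj hC k)
  · exact ((analyticAt_const.mul (analyticAt_opDer hρ hζ hρ₀ hΛinj hD k)).mul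
      (analyticAt_cmul (analyticAt_const.mul (analyticAt_cOmega hΛ)))).mul
        (analyticAt_conjOp (analyticAt_opMap hρ hζ hρ₀ hΛinj hD k))

include hρ hρ₀ hΛinj hC hD hQ hb in
theorem analyticAt_opDyn {k : Fin M} (hγ₀ : (Λ p₀).strength k ≠ 0) :
    AnalyticAt ℝ (fun p => opDyn (ρ p) (Λ p) (C p) (D p) (Q p) (b p) k) p₀ := by
  have hζ := analyticAt_center hΛ
  have hγ := analyticAt_apply (analyticAt_strength hΛ) k
  have hK := analyticAt_opKin hρ hρ₀ hΛ hΛinj hC hD hb k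
  have hDer := analyticAt_opDer hρ hζ hρ₀ hΛinj hD k
  have hMap := analyticAt_opMap hρ hζ hρ₀ hΛinj hD k
  have hP := analyticAt_opPoleDer hρ hζ hρ₀ hΛinj hD k
  have hΩ : AnalyticAt ℝ (fun p => normSq (Λ p).cOmega) p₀ := by
    have h1 := (reCLM.analyticAt _).fun_comp (analyticAt_cOmega hΛ)
    have h2 := (imCLM.analyticAt _).fun_comp (analyticAt_cOmega hΛ)
    exact (h1.mul h1).add (h2.mul h2)
  have hDD := hDer.mul (analyticAt_conjOp hDer)
  refine AnalyticAt.add (AnalyticAt.sub (AnalyticAt.sub (AnalyticAt.add ?_ ?_) ?_) ?_) ?_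
  · exact analyticAt_const.mul hK
  · exact (hρ.div hγ hγ₀).smul (hK.mul (analyticAt_conjOp hK))
  · exact ((hρ.div hγ hγ₀).mul hΩ).smul (hDD.mul (hMap.mul (analyticAt_conjOp hMap)))
  · exact (analyticAt_apply hQ k).smul hDD
  · have h2 : AnalyticAt ℝ (fun p => (2 : ℝ) • opPoleDer (ρ p) (Λ p).center (D p) k) p₀ :=
      (analyticAt_const (v := (2 : ℝ))).smul hP
    have h3 := hρ.smul (hP.mul (analyticAt_conjOp hP))
    exact (hγ.div_const).smul (h2.sub h3)

end Analytic

/-! ### The limit of vanishing cores -/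

theorem conjOp_cmul (z : ℂ) : conjOp (cmul z) = cmul ((starRingEnd ℂ) z) := by
  refine Ell.continuousLinearMap_ext fun n c => ?_
  rw [conjOp, mul_apply_eq_comp, mul_apply_eq_comp, flip_single, cmul_single, flip_single,
    cmul_single, neg_neg, map_mul, conj_conj]

theorem opInv_zero (ζ : Fin M → ℂ) {k j : Fin M} (h : ζ k ≠ ζ j) :
    opInv 0 ζ k j = cmul (ζ k - ζ j)⁻¹ := by
  have hz : ζ k - ζ j ≠ 0 := sub_ne_zero.mpr h
  rw [opInv, zero_smul, add_zero, ← mul_one (Ring.inverse _),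
    Ring.inverse_mul_eq_iff_eq_mul _ _ _ (isUnit_cmul hz), cmul_mul_cmul, mul_inv_cancel₀ hz,
    cmul_one]

theorem opPoleDer_zero (ζ : Fin M → ℂ) (a : Fin M → Ell ℕ) (k : Fin M) :
    opPoleDer 0 ζ a k = unshift * opsum (a k) ((1 / 2 : ℝ) • unshift) := by
  simp [opPoleDer]

theorem opMap_zero (ζ : Fin M → ℂ) (D : Fin M → Ell ℕ) (k : Fin M) :
    opMap 0 ζ D k = cmul (ζ k) := by
  simp [opMap]

theorem opDer_zero (ζ : Fin M → ℂ) (D : Fin M → Ell ℕ) (k : Fin M) : opDer 0 ζ D k = 1 := by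
  simp [opDer]

/-- When the radius vanishes, the other vortices and the frame motion are seen only through their
value at the center, which together is the velocity defect, times `σ`. The factor `2` is the weight
of `shift` on mode zero. -/
theorem opKin_zero_vac (Λ : VortexParams M) (hΛ : Function.Injective Λ.center)
    (C D : Fin M → Ell ℕ) (b : Fin M → ℝ) (k : Fin M) :
    opKin 0 Λ C D b k vac = Ell.single 0 (b k / (2 * Real.pi))
      + Ell.single 1 (2 * vortexMap Λ k) - negModes (C k) := by
  have hs : (∑ j ∈ Finset.univ.erase k,
      cmul (((Λ.strength j : ℂ) + I * (((0 : ℝ) * b j : ℝ) : ℂ)) / (2 * Real.pi * I))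
        * opInv 0 Λ.center k j) + cmul (I * Λ.cOmega * (starRingEnd ℂ) (Λ.center k))
      = cmul (vortexMap Λ k) := by
    rw [vortexMap, map_add, map_sum]
    congr 1
    refine Finset.sum_congr rfl fun j hj => ?_
    rw [opInv_zero _ fun h => Finset.ne_of_mem_erase hj (hΛ h).symm, cmul_mul_cmul]
    simp
  have e : opKin 0 Λ C D b k = cmul ((b k / (2 * Real.pi) : ℝ) : ℂ)
      + shift * cmul (vortexMap Λ k) - opsum (C k) ((1 / 2 : ℝ) • unshift) := by
    rw [← hs, opKin, opDer_zero, opMap_zero, opPoleDer_zero, conjOp_cmul, mul_one,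
      ← mul_assoc shift unshift, shift_mul_unshift, one_mul, mul_assoc shift, cmul_mul_cmul,
      mul_add]
    abel
  rw [e, sub_apply, add_apply, mul_apply_eq_comp, opsum_unshift_vac, vac, cmul_single, cmul_single,
    shift_single, if_pos le_rfl, mul_one, mul_one, ← map_smul, real_smul]
  push_cast
  rfl

/-- The quadratic terms in the kinematic and pole operators carry a factor `ρ`, while `f_ζ` becomes
`1`. What survives is linear in the kinematic defect, in `Q` and in `D`. -/
theorem opDyn_zero_vac (Λ : VortexParams M) (C D : Fin M → Ell ℕ) (Q b : Fin M → ℝ) (k : Fin M) :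
    opDyn 0 Λ C D Q b k vac = cscale (I / Real.pi) (opKin 0 Λ C D b k vac)
      - Ell.single 0 (Q k : ℂ)
      + (Λ.strength k / (2 * Real.pi ^ 2)) • unshift (negModes (D k)) := by
  have h1 : conjOp 1 = 1 := by
    refine Ell.continuousLinearMap_ext fun n c => ?_
    rw [conjOp, mul_one, mul_apply_eq_comp, flip_single, flip_single, neg_neg, conj_conj]; rfl
  have e : opDyn 0 Λ C D Q b k = cmul (I / Real.pi) * opKin 0 Λ C D b k - Q k • (1 : Op)
      + (Λ.strength k / (2 * Real.pi ^ 2)) •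
        (unshift * opsum (D k) ((1 / 2 : ℝ) • unshift)) := by
    rw [opDyn, opDer_zero, opPoleDer_zero, h1, zero_div, zero_mul, zero_smul, zero_smul, zero_smul,
      add_zero, sub_zero, sub_zero, mul_one, smul_smul]
    congr 2
    ring
  rw [e, add_apply, sub_apply, mul_apply_eq_comp, smul_apply, smul_apply, mul_apply_eq_comp,
    opsum_unshift_vac]
  have : Q k • (1 : Op) vac = Ell.single 0 (Q k : ℂ) := by
    change Q k • Ell.single 0 1 = _
    rw [← map_smul, real_smul, mul_one]
  rw [this]
  rfl

end Wiener

/-! ### Parameters as functions of the velocity defect. -/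

section PointVortex

variable {M : ℕ}

theorem analyticAt_vortexMap {Λ₀ : VortexParams M} (hinj : Function.Injective Λ₀.center) :
    AnalyticAt ℝ (vortexMap (M := M)) Λ₀ := by
  have hid : AnalyticAt ℝ (fun Λ : VortexParams M => Λ) Λ₀ := analyticAt_id
  have hζ := Wiener.analyticAt_center hid
  have hγ := Wiener.analyticAt_strength hid
  have hΩ := Wiener.analyticAt_cOmega hid
  refine AnalyticAt.pi fun k => AnalyticAt.add (Finset.analyticAt_fun_sum _ fun j hj => ?_) ?_
  · refine AnalyticAt.mul ((Wiener.analyticAt_ofReal (Wiener.analyticAt_apply hγ j)).div_const) ?_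
    refine analyticAt_const.div ((Wiener.analyticAt_apply hζ k).sub
      (Wiener.analyticAt_apply hζ j)) ?_
    exact sub_ne_zero.mpr fun h => Finset.ne_of_mem_erase hj (hinj h).symm
  · exact (analyticAt_const.mul hΩ).mul
      (((conjCLE : ℂ →L[ℝ] ℂ).analyticAt _).fun_comp (Wiener.analyticAt_apply hζ k))

/-- The point vortex configurations can be parameterized by the defect. -/
theorem exists_analytic_vortexParams {Λ₀ : VortexParams M} (hinj : Function.Injective Λ₀.center)
    (hV : vortexMap Λ₀ = 0) {E : Submodule ℝ (VortexParams M)} (hE : IsAdmissibleSubspace Λ₀ E) :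
    ∃ L : (Fin M → ℂ) → VortexParams M, AnalyticAt ℝ L 0 ∧ L 0 = Λ₀ ∧ (∀ v, L v - Λ₀ ∈ E) ∧
      ∀ᶠ v in 𝓝 0, vortexMap (L v) = v := by
  have hι : AnalyticAt ℝ (fun e : E => Λ₀ + (e : VortexParams M)) 0 :=
    analyticAt_const.add (E.subtypeL.analyticAt 0)
  have ha := analyticAt_vortexMap hinj
  have ha' : AnalyticAt ℝ (vortexMap (M := M)) (Λ₀ + ((0 : E) : VortexParams M)) := by
    simpa using ha
  have hf : AnalyticAt ℝ (fun e : E => vortexMap (Λ₀ + (e : VortexParams M))) 0 :=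
    ha'.fun_comp (f := fun e : E => Λ₀ + (e : VortexParams M)) hι
  have hd : fderiv ℝ (fun e : E => vortexMap (Λ₀ + (e : VortexParams M))) 0
      = fderiv ℝ vortexMap Λ₀ ∘L E.subtypeL := by
    have h1 : HasFDerivAt (fun e : E => Λ₀ + (e : VortexParams M)) E.subtypeL 0 :=
      E.subtypeL.hasFDerivAt.const_add Λ₀
    have h2 : HasFDerivAt (vortexMap (M := M)) (fderiv ℝ vortexMap Λ₀)
        (Λ₀ + ((0 : E) : VortexParams M)) := by
      simpa using ha.differentiableAt.hasFDerivAt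
    exact (h2.comp (f := fun e : E => Λ₀ + (e : VortexParams M)) 0 h1).fderiv
  obtain ⟨g, hg, hg0, hgr⟩ := exists_analytic_right_inverse hf (by rw [hd]; exact hE)
  have e0 : vortexMap (Λ₀ + ((0 : E) : VortexParams M)) = 0 := by simpa using hV
  rw [e0] at hg hg0 hgr
  refine ⟨fun v => Λ₀ + (g v : VortexParams M),
    analyticAt_const.add ((E.subtypeL.analyticAt _).fun_comp hg), ?_, fun v => ?_, hgr⟩
  · simp [hg0]
  · simp

end PointVortex

/-! ### Solution of the equations near radius zero. -/

namespace Wiener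

variable {M : ℕ}

/-- The parameters follow the velocity defects through the right inverse `L` of `𝓥`, so that the
decoded defects form a map `F` that is the identity at radius zero. No value of `b` at zero is
recorded, because only the product `ρ b` enters the flow as a circulation. -/
theorem exists_curve {Λ₀ : VortexParams M} (hinj : Function.Injective Λ₀.center)
    (hγ₀ : ∀ k, Λ₀.strength k ≠ 0) (hV : vortexMap Λ₀ = 0) {E : Submodule ℝ (VortexParams M)}
    (hE : IsAdmissibleSubspace Λ₀ E) :
    ∃ (C D : ℝ → Fin M → Ell ℕ) (Q b : ℝ → Fin M → ℝ) (Λ : ℝ → VortexParams M),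
      AnalyticAt ℝ C 0 ∧ AnalyticAt ℝ D 0 ∧ AnalyticAt ℝ Q 0 ∧ AnalyticAt ℝ b 0 ∧
      AnalyticAt ℝ Λ 0 ∧ C 0 = 0 ∧ D 0 = 0 ∧ Q 0 = 0 ∧ Λ 0 = Λ₀ ∧
      (∀ ρ, Λ ρ - Λ₀ ∈ E) ∧
      ∀ᶠ ρ in 𝓝 0, ∀ k, decode (opKin ρ (Λ ρ) (C ρ) (D ρ) (b ρ) k vac,
        opDyn ρ (Λ ρ) (C ρ) (D ρ) (Q ρ) (b ρ) k vac) = 0 := by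
  obtain ⟨L, hL, hL0, hLE, hLr⟩ := exists_analytic_vortexParams hinj hV hE
  let C : (Fin M → Unknown) → Fin M → Ell ℕ := fun x k => (x k).1
  let Λ : (Fin M → Unknown) → VortexParams M := fun x => L fun k => (x k).2.2.2.2
  -- Dividing by the strength cancels the factor `γ` in front of `D` in the limiting Bernoulli
  -- defect, as `decode_linear` requires.
  let D : (Fin M → Unknown) → Fin M → Ell ℕ := fun x k => ((Λ x).strength k)⁻¹ • (x k).2.1
  let Q : (Fin M → Unknown) → Fin M → ℝ := fun x k => (x k).2.2.1
  let b : (Fin M → Unknown) → Fin M → ℝ := fun x k => (x k).2.2.2.1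
  have hx : AnalyticAt ℝ (fun x : Fin M → Unknown => x) 0 := analyticAt_id
  have h2 : ∀ k, AnalyticAt ℝ (fun x : Fin M → Unknown => (x k).2) 0 := fun k =>
    analyticAt_snd.fun_comp (analyticAt_apply hx k)
  have h22 : ∀ k, AnalyticAt ℝ (fun x : Fin M → Unknown => (x k).2.2) 0 := fun k =>
    analyticAt_snd.fun_comp (h2 k)
  have h222 : ∀ k, AnalyticAt ℝ (fun x : Fin M → Unknown => (x k).2.2.2) 0 := fun k =>
    analyticAt_snd.fun_comp (h22 k)
  have hC : AnalyticAt ℝ C 0 := AnalyticAt.pi fun k =>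
    analyticAt_fst.fun_comp (analyticAt_apply hx k)
  have hQ : AnalyticAt ℝ Q 0 := AnalyticAt.pi fun k => analyticAt_fst.fun_comp (h22 k)
  have hb : AnalyticAt ℝ b 0 := AnalyticAt.pi fun k => analyticAt_fst.fun_comp (h222 k)
  have hv : AnalyticAt ℝ (fun (x : Fin M → Unknown) k => (x k).2.2.2.2) 0 :=
    AnalyticAt.pi fun k => analyticAt_snd.fun_comp (h222 k)
  have hΛ : AnalyticAt ℝ Λ 0 :=
    AnalyticAt.fun_comp (f := fun (x : Fin M → Unknown) k => (x k).2.2.2.2) hL hv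
  have hΛ0 : Λ 0 = Λ₀ := hL0
  have hγ := analyticAt_strength hΛ
  have hD : AnalyticAt ℝ D 0 := AnalyticAt.pi fun k =>
    ((analyticAt_apply hγ k).fun_inv (by rw [hΛ0]; exact hγ₀ k)).smul
      (analyticAt_fst.fun_comp (h2 k))
  let F : ℝ × (Fin M → Unknown) → Fin M → Unknown := fun p k =>
    decode (opKin p.1 (Λ p.2) (C p.2) (D p.2) (b p.2) k vac,
      opDyn p.1 (Λ p.2) (C p.2) (D p.2) (Q p.2) (b p.2) k vac)
  have hsnd : ∀ {G : Type} [NormedAddCommGroup G] [NormedSpace ℝ G]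
      {f : (Fin M → Unknown) → G}, AnalyticAt ℝ f 0 →
      AnalyticAt ℝ (fun p : ℝ × (Fin M → Unknown) => f p.2) (0, 0) := fun hf =>
    AnalyticAt.fun_comp (f := Prod.snd) (by exact hf) analyticAt_snd
  have hF : AnalyticAt ℝ F (0, 0) := AnalyticAt.pi fun k => by
    refine (decode.analyticAt _).fun_comp (AnalyticAt.prod ?_ ?_)
    · exact ((ContinuousLinearMap.apply ℝ (Ell ℤ) vac).analyticAt _).fun_comp
        (analyticAt_opKin analyticAt_fst rfl (hsnd hΛ) (by rw [hΛ0]; exact hinj) (hsnd hC) (hsnd hD)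
          (hsnd hb) k)
    · exact ((ContinuousLinearMap.apply ℝ (Ell ℤ) vac).analyticAt _).fun_comp
        (analyticAt_opDyn analyticAt_fst rfl (hsnd hΛ) (by rw [hΛ0]; exact hinj) (hsnd hC) (hsnd hD)
          (hsnd hQ) (hsnd hb) (by rw [hΛ0]; exact hγ₀ k))
  have hgood : ∀ᶠ x in 𝓝 (0 : Fin M → Unknown),
      vortexMap (Λ x) = (fun k => (x k).2.2.2.2) ∧ Function.Injective (Λ x).center ∧
      ∀ k, (Λ x).strength k ≠ 0 := by
    refine (hv.continuousAt.eventually (p := fun v => vortexMap (L v) = v) hLr).and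
      (Filter.Eventually.and ?_ ?_)
    · have hζ := analyticAt_center hΛ
      have : ∀ᶠ x in 𝓝 (0 : Fin M → Unknown), ∀ i j, i ≠ j →
          (Λ x).center i ≠ (Λ x).center j := by
        rw [eventually_all]; intro i
        rw [eventually_all]; intro j
        rw [eventually_imp_distrib_left]; intro hij
        have := ((analyticAt_apply hζ i).sub (analyticAt_apply hζ j)).continuousAt.eventually_ne
          (y := 0) (by
            change (Λ 0).center i - (Λ 0).center j ≠ 0
            rw [hΛ0]
            exact sub_ne_zero.mpr fun h => hij (hinj h))
        exact this.mono fun x hx => sub_ne_zero.mp hx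
      exact this.mono fun x hx i j hij => by_contra fun h => hx i j h hij
    · rw [eventually_all]; intro k
      exact (analyticAt_apply hγ k).continuousAt.eventually_ne (by rw [hΛ0]; exact hγ₀ k)
  have hF0 : ∀ᶠ x in 𝓝 (0 : Fin M → Unknown), F (0, x) = x := by
    filter_upwards [hgood] with x ⟨hx1, hx2, hx3⟩
    funext k
    refine decode_linear (C x k) (x k).2.1 (Q x k) (b x k) ((x k).2.2.2.2) _ _ ?_ ?_
    · rw [opKin_zero_vac _ hx2, hx1]
    · rw [opDyn_zero_vac]
      congr 1
      change _ • unshift (negModes (((Λ x).strength k)⁻¹ • (x k).2.1)) = _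
      rw [map_smul, map_smul, smul_smul]
      congr 1
      have := hx3 k
      field_simp
  obtain ⟨x, hxa, hx0, hxF⟩ := exists_analytic_curve hF hF0
  have hcomp : ∀ {G : Type} [NormedAddCommGroup G] [NormedSpace ℝ G]
      {f : (Fin M → Unknown) → G}, AnalyticAt ℝ f 0 →
      AnalyticAt ℝ (fun ρ : ℝ => f (x ρ)) 0 := fun hf =>
    AnalyticAt.fun_comp (f := x) (by rw [hx0]; exact hf) hxa
  refine ⟨fun ρ => C (x ρ), fun ρ => D (x ρ), fun ρ => Q (x ρ), fun ρ => b (x ρ),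
    fun ρ => Λ (x ρ), hcomp hC, hcomp hD, hcomp hQ, hcomp hb, hcomp hΛ, ?_, ?_, ?_, ?_,
    fun ρ => hLE _, ?_⟩
  · simp only [hx0]; rfl
  · simp only [hx0]
    funext k
    change _ • (0 : Ell ℕ) = 0
    rw [smul_zero]
  · simp only [hx0]; rfl
  · simp only [hx0]; exact hΛ0
  · filter_upwards [hxF] with ρ hρ k
    exact congrFun hρ k

end Wiener

/-! ### The densities -/

/-- The geometric weight beats the polynomial growth caused by `j` derivatives. This is why a single
coefficient space serves all Hölder spaces. -/
theorem exists_bound_pow_mul (j : ℕ) :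
    ∃ K : ℝ, ∀ n : ℕ, 2 * ((n + 1 : ℝ) ^ j * (1 / 2) ^ (n + 1)) ≤ K := by
  have h := tendsto_pow_const_mul_const_pow_of_abs_lt_one j (r := (1 / 2 : ℝ))
    (by rw [abs_of_pos] <;> norm_num)
  obtain ⟨K, hK⟩ := h.bddAbove_range
  refine ⟨2 * K, fun n => mul_le_mul_of_nonneg_left ?_ two_pos.le⟩
  exact_mod_cast hK (mem_range_self (n + 1))

/-- A uniform bound for the coefficients of the `j`-th derivative of a density. -/
noncomputable def densityBound (j : ℕ) : ℝ := (exists_bound_pow_mul j).choose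

theorem le_densityBound (j n : ℕ) :
    2 * ((n + 1 : ℝ) ^ j * (1 / 2) ^ (n + 1)) ≤ densityBound j :=
  (exists_bound_pow_mul j).choose_spec n

theorem densityBound_nonneg (j : ℕ) : 0 ≤ densityBound j :=
  le_trans (by positivity) (le_densityBound j 0)

/-- The `n`-th term of the `j`-th derivative of a density. -/
noncomputable def densityTerm (j n : ℕ) (θ : ℝ) : ℂ :=
  -2 / (n + 1) * (1 / 2) ^ (n + 1) * (-I * (n + 1)) ^ j * cexp (-I * (n + 1) * θ)

theorem norm_densityTerm_le (j n : ℕ) (θ : ℝ) : ‖densityTerm j n θ‖ ≤ densityBound j := by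
  refine le_trans ?_ (le_densityBound j n)
  have h1 : ‖cexp (-I * (n + 1) * θ)‖ = 1 := by
    rw [show -I * (n + 1) * θ = ((-((n : ℝ) + 1) * θ : ℝ) : ℂ) * I by push_cast; ring,
      norm_exp_ofReal_mul_I]
  have h2 : ‖(n + 1 : ℂ)‖ = (n + 1 : ℝ) := by
    rw [← Nat.cast_succ, norm_natCast, Nat.cast_succ]
  rw [densityTerm, norm_mul, h1, mul_one, norm_mul, norm_mul, norm_pow, norm_pow, norm_mul,
    norm_neg,
    norm_I, one_mul, norm_div, h2, norm_neg, Complex.norm_ofNat, norm_div, norm_one,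
    Complex.norm_ofNat, div_mul_eq_mul_div, div_mul_eq_mul_div]
  rw [div_le_iff₀ (by positivity)]
  have : 0 ≤ (n + 1 : ℝ) ^ j * (1 / 2) ^ (n + 1) := by positivity
  nlinarith [mul_nonneg this (Nat.cast_nonneg (α := ℝ) n)]

theorem hasDerivAt_densityTerm (j n : ℕ) (θ : ℝ) :
    HasDerivAt (densityTerm j n) (densityTerm (j + 1) n θ) θ := by
  have h1 : HasDerivAt (fun θ : ℝ => -I * (n + 1) * (θ : ℂ)) (-I * (n + 1) * 1) θ :=
    (hasDerivAt_id θ).ofReal_comp.const_mul _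
  have h2 := (h1.cexp).const_mul (-2 / (n + 1) * (1 / 2) ^ (n + 1) * (-I * (n + 1)) ^ j)
  refine HasDerivAt.congr_deriv h2 ?_
  rw [densityTerm, pow_succ (-I * (n + 1 : ℂ)) j]
  ring

/-- The `j`-th derivative of the density with given coefficients. -/
noncomputable def densityDeriv (j : ℕ) (θ : ℝ) : Ell ℕ →L[ℝ] ℝ :=
  Ell.lift (fun n => reCLM ∘L ContinuousLinearMap.mul ℝ ℂ (densityTerm j n θ)) (densityBound j)
    fun n => by
      refine ContinuousLinearMap.opNorm_le_bound _ (densityBound_nonneg j) fun c => ?_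
      refine (abs_re_le_norm _).trans ?_
      change ‖densityTerm j n θ * c‖ ≤ _
      rw [norm_mul]
      exact mul_le_mul_of_nonneg_right (norm_densityTerm_le j n θ) (norm_nonneg _)

theorem hasSum_densityDeriv (j : ℕ) (θ : ℝ) (c : Ell ℕ) :
    HasSum (fun n => (densityTerm j n θ * c n).re) (densityDeriv j θ c) :=
  Ell.hasSum_lift _ _ _ c

theorem abs_densityDeriv_le (j : ℕ) (θ : ℝ) (c : Ell ℕ) :
    |densityDeriv j θ c| ≤ densityBound j * ‖c‖ :=
  (densityDeriv j θ).le_of_opNorm_le (Ell.norm_lift_le _ _ (densityBound_nonneg j) _) c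

theorem hasDerivAt_densityDeriv (j : ℕ) (c : Ell ℕ) (θ : ℝ) :
    HasDerivAt (fun θ => densityDeriv j θ c) (densityDeriv (j + 1) θ c) θ := by
  have h := hasDerivAt_tsum (u := fun n => densityBound (j + 1) * ‖c n‖)
    (g := fun n θ => (densityTerm j n θ * c n).re)
    (g' := fun n θ => (densityTerm (j + 1) n θ * c n).re) (y₀ := θ)
    (c.summable_norm.mul_left _) (fun n y => ?_) (fun n y => ?_)
    (hasSum_densityDeriv j θ c).summable θ
  · rw [(hasSum_densityDeriv (j + 1) θ c).tsum_eq] at h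
    exact h.congr_of_eventuallyEq
      (Eventually.of_forall fun y => (hasSum_densityDeriv j y c).tsum_eq.symm)
  · exact reCLM.hasFDerivAt.comp_hasDerivAt y ((hasDerivAt_densityTerm j n y).mul_const (c n))
  · refine (abs_re_le_norm _).trans ?_
    rw [norm_mul]
    exact mul_le_mul_of_nonneg_right (norm_densityTerm_le _ n y) (norm_nonneg _)

theorem iteratedDeriv_densityDeriv (j : ℕ) (c : Ell ℕ) :
    iteratedDeriv j (fun θ => densityDeriv 0 θ c) = fun θ => densityDeriv j θ c := by
  induction j with
  | zero => exact iteratedDeriv_zero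
  | succ j ih =>
    rw [iteratedDeriv_succ, ih]
    exact funext fun θ => (hasDerivAt_densityDeriv j c θ).deriv

theorem contDiff_densityDeriv (ℓ : ℕ) (c : Ell ℕ) :
    ContDiff ℝ ℓ (fun θ => densityDeriv 0 θ c) := by
  refine contDiff_of_differentiable_iteratedDeriv fun m _ => ?_
  rw [iteratedDeriv_densityDeriv]
  exact fun θ => (hasDerivAt_densityDeriv m c θ).differentiableAt

theorem abs_densityDeriv_sub_le (j : ℕ) (c : Ell ℕ) (x y : ℝ) :
    |densityDeriv j x c - densityDeriv j y c| ≤ densityBound (j + 1) * ‖c‖ * |x - y| :=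
  Convex.norm_image_sub_le_of_norm_hasDerivWithin_le (s := univ) (f := fun θ => densityDeriv j θ c)
    (fun θ _ => (hasDerivAt_densityDeriv j c θ).hasDerivWithinAt)
    (fun θ _ => abs_densityDeriv_le (j + 1) θ c) convex_univ (mem_univ y) (mem_univ x)

/-- The density on the circle with given coefficients. -/
noncomputable def density (c : Ell ℕ) (σ : Circle) : ℝ := densityDeriv 0 (arg σ) c

theorem densityTerm_zero_eq (n : ℕ) (θ : ℝ) :
    densityTerm 0 n θ = -2 / (n + 1) * ((Circle.exp θ : ℂ)⁻¹ / 2) ^ (n + 1) := by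
  have : ((n + 1 : ℕ) : ℂ) * -(θ * I) = -I * (n + 1) * θ := by push_cast; ring
  rw [densityTerm, pow_zero, mul_one, Circle.coe_exp, ← exp_neg, div_pow (cexp _), ← exp_nat_mul,
    this, div_pow, one_pow]
  ring

/-- The density is defined through the principal argument, but each term depends on the angle only
through the point of the circle, so the jump of the argument is harmless. -/
theorem circleLift_density (c : Ell ℕ) : circleLift (density c) = fun θ => densityDeriv 0 θ c := by
  funext θ
  have h : ∀ n, densityTerm 0 n (arg (Circle.exp θ)) = densityTerm 0 n θ := fun n => by
    rw [densityTerm_zero_eq, densityTerm_zero_eq, Circle.exp_arg]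
  have h1 := hasSum_densityDeriv 0 (arg (Circle.exp θ)) c
  simp only [h] at h1
  exact h1.unique (hasSum_densityDeriv 0 θ c)

/-- For angles closer than `1` the Lipschitz bound is used, since `|x - y| ≤ |x - y|^α`. For distant
angles twice the supremum bound is enough, since `|x - y|^α ≥ 1`. -/
theorem holderQuotient_density_le (ℓ : ℕ) {α : ℝ} (hα₀ : 0 < α) (hα₁ : α < 1) (c : Ell ℕ)
    (p : ℝ × ℝ) :
    holderQuotient ℓ α (density c) p ≤ (densityBound (ℓ + 1) + 2 * densityBound ℓ) * ‖c‖ := by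
  have hb := densityBound_nonneg ℓ
  have hb' := densityBound_nonneg (ℓ + 1)
  rw [holderQuotient, circleLift_density, iteratedDeriv_densityDeriv]
  rcases eq_or_ne p.1 p.2 with h | h
  · rw [h]; simp only [sub_self, abs_zero, zero_div]; positivity
  have hpos : 0 < |p.1 - p.2| := abs_pos.mpr (sub_ne_zero.mpr h)
  rw [div_le_iff₀ (Real.rpow_pos_of_pos hpos α)]
  rcases le_total |p.1 - p.2| 1 with h1 | h1
  · have h2 : |p.1 - p.2| ≤ |p.1 - p.2| ^ α := by
      simpa using Real.rpow_le_rpow_of_exponent_ge hpos h1 hα₁.le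
    refine (abs_densityDeriv_sub_le ℓ c p.1 p.2).trans (mul_le_mul ?_ h2 hpos.le (by positivity))
    exact mul_le_mul_of_nonneg_right (by linarith) (norm_nonneg _)
  · have h2 : 1 ≤ |p.1 - p.2| ^ α := Real.one_le_rpow h1 hα₀.le
    have h3 := (abs_sub (densityDeriv ℓ p.1 c) (densityDeriv ℓ p.2 c)).trans
      (add_le_add (abs_densityDeriv_le ℓ p.1 c) (abs_densityDeriv_le ℓ p.2 c))
    refine h3.trans (le_trans ?_ (le_mul_of_one_le_right (by positivity) h2))
    nlinarith [norm_nonneg c]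

/-- The densities in the Hölder space, as a linear function of the coefficients. -/
noncomputable def holderDensity (ℓ : ℕ) {α : ℝ} (hα₀ : 0 < α) (hα₁ : α < 1) :
    Ell ℕ →L[ℝ] HolderCircle ℓ α :=
  LinearMap.mkContinuous
    { toFun := fun c => ⟨density c, by
        refine ⟨by rw [circleLift_density]; exact contDiff_densityDeriv ℓ c,
          (densityBound (ℓ + 1) + 2 * densityBound ℓ) * ‖c‖, ?_⟩
        rintro _ ⟨p, rfl⟩
        exact holderQuotient_density_le ℓ hα₀ hα₁ c p⟩
      map_add' := fun c d => Subtype.ext (funext fun σ => map_add _ c d)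
      map_smul' := fun r c => Subtype.ext (funext fun σ => map_smul _ r c) }
    ((∑ j ∈ Finset.range (ℓ + 1), densityBound j) + (densityBound (ℓ + 1) + 2 * densityBound ℓ))
    fun c => by
      rw [HolderCircle.norm_def, holderNorm, add_mul, Finset.sum_mul]
      refine add_le_add (Finset.sum_le_sum fun j _ => ciSup_le fun θ => ?_)
        (ciSup_le fun p => holderQuotient_density_le ℓ hα₀ hα₁ c p)
      change |iteratedDeriv j (circleLift (density c)) θ| ≤ _
      rw [circleLift_density, iteratedDeriv_densityDeriv]
      exact abs_densityDeriv_le j θ c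

theorem holderDensity_apply (ℓ : ℕ) {α : ℝ} (hα₀ : 0 < α) (hα₁ : α < 1) (c : Ell ℕ)
    (σ : Circle) : holderDensity ℓ hα₀ hα₁ c σ = density c σ := rfl

/-! ### Layer potentials -/

theorem continuous_circle_exp : Continuous fun θ : ℝ => (Circle.exp θ : ℂ) := by
  simp only [Circle.coe_exp]; fun_prop

theorem one_sub_mul_exp_ne_zero {u : ℂ} (hu : ‖u‖ < 1) (θ : ℝ) : 1 - u * Circle.exp θ ≠ 0 := by
  intro h
  have h1 : ‖u * Circle.exp θ‖ = 1 := by rw [← sub_eq_zero.mp h, norm_one]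
  rw [norm_mul, Circle.norm_coe, mul_one] at h1
  exact hu.ne h1

theorem continuous_geometric_kernel {u : ℂ} (hu : ‖u‖ < 1) :
    Continuous fun θ : ℝ => u * Circle.exp θ / (1 - u * Circle.exp θ) :=
  (continuous_const.mul continuous_circle_exp).div
    (continuous_const.sub (continuous_const.mul continuous_circle_exp))
    (one_sub_mul_exp_ne_zero hu)

/-- For a nonnegative harmonic the integrand extends holomorphically to the disk, and Cauchy's
theorem applies. -/
theorem integral_pow_mul_kernel {u : ℂ} (hu : ‖u‖ < 1) (m : ℕ) :
    ∫ θ in (0 : ℝ)..(2 * Real.pi),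
      (Circle.exp θ : ℂ) ^ m * (u * Circle.exp θ / (1 - u * Circle.exp θ)) = 0 := by
  have hne : ∀ z ∈ Metric.closedBall (0 : ℂ) 1, 1 - u * z ≠ 0 := by
    intro z hz h
    have h1 : ‖u * z‖ = 1 := by rw [← sub_eq_zero.mp h, norm_one]
    rw [norm_mul] at h1
    have hz' : ‖z‖ ≤ 1 := by simpa using hz
    nlinarith [norm_nonneg u, norm_nonneg z]
  have hd : DifferentiableOn ℂ (fun z : ℂ => z ^ m * (u / (1 - u * z))) (Metric.closedBall 0 1) :=
    fun z hz => ((differentiableAt_id.pow m).mul ((differentiableAt_const u).div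
      ((differentiableAt_const (1 : ℂ)).sub ((differentiableAt_const u).mul differentiableAt_id))
      (hne z hz))).differentiableWithinAt
  have h := (hd.diffContOnCl_ball (subset_refl _)).circleIntegral_eq_zero zero_le_one
  rw [circleIntegral] at h
  have h2 : ∀ θ : ℝ, deriv (circleMap 0 1) θ •
      ((circleMap 0 1 θ) ^ m * (u / (1 - u * circleMap 0 1 θ)))
      = I * ((Circle.exp θ : ℂ) ^ m * (u * Circle.exp θ / (1 - u * Circle.exp θ))) := fun θ => by
    rw [deriv_circleMap, smul_eq_mul, circleMap, zero_add, ofReal_one, one_mul, ← Circle.coe_exp]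
    ring
  simp only [h2] at h
  rw [intervalIntegral.integral_const_mul] at h
  exact (mul_eq_zero.mp h).resolve_left I_ne_zero

theorem integral_inv_pow_exp (m : ℕ) :
    ∫ θ in (0 : ℝ)..(2 * Real.pi), (Circle.exp θ : ℂ)⁻¹ ^ m
      = if m = 0 then (2 * Real.pi : ℂ) else 0 := by
  split_ifs with h
  · subst h; simp
  have h1 : ∀ θ : ℝ, (Circle.exp θ : ℂ)⁻¹ ^ m = cexp (-(m * I) * θ) := fun θ => by
    rw [Circle.coe_exp, ← exp_neg, ← exp_nat_mul]
    congr 1; ring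
  have hc : -((m : ℂ) * I) ≠ 0 := by simp [h]
  simp only [h1]
  rw [integral_exp_mul_complex hc]
  have : cexp (-(m * I) * ((2 * Real.pi : ℝ) : ℂ)) = 1 := by
    rw [exp_eq_one_iff]
    exact ⟨-m, by push_cast; ring⟩
  rw [this]
  simp

theorem integral_pow_succ_exp (m : ℕ) :
    ∫ θ in (0 : ℝ)..(2 * Real.pi), (Circle.exp θ : ℂ) ^ (m + 1) = 0 := by
  have h1 : ∀ θ : ℝ, (Circle.exp θ : ℂ) ^ (m + 1) = cexp (((m + 1 : ℕ) * I) * θ) := fun θ => by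
    rw [Circle.coe_exp, ← exp_nat_mul]
    congr 1; ring
  have hc : ((m + 1 : ℕ) : ℂ) * I ≠ 0 := mul_ne_zero (Nat.cast_ne_zero.mpr m.succ_ne_zero) I_ne_zero
  simp only [h1]
  rw [integral_exp_mul_complex hc]
  have : cexp (((m + 1 : ℕ) * I) * ((2 * Real.pi : ℝ) : ℂ)) = 1 := by
    rw [exp_eq_one_iff]
    exact ⟨(m + 1 : ℕ), by push_cast; ring⟩
  rw [this]
  simp

/-- With `K = uσ / (1 - uσ)` one has `K = uσ (1 + K)`. This lowers the exponent of `σ⁻¹` at the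
price of a factor `u`, and the constant harmonic supplies `2π` at the end of the recursion. -/
theorem integral_inv_pow_mul_kernel {u : ℂ} (hu : ‖u‖ < 1) (m : ℕ) :
    ∫ θ in (0 : ℝ)..(2 * Real.pi),
      (Circle.exp θ : ℂ)⁻¹ ^ (m + 1) * (u * Circle.exp θ / (1 - u * Circle.exp θ))
      = 2 * Real.pi * u ^ (m + 1) := by
  have hci : Continuous fun θ : ℝ => (Circle.exp θ : ℂ)⁻¹ :=
    continuous_circle_exp.inv₀ fun θ => Circle.coe_ne_zero _
  have step : ∀ m : ℕ, ∫ θ in (0 : ℝ)..(2 * Real.pi),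
      (Circle.exp θ : ℂ)⁻¹ ^ (m + 1) * (u * Circle.exp θ / (1 - u * Circle.exp θ))
      = u * ((∫ θ in (0 : ℝ)..(2 * Real.pi), (Circle.exp θ : ℂ)⁻¹ ^ m) +
        ∫ θ in (0 : ℝ)..(2 * Real.pi),
          (Circle.exp θ : ℂ)⁻¹ ^ m * (u * Circle.exp θ / (1 - u * Circle.exp θ))) := fun m => by
    have hadd := intervalIntegral.integral_add (μ := volume) (a := 0) (b := 2 * Real.pi)
      (f := fun θ : ℝ => (Circle.exp θ : ℂ)⁻¹ ^ m)
      (g := fun θ : ℝ => (Circle.exp θ : ℂ)⁻¹ ^ m * (u * Circle.exp θ / (1 - u * Circle.exp θ)))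
      ((hci.pow m).intervalIntegrable _ _)
      (((hci.pow m).mul (continuous_geometric_kernel hu)).intervalIntegrable _ _)
    rw [← hadd, ← intervalIntegral.integral_const_mul]
    refine intervalIntegral.integral_congr fun θ _ => ?_
    have h1 := one_sub_mul_exp_ne_zero hu θ
    have h2 : (Circle.exp θ : ℂ) ≠ 0 := Circle.coe_ne_zero _
    change (Circle.exp θ : ℂ)⁻¹ ^ (m + 1) * (u * Circle.exp θ / (1 - u * Circle.exp θ))
      = u * ((Circle.exp θ : ℂ)⁻¹ ^ m
        + (Circle.exp θ : ℂ)⁻¹ ^ m * (u * Circle.exp θ / (1 - u * Circle.exp θ)))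
    rw [pow_succ]
    generalize (Circle.exp θ : ℂ) = e at h1 h2 ⊢
    have h3 : 1 + u * e / (1 - u * e) = 1 / (1 - u * e) := by
      rw [eq_div_iff h1, add_mul, div_mul_cancel₀ _ h1]; ring
    rw [← mul_one_add, h3]
    field_simp
  induction m with
  | zero =>
    rw [step, integral_inv_pow_exp, if_pos rfl]
    have := integral_pow_mul_kernel hu 0
    simp only [pow_zero] at this ⊢
    rw [this]
    ring
  | succ m ih =>
    rw [step, ih, integral_inv_pow_exp, if_neg (by omega)]
    ring

theorem densityTerm_re_eq (c : Ell ℕ) (n : ℕ) (θ : ℝ) : ((densityTerm 0 n θ * c n).re : ℂ)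
    = -(Ell.integ c n * (1 / 2) ^ (n + 1) * (Circle.exp θ : ℂ)⁻¹ ^ (n + 1)
      + (starRingEnd ℂ) (Ell.integ c n * (1 / 2) ^ (n + 1)) * (Circle.exp θ : ℂ) ^ (n + 1)) := by
  have h1 : densityTerm 0 n θ * c n
      = -2 * (Ell.integ c n * (1 / 2) ^ (n + 1) * (Circle.exp θ : ℂ)⁻¹ ^ (n + 1)) := by
    rw [densityTerm_zero_eq, Ell.coord_integ, div_pow, one_div, inv_pow 2]
    ring
  have h2 : (starRingEnd ℂ) ((Circle.exp θ : ℂ)⁻¹) = Circle.exp θ := by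
    rw [← Circle.coe_inv, ← Circle.coe_inv_eq_conj, inv_inv]
  rw [h1, re_eq_add_conj, map_mul, map_mul _ (_ * _), map_pow _ (_⁻¹), h2, map_neg, map_ofNat]
  ring

theorem hasSum_integral_density_mul (c : Ell ℕ) {K : ℝ → ℂ} (hK : Continuous K) :
    HasSum (fun n => ∫ θ in (0 : ℝ)..(2 * Real.pi), ((densityTerm 0 n θ * c n).re : ℂ) * K θ)
      (∫ θ in (0 : ℝ)..(2 * Real.pi), (density c (Circle.exp θ) : ℂ) * K θ) := by
  obtain ⟨B, hB⟩ : ∃ B, ∀ θ ∈ uIcc (0 : ℝ) (2 * Real.pi), ‖K θ‖ ≤ B :=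
    isCompact_uIcc.exists_bound_of_continuousOn hK.continuousOn
  have hcont : ∀ n, Continuous fun θ : ℝ => ((densityTerm 0 n θ * c n).re : ℂ) * K θ :=
    fun n => by
      have : Continuous (densityTerm 0 n) :=
        continuous_iff_continuousAt.mpr fun θ => (hasDerivAt_densityTerm 0 n θ).continuousAt
      exact (continuous_ofReal.comp (continuous_re.comp (this.mul continuous_const))).mul hK
  refine intervalIntegral.hasSum_integral_of_dominated_convergence (ι := ℕ) (μ := volume)
    (fun n _ => densityBound 0 * ‖c n‖ * B) (fun n => (hcont n).aestronglyMeasurable)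
    (fun n => Eventually.of_forall fun θ hθ => ?_)
    (Eventually.of_forall fun θ _ => (c.summable_norm.mul_left _).mul_right _)
    intervalIntegrable_const
    (Eventually.of_forall fun θ _ => ?_)
  · rw [norm_mul]
    refine mul_le_mul ?_ (hB θ (uIoc_subset_uIcc hθ)) (norm_nonneg _)
      (mul_nonneg (densityBound_nonneg 0) (norm_nonneg _))
    rw [norm_real]
    refine (abs_re_le_norm _).trans ?_
    rw [norm_mul]
    exact mul_le_mul_of_nonneg_right (norm_densityTerm_le 0 n θ) (norm_nonneg _)
  · have h1 : density c (Circle.exp θ) = densityDeriv 0 θ c :=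
      congrFun (circleLift_density c) θ
    rw [h1]
    exact ((hasSum_densityDeriv 0 θ c).mapL ofRealCLM).mul_right _

/-- The kernel detects only the negative harmonics of a real density. The conjugate half, needed to
make the density real, integrates to zero, so the potential is the power series of the negative
coefficients. -/
theorem integral_density_mul_kernel (c : Ell ℕ) {u : ℂ} (hu : ‖u‖ < 1) :
    ∫ θ in (0 : ℝ)..(2 * Real.pi), (density c (Circle.exp θ) : ℂ) *
        (-I * (u * Circle.exp θ / (1 - u * Circle.exp θ)))
      = 2 * Real.pi * I * psum (Ell.integ c) (u / 2) := by
  have hK := continuous_geometric_kernel hu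
  have hci : Continuous fun θ : ℝ => (Circle.exp θ : ℂ)⁻¹ :=
    continuous_circle_exp.inv₀ fun θ => Circle.coe_ne_zero _
  have hint : ∀ n, ∫ θ in (0 : ℝ)..(2 * Real.pi), ((densityTerm 0 n θ * c n).re : ℂ) *
        (-I * (u * Circle.exp θ / (1 - u * Circle.exp θ)))
      = 2 * Real.pi * I * (Ell.integ c n * (u / 2) ^ (n + 1)) := fun n => by
    have h1 : ∀ θ : ℝ, ((densityTerm 0 n θ * c n).re : ℂ) *
        (-I * (u * Circle.exp θ / (1 - u * Circle.exp θ)))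
        = I * (Ell.integ c n * (1 / 2) ^ (n + 1)) * ((Circle.exp θ : ℂ)⁻¹ ^ (n + 1) *
            (u * Circle.exp θ / (1 - u * Circle.exp θ)))
          + I * (starRingEnd ℂ) (Ell.integ c n * (1 / 2) ^ (n + 1)) * ((Circle.exp θ : ℂ) ^ (n + 1)
            * (u * Circle.exp θ / (1 - u * Circle.exp θ))) := fun θ => by
      rw [densityTerm_re_eq]; ring
    simp only [h1]
    rw [intervalIntegral.integral_add, intervalIntegral.integral_const_mul,
      intervalIntegral.integral_const_mul, integral_inv_pow_mul_kernel hu,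
      integral_pow_mul_kernel hu, div_pow u, one_div, inv_pow]
    · ring
    · exact (continuous_const.mul ((hci.pow _).mul hK)).intervalIntegrable _ _
    · exact (continuous_const.mul ((continuous_circle_exp.pow _).mul hK)).intervalIntegrable _ _
  have h := hasSum_integral_density_mul c
    (K := fun θ => -I * (u * Circle.exp θ / (1 - u * Circle.exp θ))) (continuous_const.mul hK)
  simp only [hint] at h
  have hw : ‖u / 2‖ ≤ 1 := by rw [norm_div, Complex.norm_ofNat]; linarith
  exact h.unique ((hasSum_psum (Ell.integ c) hw).mul_left _)

theorem integral_density (c : Ell ℕ) :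
    ∫ θ in (0 : ℝ)..(2 * Real.pi), density c (Circle.exp θ) = 0 := by
  have hci : Continuous fun θ : ℝ => (Circle.exp θ : ℂ)⁻¹ :=
    continuous_circle_exp.inv₀ fun θ => Circle.coe_ne_zero _
  have hint : ∀ n, ∫ θ in (0 : ℝ)..(2 * Real.pi), ((densityTerm 0 n θ * c n).re : ℂ) * 1 = 0 :=
    fun n => by
      have h1 : ∀ θ : ℝ, ((densityTerm 0 n θ * c n).re : ℂ) * 1
          = -(Ell.integ c n * (1 / 2) ^ (n + 1) * (Circle.exp θ : ℂ)⁻¹ ^ (n + 1)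
            + (starRingEnd ℂ) (Ell.integ c n * (1 / 2) ^ (n + 1)) * (Circle.exp θ : ℂ) ^ (n + 1)) :=
        fun θ => by rw [mul_one, densityTerm_re_eq]
      simp only [h1]
      rw [intervalIntegral.integral_neg, intervalIntegral.integral_add,
        intervalIntegral.integral_const_mul, intervalIntegral.integral_const_mul,
        integral_inv_pow_exp, if_neg n.succ_ne_zero, integral_pow_succ_exp]
      · simp
      · exact (continuous_const.mul (hci.pow _)).intervalIntegrable _ _
      · exact (continuous_const.mul (continuous_circle_exp.pow _)).intervalIntegrable _ _
  have h := hasSum_integral_density_mul c (K := fun _ => 1) continuous_const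
  have h2 := (funext hint : (fun n => ∫ θ in (0 : ℝ)..(2 * Real.pi),
    ((densityTerm 0 n θ * c n).re : ℂ) * 1) = fun _ => 0) ▸ h
  have h3 : ∫ θ in (0 : ℝ)..(2 * Real.pi), (density c (Circle.exp θ) : ℂ) * 1 = 0 :=
    h2.unique hasSum_zero
  simp only [mul_one] at h3
  rw [intervalIntegral.integral_ofReal] at h3
  exact ofReal_eq_zero.mp h3

theorem layerPotential_holderDensity {M ℓ : ℕ} {α : ℝ} (hα₀ : 0 < α) (hα₁ : α < 1) {ρ : ℝ}
    {ζ : Fin M → ℂ} (c : Fin M → Ell ℕ) {η : ℂ} (hη : η ∈ circularDomain ζ ρ) :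
    layerPotential ρ ζ (fun k => holderDensity ℓ hα₀ hα₁ (c k)) η
      = poleSum ρ ζ (fun k => Ell.integ (c k)) η := by
  have hpi : (Real.pi : ℂ) ≠ 0 := by exact_mod_cast Real.pi_ne_zero
  have key : ∀ k, ∫ θ in (0 : ℝ)..(2 * Real.pi),
      (holderDensity ℓ hα₀ hα₁ (c k) (Circle.exp θ) : ℂ) / (ρ * (Circle.exp θ : ℂ) + ζ k - η)
      * (ρ * (I * (Circle.exp θ : ℂ)))
      = 2 * Real.pi * I * psum (Ell.integ (c k)) (ρ / (η - ζ k) / 2) := fun k => by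
    have hne : η - ζ k ≠ 0 := norm_pos_iff.mp ((abs_nonneg ρ).trans_lt (hη k))
    have hu : ‖(ρ : ℂ) / (η - ζ k)‖ < 1 := by
      rw [norm_div, norm_real, Real.norm_eq_abs, div_lt_one (norm_pos_iff.mpr hne)]
      exact hη k
    rw [← integral_density_mul_kernel (c k) hu]
    refine intervalIntegral.integral_congr fun θ _ => ?_
    have h1 := one_sub_mul_exp_ne_zero hu θ
    -- With `u = ρ / (η - ζ k)` the Cauchy kernel becomes the geometric kernel.
    have h2 : (ρ : ℂ) * Circle.exp θ + ζ k - η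
        = -(η - ζ k) * (1 - ρ / (η - ζ k) * Circle.exp θ) := by
      field_simp; ring
    simp only [holderDensity_apply]
    rw [h2]
    generalize 1 - ρ / (η - ζ k) * (Circle.exp θ : ℂ) = d at *
    field_simp
  rw [layerPotential, poleSum]
  simp only [key]
  rw [← Finset.mul_sum]
  field_simp

/-! ### Holomorphy of the power series -/

theorem norm_psum_le (c : Ell ℕ) {w : ℂ} (hw : ‖w‖ ≤ 1) : ‖psum c w‖ ≤ ‖c‖ := by
  refine (norm_tsum_le_tsum_norm (summable_norm_psum c hw)).trans ?_
  rw [← c.hasSum_norm.tsum_eq]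
  refine (summable_norm_psum c hw).tsum_le_tsum (fun n => ?_) c.summable_norm
  rw [norm_mul, norm_pow]
  exact mul_le_of_le_one_right (norm_nonneg _) (pow_le_one₀ (norm_nonneg _) hw)

/-- The derivative of the integrated power series. -/
noncomputable def pder (c : Ell ℕ) (w : ℂ) : ℂ := ∑' n, c n * w ^ n

theorem summable_norm_pder (c : Ell ℕ) {w : ℂ} (hw : ‖w‖ ≤ 1) :
    Summable fun n => ‖c n * w ^ n‖ :=
  c.summable_norm.of_nonneg_of_le (fun _ => norm_nonneg _) fun n => by
    rw [norm_mul, norm_pow]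
    exact mul_le_of_le_one_right (norm_nonneg _) (pow_le_one₀ (norm_nonneg _) hw)

theorem norm_pder_le (c : Ell ℕ) {w : ℂ} (hw : ‖w‖ ≤ 1) : ‖pder c w‖ ≤ ‖c‖ := by
  refine (norm_tsum_le_tsum_norm (summable_norm_pder c hw)).trans ?_
  rw [← c.hasSum_norm.tsum_eq]
  refine (summable_norm_pder c hw).tsum_le_tsum (fun n => ?_) c.summable_norm
  rw [norm_mul, norm_pow]
  exact mul_le_of_le_one_right (norm_nonneg _) (pow_le_one₀ (norm_nonneg _) hw)

theorem mul_pder (c : Ell ℕ) (w : ℂ) : w * pder c w = psum c w := by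
  rw [pder, psum, ← tsum_mul_left]
  exact tsum_congr fun n => by ring

theorem hasDerivAt_psum_integ (c : Ell ℕ) {w : ℂ} (hw : ‖w‖ < 1) :
    HasDerivAt (psum (Ell.integ c)) (pder c w) w := by
  have hmem : ∀ {z : ℂ}, z ∈ Metric.ball (0 : ℂ) 1 → ‖z‖ ≤ 1 := fun hz => by
    simpa using (mem_ball_zero_iff.mp hz).le
  exact hasDerivAt_tsum_of_isPreconnected (u := fun n => ‖c n‖)
    (g := fun n z => Ell.integ c n * z ^ (n + 1)) (g' := fun n z => c n * z ^ n)
    (t := Metric.ball 0 1) (y₀ := w) c.summable_norm Metric.isOpen_ball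
    (convex_ball _ _).isPreconnected
    (fun n z _ => by
      refine ((hasDerivAt_pow (n + 1) z).const_mul (Ell.integ c n)).congr_deriv ?_
      rw [Ell.coord_integ]
      have : (n + 1 : ℂ) ≠ 0 := by exact_mod_cast n.succ_ne_zero
      push_cast
      field_simp)
    (fun n z hz => by
      rw [norm_mul, norm_pow]
      exact mul_le_of_le_one_right (norm_nonneg _) (pow_le_one₀ (norm_nonneg _) (hmem hz)))
    (by simpa using hw) (hasSum_psum (Ell.integ c) hw.le).summable (by simpa using hw)

/-- The series is `w` times the derivative of the holomorphic function `psum (Ell.integ c)`. -/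
theorem differentiableAt_psum (c : Ell ℕ) {w : ℂ} (hw : ‖w‖ < 1) :
    DifferentiableAt ℂ (psum c) w := by
  have h1 : DifferentiableOn ℂ (psum (Ell.integ c)) (Metric.ball 0 1) := fun z hz =>
    (hasDerivAt_psum_integ c (by simpa using hz)).differentiableAt.differentiableWithinAt
  have hmem : Metric.ball (0 : ℂ) 1 ∈ 𝓝 w := Metric.isOpen_ball.mem_nhds (by simpa using hw)
  have h2 := (h1.deriv Metric.isOpen_ball).differentiableAt hmem
  refine (differentiableAt_id.mul h2).congr_of_eventuallyEq ?_
  filter_upwards [hmem] with z hz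
  change psum c z = z * deriv (psum (Ell.integ c)) z
  rw [(hasDerivAt_psum_integ c (by simpa using hz)).deriv, mul_pder]

theorem norm_psum_integ_sub_le (c : Ell ℕ) {w z : ℂ} (hw : ‖w‖ < 1) (hz : ‖z‖ < 1) :
    ‖psum (Ell.integ c) w - psum (Ell.integ c) z‖ ≤ ‖c‖ * ‖w - z‖ :=
  Convex.norm_image_sub_le_of_norm_hasDerivWithin_le (s := Metric.ball (0 : ℂ) 1)
    (fun x hx => (hasDerivAt_psum_integ c (by simpa using hx)).hasDerivWithinAt)
    (fun x hx => norm_pder_le c (by simpa using (mem_ball_zero_iff.mp hx).le)) (convex_ball _ _)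
    (by simpa using hz) (by simpa using hw)

@[simp] theorem psum_zero_right (c : Ell ℕ) : psum c 0 = 0 := by simp [psum]

/-! ### Sums of poles -/

section Poles

variable {M : ℕ} {ρ : ℝ} {ζ : Fin M → ℂ} {η : ℂ}

/-- The halved argument of the pole series makes them converge down to half the core radius. The
conformal map and the velocity therefore continue holomorphically across the boundary circles. -/
theorem norm_half_pole_lt_one {z : ℂ} (h : |ρ| / 2 < ‖z‖) : ‖(ρ : ℂ) / z / 2‖ < 1 := by
  have : 0 < ‖z‖ := lt_of_le_of_lt (by positivity) h
  rw [norm_div, norm_div, norm_real, Real.norm_eq_abs, Complex.norm_ofNat, div_div,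
    div_lt_one (by positivity)]
  linarith

theorem ne_zero_of_lt_norm {z : ℂ} (h : |ρ| / 2 < ‖z‖) : z ≠ 0 :=
  norm_pos_iff.mp (lt_of_le_of_lt (by positivity) h)

theorem hasDerivAt_pole {z : ℂ} (hη : η - z ≠ 0) :
    HasDerivAt (fun η => (ρ : ℂ) / (η - z) / 2) (-(ρ / (η - z) / 2) / (η - z)) η := by
  have h := (((hasDerivAt_id η).sub_const z).inv hη).const_mul ((ρ : ℂ) / 2)
  refine (h.congr_of_eventuallyEq (Eventually.of_forall fun x => ?_)).congr_deriv ?_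
  · change (ρ : ℂ) / (x - z) / 2 = ρ / 2 * (x - z)⁻¹
    ring
  · change (ρ : ℂ) / 2 * (-1 / (η - z) ^ 2) = _
    field_simp

theorem differentiableAt_pole {z : ℂ} (hη : η - z ≠ 0) :
    DifferentiableAt ℂ (fun η => (ρ : ℂ) / (η - z)) η :=
  (differentiableAt_const _).div (differentiableAt_id.sub_const z) hη

theorem hasDerivAt_poleSum (c : Fin M → Ell ℕ) (hη : ∀ j, |ρ| / 2 < ‖η - ζ j‖) :
    HasDerivAt (poleSum ρ ζ fun j => Ell.integ (c j))
      (-∑ j, psum (c j) (ρ / (η - ζ j) / 2) / (η - ζ j)) η := by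
  rw [← Finset.sum_neg_distrib]
  refine HasDerivAt.fun_sum fun j _ => ?_
  have hne := ne_zero_of_lt_norm (hη j)
  refine ((hasDerivAt_psum_integ (c j) (norm_half_pole_lt_one (hη j))).comp η
    (hasDerivAt_pole hne)).congr_deriv ?_
  rw [← mul_pder]
  ring

theorem mul_sum_eq_poleDer (c : Fin M → Ell ℕ) :
    (ρ : ℂ) * ∑ j, psum (c j) (ρ / (η - ζ j) / 2) / (η - ζ j) = poleDer ρ ζ c η := by
  rw [Finset.mul_sum, poleDer]
  exact Finset.sum_congr rfl fun j _ => by ring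

theorem hasDerivAt_confMap (D : Fin M → Ell ℕ) (hη : ∀ j, |ρ| / 2 < ‖η - ζ j‖) :
    HasDerivAt (confMap ρ ζ D) (confDer ρ ζ D η) η := by
  refine ((hasDerivAt_id η).add ((hasDerivAt_poleSum D hη).const_mul ((ρ : ℂ) ^ 2))).congr_deriv ?_
  rw [confDer, ← mul_sum_eq_poleDer]
  ring

theorem differentiableAt_poleDer (c : Fin M → Ell ℕ) (hη : ∀ j, |ρ| / 2 < ‖η - ζ j‖) :
    DifferentiableAt ℂ (poleDer ρ ζ c) η := by
  refine DifferentiableAt.fun_sum fun j _ => ?_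
  have hne := ne_zero_of_lt_norm (hη j)
  exact (differentiableAt_pole hne).mul
    (DifferentiableAt.comp η (differentiableAt_psum (c j) (norm_half_pole_lt_one (hη j)))
      (hasDerivAt_pole hne).differentiableAt)

theorem norm_poleDer_le (c : Fin M → Ell ℕ) (hη : ∀ j, |ρ| ≤ ‖η - ζ j‖) :
    ‖poleDer ρ ζ c η‖ ≤ ∑ j, ‖c j‖ := by
  refine (norm_sum_le _ _).trans (Finset.sum_le_sum fun j _ => ?_)
  rw [norm_mul]
  refine (mul_le_mul (Wiener.norm_pole_le_one (hη j)) (norm_psum_le _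
    ((Wiener.norm_half_pole_le (hη j)).trans (by norm_num))) (norm_nonneg _) zero_le_one).trans ?_
  rw [one_mul]

theorem norm_confDer_sub_one_le (D : Fin M → Ell ℕ) (hη : ∀ j, |ρ| ≤ ‖η - ζ j‖) :
    ‖confDer ρ ζ D η - 1‖ ≤ |ρ| * ∑ j, ‖D j‖ := by
  rw [confDer, sub_sub_cancel_left, norm_neg, norm_mul, norm_real]
  exact mul_le_mul_of_nonneg_left (norm_poleDer_le D hη) (abs_nonneg _)

theorem differentiableAt_confDer (D : Fin M → Ell ℕ) (hη : ∀ j, |ρ| / 2 < ‖η - ζ j‖) :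
    DifferentiableAt ℂ (confDer ρ ζ D) η :=
  (differentiableAt_const _).sub ((differentiableAt_const _).mul (differentiableAt_poleDer D hη))

theorem differentiableAt_confVel (γ β : Fin M → ℝ) (C : Fin M → Ell ℕ)
    (hη : ∀ j, |ρ| / 2 < ‖η - ζ j‖) : DifferentiableAt ℂ (confVel ρ ζ γ β C) η := by
  refine DifferentiableAt.sub (DifferentiableAt.fun_sum fun j _ => ?_)
    (differentiableAt_poleDer C hη)
  exact (differentiableAt_const _).mul ((differentiableAt_const _).div
    (differentiableAt_id.sub_const _) (ne_zero_of_lt_norm (hη j)))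

theorem tendsto_const_div_sub (a z : ℂ) :
    Tendsto (fun η => a / (η - z)) (cocompact ℂ) (𝓝 0) := by
  have h1 : Tendsto (fun η : ℂ => η - z) (cocompact ℂ) (cocompact ℂ) :=
    (Homeomorph.subRight z).isClosedEmbedding.tendsto_cocompact
  have h2 := (tendsto_inv₀_cobounded (α := ℂ))
  rw [Metric.cobounded_eq_cocompact] at h2
  simpa [div_eq_mul_inv] using (h2.comp h1).const_mul a

theorem tendsto_psum_pole (c : Ell ℕ) (z : ℂ) :
    Tendsto (fun η => psum c (ρ / (η - z) / 2)) (cocompact ℂ) (𝓝 0) := by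
  have h1 := (tendsto_const_div_sub ρ z).div_const 2
  rw [zero_div] at h1
  have h2 := (differentiableAt_psum c (w := 0) (by simp)).continuousAt.tendsto
  rw [psum_zero_right] at h2
  exact h2.comp h1

theorem tendsto_poleSum (c : Fin M → Ell ℕ) :
    Tendsto (poleSum ρ ζ c) (cocompact ℂ) (𝓝 0) := by
  have h := tendsto_finsetSum Finset.univ fun j (_ : j ∈ Finset.univ) =>
    tendsto_psum_pole (ρ := ρ) (c j) (ζ j)
  rw [Finset.sum_const_zero] at h
  exact h

theorem tendsto_poleDer (c : Fin M → Ell ℕ) :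
    Tendsto (poleDer ρ ζ c) (cocompact ℂ) (𝓝 0) := by
  have h := tendsto_finsetSum Finset.univ fun j (_ : j ∈ Finset.univ) =>
    (tendsto_const_div_sub (ρ : ℂ) (ζ j)).mul (tendsto_psum_pole (ρ := ρ) (c j) (ζ j))
  simp only [mul_zero, Finset.sum_const_zero] at h
  exact h

theorem tendsto_confVel (γ β : Fin M → ℝ) (C : Fin M → Ell ℕ) :
    Tendsto (confVel ρ ζ γ β C) (cocompact ℂ) (𝓝 0) := by
  have h := (tendsto_finsetSum Finset.univ fun j (_ : j ∈ Finset.univ) =>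
    (tendsto_const_div_sub 1 (ζ j)).const_mul (((γ j : ℂ) + I * β j) / (2 * Real.pi * I))).sub
    (tendsto_poleDer (ρ := ρ) (ζ := ζ) C)
  simp only [mul_zero, Finset.sum_const_zero, sub_zero] at h
  exact h

theorem half_lt_of_mem_closed (hρ : ρ ≠ 0) (hη : η ∈ closedCircularDomain ζ ρ) (j : Fin M) :
    |ρ| / 2 < ‖η - ζ j‖ := by
  have := hη j
  have := abs_pos.mpr hρ
  linarith

theorem mem_closed_of_mem_sphere (hdisj : Pairwise fun j k => 2 * |ρ| < ‖ζ j - ζ k‖) {k : Fin M}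
    (hη : η ∈ Metric.sphere (ζ k) |ρ|) : η ∈ closedCircularDomain ζ ρ := fun j => by
  rw [mem_sphere_iff_norm] at hη
  by_cases hj : j = k
  · rw [hj, hη]
  · have h1 := hdisj (Ne.symm hj)
    have h2 := norm_sub_le_norm_sub_add_norm_sub (ζ k) η (ζ j)
    rw [norm_sub_rev (ζ k) η, hη] at h2
    linarith

/-- This part of the velocity has the single-valued primitive `-ρ poleSum`, so all circulation comes
from the simple poles. -/
theorem circleIntegral_poleDer (hρ : ρ ≠ 0)
    (hdisj : Pairwise fun j k => 2 * |ρ| < ‖ζ j - ζ k‖) (C : Fin M → Ell ℕ) (k : Fin M) :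
    (∮ η in C(ζ k, |ρ|), poleDer ρ ζ C η) = 0 := by
  refine circleIntegral.integral_eq_zero_of_hasDerivWithinAt (abs_nonneg ρ)
    (f := fun η => -(ρ * poleSum ρ ζ (fun j => Ell.integ (C j)) η)) fun η hη => ?_
  have h := ((hasDerivAt_poleSum C (half_lt_of_mem_closed hρ
    (mem_closed_of_mem_sphere hdisj hη))).const_mul (ρ : ℂ)).neg
  rw [mul_neg, neg_neg, mul_sum_eq_poleDer] at h
  exact h.hasDerivWithinAt

theorem circleIntegral_pole (hρ : ρ ≠ 0)
    (hdisj : Pairwise fun j k => 2 * |ρ| < ‖ζ j - ζ k‖) (a : ℂ) (j k : Fin M) :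
    (∮ η in C(ζ k, |ρ|), a / (2 * Real.pi * I) * (1 / (η - ζ j))) = if j = k then a else 0 := by
  have hpi : (Real.pi : ℂ) ≠ 0 := by exact_mod_cast Real.pi_ne_zero
  have hpos := abs_pos.mpr hρ
  rw [circleIntegral.integral_const_mul]
  simp only [one_div]
  split_ifs with hj
  · subst hj
    rw [circleIntegral.integral_sub_center_inv _ hpos.ne']
    field_simp
  · have hd : DifferentiableOn ℂ (fun η => (η - ζ j)⁻¹) (Metric.closedBall (ζ k) |ρ|) :=
      fun η hη => by
        have h1 := hdisj (Ne.symm hj)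
        have h2 := norm_sub_le_norm_sub_add_norm_sub (ζ k) η (ζ j)
        rw [norm_sub_rev (ζ k) η] at h2
        have h3 := mem_closedBall_iff_norm.mp hη
        have h4 : η - ζ j ≠ 0 := norm_pos_iff.mp (by linarith)
        exact DifferentiableAt.differentiableWithinAt
          (DifferentiableAt.fun_inv (differentiableAt_id.sub_const (ζ j)) h4)
    rw [(hd.diffContOnCl_ball subset_rfl).circleIntegral_eq_zero hpos.le, mul_zero]

theorem continuousOn_pole (hρ : ρ ≠ 0)
    (hdisj : Pairwise fun j k => 2 * |ρ| < ‖ζ j - ζ k‖) (a : ℂ) (j k : Fin M) :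
    ContinuousOn (fun η : ℂ => a * (1 / (η - ζ j))) (Metric.sphere (ζ k) |ρ|) := fun _ hη =>
  ((differentiableAt_const a).mul ((differentiableAt_const 1).div
    (differentiableAt_id.sub_const (ζ j)) (ne_zero_of_lt_norm (half_lt_of_mem_closed hρ
      (mem_closed_of_mem_sphere hdisj hη) j)))).continuousAt.continuousWithinAt

theorem circleIntegral_confVel (hρ : ρ ≠ 0)
    (hdisj : Pairwise fun j k => 2 * |ρ| < ‖ζ j - ζ k‖) (γ β : Fin M → ℝ) (C : Fin M → Ell ℕ)
    (k : Fin M) : (∮ η in C(ζ k, |ρ|), confVel ρ ζ γ β C η) = γ k + I * β k := by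
  have hpos := abs_nonneg ρ
  have hpd : CircleIntegrable (poleDer ρ ζ C) (ζ k) |ρ| :=
    ContinuousOn.circleIntegrable hpos fun η hη =>
      (differentiableAt_poleDer C (half_lt_of_mem_closed hρ
        (mem_closed_of_mem_sphere hdisj hη))).continuousAt.continuousWithinAt
  have hsum : CircleIntegrable (fun η => ∑ j, ((γ j : ℂ) + I * β j) / (2 * Real.pi * I)
      * (1 / (η - ζ j))) (ζ k) |ρ| :=
    ContinuousOn.circleIntegrable hpos
      (continuousOn_finsetSum _ fun j _ => continuousOn_pole hρ hdisj _ j k)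
  have h1 : (∮ η in C(ζ k, |ρ|), confVel ρ ζ γ β C η) =
      (∮ η in C(ζ k, |ρ|), ∑ j, ((γ j : ℂ) + I * β j) / (2 * Real.pi * I) * (1 / (η - ζ j)))
        - ∮ η in C(ζ k, |ρ|), poleDer ρ ζ C η := circleIntegral.integral_sub hsum hpd
  have h2 := circleIntegral.integral_fun_sum (s := Finset.univ)
    (f := fun (j : Fin M) η => ((γ j : ℂ) + I * β j) / (2 * Real.pi * I) * (1 / (η - ζ j)))
    (c := ζ k) (R := |ρ|) fun j _ =>
      ContinuousOn.circleIntegrable hpos (continuousOn_pole hρ hdisj _ j k)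
  rw [h1, circleIntegral_poleDer hρ hdisj, sub_zero, h2]
  simp only [circleIntegral_pole hρ hdisj]
  simp

end Poles

/-! ### Extension of the conformal map to a homeomorphism of the plane -/

/-- The inversion `w ↦ 1 / w`, continued by `w ↦ conj w` to the unit disk. -/
noncomputable def foldInv (w : ℂ) : ℂ := if 1 ≤ ‖w‖ then w⁻¹ else (starRingEnd ℂ) w

theorem norm_foldInv_le_one (w : ℂ) : ‖foldInv w‖ ≤ 1 := by
  unfold foldInv
  split_ifs with h
  · rw [norm_inv]
    exact inv_le_one_of_one_le₀ h
  · rw [RCLike.norm_conj]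
    exact (not_le.mp h).le

/-- The squares of `|1 - w conj z|` and `|w - z|` differ by `(1 - |w|²)(1 - |z|²)`, which is
nonpositive when the unit circle separates `w` from `z`. -/
theorem norm_inv_sub_conj_le {w z : ℂ} (hw : 1 ≤ ‖w‖) (hz : ‖z‖ < 1) :
    ‖w⁻¹ - (starRingEnd ℂ) z‖ ≤ ‖w - z‖ := by
  have hw0 : w ≠ 0 := norm_pos_iff.mp (by linarith)
  have h1 : ‖1 - w * (starRingEnd ℂ) z‖ ≤ ‖w - z‖ := by
    refine abs_le_of_sq_le_sq' ?_ (norm_nonneg _) |>.2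
    have e : ‖1 - w * (starRingEnd ℂ) z‖ ^ 2 =
        ‖w - z‖ ^ 2 + (1 - ‖w‖ ^ 2) * (1 - ‖z‖ ^ 2) := by
      simp only [← normSq_eq_norm_sq, normSq_apply, sub_re, sub_im, mul_re, mul_im, one_re, one_im,
        conj_re, conj_im]
      ring
    rw [e]
    have : (1 - ‖w‖ ^ 2) * (1 - ‖z‖ ^ 2) ≤ 0 :=
      mul_nonpos_of_nonpos_of_nonneg (by nlinarith) (by nlinarith [norm_nonneg z])
    linarith
  have h2 : w⁻¹ - (starRingEnd ℂ) z = w⁻¹ * (1 - w * (starRingEnd ℂ) z) := by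
    field_simp
  rw [h2, norm_mul, norm_inv]
  exact (mul_le_of_le_one_left (norm_nonneg _) (inv_le_one_of_one_le₀ hw)).trans h1

/-- The exterior of the disks is not convex, so a derivative bound there does not directly give a
Lipschitz bound. The fold moves the arguments of the series into a disk, which is convex, without
increasing distances. -/
theorem norm_foldInv_sub_le (w z : ℂ) : ‖foldInv w - foldInv z‖ ≤ ‖w - z‖ := by
  unfold foldInv
  split_ifs with hw hz hz
  · have hw0 : w ≠ 0 := norm_pos_iff.mp (by linarith)
    have hz0 : z ≠ 0 := norm_pos_iff.mp (by linarith)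
    have e : w⁻¹ - z⁻¹ = w⁻¹ * z⁻¹ * (z - w) := by field_simp
    rw [e, norm_mul, norm_mul, norm_inv, norm_inv, norm_sub_rev]
    refine mul_le_of_le_one_left (norm_nonneg _) ?_
    exact mul_le_one₀ (inv_le_one_of_one_le₀ hw) (by positivity) (inv_le_one_of_one_le₀ hz)
  · exact norm_inv_sub_conj_le hw (not_le.mp hz)
  · rw [norm_sub_rev, norm_sub_rev w]
    exact norm_inv_sub_conj_le hz (not_le.mp hw)
  · rw [← map_sub, RCLike.norm_conj]

section Extension

variable {M : ℕ} {ρ : ℝ} {ζ : Fin M → ℂ}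

/-- The conformal map, extended to the plane. -/
noncomputable def confExt (ρ : ℝ) (ζ : Fin M → ℂ) (D : Fin M → Ell ℕ) (η : ℂ) : ℂ :=
  η + ρ ^ 2 * ∑ j, psum (Ell.integ (D j)) (foldInv ((η - ζ j) / ρ) / 2)

theorem confExt_eq_confMap (hρ : ρ ≠ 0) (D : Fin M → Ell ℕ) {η : ℂ}
    (hη : η ∈ closedCircularDomain ζ ρ) : confExt ρ ζ D η = confMap ρ ζ D η := by
  rw [confExt, confMap, poleSum]
  congr 2
  refine Finset.sum_congr rfl fun j _ => ?_
  have h : 1 ≤ ‖(η - ζ j) / ρ‖ := by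
    rw [norm_div, norm_real, Real.norm_eq_abs, one_le_div (abs_pos.mpr hρ)]
    exact hη j
  rw [foldInv, if_pos h, inv_div]

/-- Each series is Lipschitz with constant `‖D j‖`, and the rescaling of its argument costs at most
`1/|ρ|`. The prefactor `ρ²` leaves one power of `|ρ|`, hence a small perturbation of the identity.
-/
theorem norm_confExt_sub_le (hρ : ρ ≠ 0) (D : Fin M → Ell ℕ) (x y : ℂ) :
    ‖confExt ρ ζ D x - confExt ρ ζ D y - (x - y)‖ ≤ |ρ| * (∑ j, ‖D j‖) * ‖x - y‖ := by
  have hpos := abs_pos.mpr hρ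
  have hlt : ∀ w : ℂ, ‖foldInv w / 2‖ < 1 := fun w => by
    rw [norm_div, Complex.norm_ofNat]
    linarith [norm_foldInv_le_one w]
  have e : confExt ρ ζ D x - confExt ρ ζ D y - (x - y) =
      (ρ : ℂ) ^ 2 * ∑ j, (psum (Ell.integ (D j)) (foldInv ((x - ζ j) / ρ) / 2) -
        psum (Ell.integ (D j)) (foldInv ((y - ζ j) / ρ) / 2)) := by
    rw [confExt, confExt, Finset.sum_sub_distrib]
    ring
  have hb : ∀ j, ‖psum (Ell.integ (D j)) (foldInv ((x - ζ j) / ρ) / 2) -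
        psum (Ell.integ (D j)) (foldInv ((y - ζ j) / ρ) / 2)‖ ≤ ‖D j‖ * (‖x - y‖ / |ρ|) := by
    intro j
    refine (norm_psum_integ_sub_le (D j) (hlt _) (hlt _)).trans
      (mul_le_mul_of_nonneg_left ?_ (norm_nonneg _))
    have h1 := norm_foldInv_sub_le ((x - ζ j) / ρ) ((y - ζ j) / ρ)
    rw [← sub_div, sub_sub_sub_cancel_right, norm_div, norm_real, Real.norm_eq_abs] at h1
    rw [← sub_div, norm_div, Complex.norm_ofNat]
    linarith [norm_nonneg (foldInv ((x - ζ j) / ρ) - foldInv ((y - ζ j) / ρ))]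
  rw [e, norm_mul, norm_pow, norm_real, Real.norm_eq_abs]
  calc |ρ| ^ 2 * _ ≤ |ρ| ^ 2 * ∑ j, ‖D j‖ * (‖x - y‖ / |ρ|) :=
        mul_le_mul_of_nonneg_left (norm_sum_le_of_le _ fun j _ => hb j) (by positivity)
    _ = _ := by
        rw [← Finset.sum_mul]
        field_simp

/-- A perturbation of the identity that is Lipschitz with a constant `δ < 1` is a
homeomorphism. -/
theorem exists_homeomorph_of_norm_sub_le {F : ℂ → ℂ} {δ : ℝ} (h0 : 0 ≤ δ) (h1 : δ < 1)
    (hF : ∀ x y, ‖F x - F y - (x - y)‖ ≤ δ * ‖x - y‖) : ∃ e : ℂ ≃ₜ ℂ, ⇑e = F := by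
  have ha : ApproximatesLinearOn F ((ContinuousLinearEquiv.refl ℂ ℂ : ℂ ≃L[ℂ] ℂ) : ℂ →L[ℂ] ℂ)
      univ ⟨δ, h0⟩ := fun x _ y _ => hF x y
  refine ⟨ha.toHomeomorph F (Or.inr ?_), rfl⟩
  have h2 : ‖((ContinuousLinearEquiv.refl ℂ ℂ).symm : ℂ →L[ℂ] ℂ)‖₊ = 1 := by
    ext
    exact ContinuousLinearMap.norm_id
  rw [h2, inv_one]
  exact h1

theorem tendsto_confDer (D : Fin M → Ell ℕ) :
    Tendsto (confDer ρ ζ D) (cocompact ℂ) (𝓝 1) := by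
  have h := ((tendsto_poleDer (ρ := ρ) (ζ := ζ) D).const_mul (ρ : ℂ)).const_sub 1
  rw [mul_zero, sub_zero] at h
  exact h

end Extension

/-! ### From conformal solutions to hollow vortices -/

/-- The point `x` is compared with `y = η - ε(η - ζ)`, at distance `(1 - ε)r` from the center. The
images of `x` and `y` differ by at most `2δεr`, and `F` contracts distances by at most `1 - δ`.
Hence `|x - y| ≤ 2δεr / (1 - δ)`, which is below `εr` exactly because `δ < 1/3`. -/
theorem norm_sub_center_le_of_near_identity {F : ℂ → ℂ} {δ ε r : ℝ} {ζ η x a : ℂ}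
    (h1 : δ < 1 / 3) (hF : ∀ x y, ‖F x - F y - (x - y)‖ ≤ δ * ‖x - y‖)
    (hη : ‖η - ζ‖ = r) (hr : 0 < r) (ha : ‖a - 1‖ ≤ δ) (hε : 0 < ε) (hε1 : ε < 1)
    (hx : F x = F η - ε * (η - ζ) * a) : ‖x - ζ‖ < r := by
  have hnε : ‖(ε : ℂ)‖ = ε := by rw [norm_real, Real.norm_eq_abs, abs_of_pos hε]
  set y := η - ε * (η - ζ) with hy
  have hyη : ‖y - η‖ = ε * r := by
    rw [hy, sub_sub_cancel_left, norm_neg, norm_mul, hnε, hη]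
  have hyζ : ‖y - ζ‖ = (1 - ε) * r := by
    have : y - ζ = ((1 - ε : ℝ) : ℂ) * (η - ζ) := by
      rw [hy]; push_cast; ring
    rw [this, norm_mul, norm_real, Real.norm_eq_abs, abs_of_pos (by linarith), hη]
  have h2 : ‖F x - F y‖ ≤ 2 * δ * (ε * r) := by
    have e : F x - F y = -(F y - F η - (y - η)) - ε * (η - ζ) * (a - 1) := by
      rw [hx, hy]; ring
    have h3 := hF y η
    have h4 : ‖(ε : ℂ) * (η - ζ) * (a - 1)‖ ≤ ε * r * δ := by
      rw [norm_mul, norm_mul, hnε, hη]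
      exact mul_le_mul_of_nonneg_left ha (by positivity)
    rw [e]
    refine (norm_sub_le _ _).trans ?_
    rw [norm_neg]
    rw [hyη] at h3
    linarith
  have h3 : (1 - δ) * ‖x - y‖ ≤ ‖F x - F y‖ := by
    have h4 := hF x y
    have h5 := norm_sub_norm_le (x - y) (x - y - (F x - F y))
    rw [sub_sub_cancel, norm_sub_rev (x - y) (F x - F y)] at h5
    linarith
  have hεr : 0 < ε * r := by positivity
  have h4 : ‖x - y‖ < ε * r := by
    by_contra hcon
    push Not at hcon
    nlinarith
  have h5 := norm_sub_le_norm_sub_add_norm_sub x y ζ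
  rw [hyζ] at h5
  linarith

section Geometry

variable {M : ℕ} {ρ : ℝ} {ζ : Fin M → ℂ}

theorem isOpen_circularDomain : IsOpen (circularDomain ζ ρ) := by
  have : circularDomain ζ ρ = ⋂ k, {η | |ρ| < ‖η - ζ k‖} := by
    ext; simp [circularDomain]
  rw [this]
  exact isOpen_iInter_of_finite fun k => isOpen_lt continuous_const (by fun_prop)

theorem isClosed_closedCircularDomain : IsClosed (closedCircularDomain ζ ρ) := by
  have : closedCircularDomain ζ ρ = ⋂ k, {η | |ρ| ≤ ‖η - ζ k‖} := by
    ext; simp [closedCircularDomain]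
  rw [this]
  exact isClosed_iInter fun k => isClosed_le continuous_const (by fun_prop)

theorem circularDomain_subset : circularDomain ζ ρ ⊆ closedCircularDomain ζ ρ :=
  fun _ h k => (h k).le

theorem closure_core (hρ : ρ ≠ 0) (F : ℂ ≃ₜ ℂ) (k : Fin M) :
    closure (F '' Metric.ball (ζ k) |ρ|) = F '' Metric.closedBall (ζ k) |ρ| := by
  rw [← F.image_closure, closure_ball _ (abs_pos.mpr hρ).ne']

theorem frontier_core (hρ : ρ ≠ 0) (F : ℂ ≃ₜ ℂ) (k : Fin M) :
    frontier (F '' Metric.ball (ζ k) |ρ|) = F '' Metric.sphere (ζ k) |ρ| := by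
  rw [← F.image_frontier, frontier_ball _ (abs_pos.mpr hρ).ne']

theorem compl_iUnion_core (hρ : ρ ≠ 0) (F : ℂ ≃ₜ ℂ) :
    (⋃ k, closure (F '' Metric.ball (ζ k) |ρ|))ᶜ = F '' circularDomain ζ ρ := by
  simp only [closure_core hρ]
  rw [← image_iUnion, ← image_compl_eq F.bijective]
  congr 1
  ext η
  simp [circularDomain, dist_eq_norm]

theorem closure_fluidDomain_subset (F : ℂ ≃ₜ ℂ) :
    closure (F '' circularDomain ζ ρ) ⊆ F '' closedCircularDomain ζ ρ := by
  rw [← F.image_closure]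
  exact image_mono (closure_minimal circularDomain_subset isClosed_closedCircularDomain)

end Geometry

/-! ### Bernoulli's law in the rotating and contracting frame. -/

section Flow

/-- The velocity of the self-similar flow whose inertial part is the conjugate of `h`. -/
noncomputable def frameVelocity (c : ℂ) (h : ℂ → ℂ) (ξ : ℂ) : ℂ := (starRingEnd ℂ) (h ξ) + c * ξ

/-- The pressure given by Bernoulli's law. -/
noncomputable def bernoulliPressure (c : ℂ) (U : ℂ → ℂ) (ξ : ℂ) : ℝ :=
  -(1 / 2) * ‖U ξ‖ ^ 2 + 1 / 2 * ‖c‖ ^ 2 * ‖ξ‖ ^ 2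

theorem hasFDerivAt_frameVelocity {c a : ℂ} {h : ℂ → ℂ} {ξ : ℂ} (hh : HasDerivAt h a ξ) :
    HasFDerivAt (frameVelocity c h)
      ((conjCLE : ℂ →L[ℝ] ℂ) ∘L (a • (1 : ℂ →L[ℝ] ℂ)) + c • (1 : ℂ →L[ℝ] ℂ)) ξ := by
  refine HasFDerivAt.add ?_ ?_
  · refine conjCLE.hasFDerivAt.comp ξ (hh.complexToReal_fderiv.congr_fderiv ?_)
    ext v
    simp
  · exact (hasFDerivAt_id ξ).const_smul c

theorem contDiffOn_frameVelocity {c : ℂ} {h : ℂ → ℂ} {s : Set ℂ} (hs : IsOpen s)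
    (hh : DifferentiableOn ℂ h s) : ContDiffOn ℝ 1 (frameVelocity c h) s :=
  (conjCLE.contDiff.comp_contDiffOn ((hh.contDiffOn hs).restrict_scalars ℝ)).add
    (contDiffOn_const.mul contDiffOn_id)

/-- The identity `(U · ∇)U = ∇|U|²/2 + (curl U) U^⊥` is at work. The conjugate of a holomorphic
function is irrotational, so `curl U = 2 Im c`, and the Coriolis term cancels the vortical part.
Only gradients remain. -/
theorem momentum_frameVelocity {c a : ℂ} {h : ℂ → ℂ} {ξ : ℂ} (hh : HasDerivAt h a ξ) :
    fderiv ℝ (frameVelocity c h) ξ (frameVelocity c h ξ)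
      + 2 * ((-c.im : ℝ) : ℂ) * (I * frameVelocity c h ξ) - ((‖c‖ ^ 2 : ℝ) : ℂ) * ξ
      = -gradient (bernoulliPressure c (frameVelocity c h)) ξ := by
  have hU := hasFDerivAt_frameVelocity (c := c) hh
  set U := frameVelocity c h with hUdef
  have hP : HasFDerivAt (bernoulliPressure c U)
      (-(1 / 2 : ℝ) • (2 • (innerSL ℝ (U ξ)).comp
        ((conjCLE : ℂ →L[ℝ] ℂ) ∘L (a • (1 : ℂ →L[ℝ] ℂ)) + c • (1 : ℂ →L[ℝ] ℂ)))
        + (1 / 2 * ‖c‖ ^ 2 : ℝ) • (2 • innerSL ℝ ξ)) ξ := by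
    have h1 := (hU.norm_sq.const_smul (-(1 / 2 : ℝ)))
    have h2 := ((hasFDerivAt_id (𝕜 := ℝ) ξ).norm_sq.const_smul (1 / 2 * ‖c‖ ^ 2 : ℝ))
    refine (h1.add h2).congr_fderiv ?_
    ext v
    simp
  have hg : HasGradientAt (bernoulliPressure c U)
      (-(fderiv ℝ U ξ (U ξ) + 2 * ((-c.im : ℝ) : ℂ) * (I * U ξ) - ((‖c‖ ^ 2 : ℝ) : ℂ) * ξ)) ξ := by
    rw [hasGradientAt_iff_hasFDerivAt]
    refine hP.congr_fderiv ?_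
    rw [hU.fderiv]
    generalize ‖c‖ ^ 2 = K
    ext v
    simp [Complex.inner]
    ring
  rw [hg.gradient, neg_neg]

end Flow

/-! ### Transport of conformal solutions to the physical plane. -/

namespace IsConformalSolution

section

variable {M : ℕ} {Λ : VortexParams M} {ρ : ℝ} {q : Fin M → ℝ} {F : ℂ ≃ₜ ℂ} {f' w' : ℂ → ℂ}

/-- The inertial part of the velocity in the physical plane. -/
noncomputable def inertialVelocity (F : ℂ ≃ₜ ℂ) (f' w' : ℂ → ℂ) (ξ : ℂ) : ℂ :=
  w' (F.symm ξ) / f' (F.symm ξ)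

theorem frameVelocity_map (c : ℂ) (η : ℂ) :
    frameVelocity ((starRingEnd ℂ) (I * c)) (inertialVelocity F f' w') (F η)
      = (starRingEnd ℂ) (conformalVelocity c F f' w' η) := by
  simp [frameVelocity, inertialVelocity, conformalVelocity]

theorem differentiableAt_inertialVelocity (h : IsConformalSolution Λ ρ q F f' w') {η : ℂ}
    (hη : η ∈ circularDomain Λ.center ρ) :
    DifferentiableAt ℂ (inertialVelocity F f' w') (F η) := by
  have hne := h.deriv_ne_zero η (circularDomain_subset hη)
  have hsymm : HasDerivAt F.symm (f' η)⁻¹ (F η) := by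
    refine HasDerivAt.of_local_left_inverse F.symm.continuous.continuousAt ?_ hne
      (Eventually.of_forall fun x => F.apply_symm_apply x)
    rw [F.symm_apply_apply]
    exact h.hasDerivAt η hη
  have hnhds := isOpen_circularDomain.mem_nhds hη
  have hf' : DifferentiableAt ℂ f' η := by
    have h1 : DifferentiableOn ℂ F (circularDomain Λ.center ρ) := fun x hx =>
      (h.hasDerivAt x hx).differentiableAt.differentiableWithinAt
    refine ((h1.deriv isOpen_circularDomain).differentiableAt hnhds).congr_of_eventuallyEq ?_
    filter_upwards [hnhds] with x hx
    exact (h.hasDerivAt x hx).deriv.symm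
  have hw' : DifferentiableAt ℂ w' η := h.potential_differentiableOn.differentiableAt hnhds
  have hq : DifferentiableAt ℂ (fun x => w' x / f' x) (F.symm (F η)) := by
    rw [F.symm_apply_apply]
    exact hw'.div hf' hne
  exact hq.comp (F η) hsymm.differentiableAt

theorem continuousOn_inertialVelocity (h : IsConformalSolution Λ ρ q F f' w') :
    ContinuousOn (inertialVelocity F f' w') (F '' closedCircularDomain Λ.center ρ) := by
  have h1 : ContinuousOn (fun x => w' x / f' x) (closedCircularDomain Λ.center ρ) :=
    h.potential_continuousOn.div h.continuousOn_deriv h.deriv_ne_zero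
  refine h1.comp F.symm.continuous.continuousOn ?_
  rintro _ ⟨x, hx, rfl⟩
  simpa using hx

theorem disjoint_core (h : IsConformalSolution Λ ρ q F f' w') (hρ : ρ ≠ 0) :
    Pairwise fun j k => Disjoint (closure (F '' Metric.ball (Λ.center j) |ρ|))
      (closure (F '' Metric.ball (Λ.center k) |ρ|)) := fun j k hjk => by
  simp only [closure_core hρ]
  rw [disjoint_image_iff F.injective]
  refine Metric.closedBall_disjoint_closedBall ?_
  rw [dist_eq_norm]
  linarith [h.disks_disjoint hjk]

/-- The parametrized boundary of a core. -/
theorem exists_boundary_curve (h : IsConformalSolution Λ ρ q F f' w') (hρ : ρ ≠ 0) {δ : ℝ}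
    (hδ : δ < 1 / 3) (hF : ∀ x y, ‖F x - F y - (x - y)‖ ≤ δ * ‖x - y‖)
    (hf' : ∀ η ∈ closedCircularDomain Λ.center ρ, ‖f' η - 1‖ ≤ δ) {g : ℂ → ℂ}
    (hg : ∀ η ∈ closedCircularDomain Λ.center ρ, g η = F η ∧ HasDerivAt g (f' η) η)
    (k : Fin M) :
    ∃ c : ℝ → ℂ, ContDiff ℝ 1 c ∧ Function.Periodic c (2 * Real.pi) ∧
      InjOn c (Ico 0 (2 * Real.pi)) ∧ range c = F '' Metric.sphere (Λ.center k) |ρ| ∧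
      (∀ θ, deriv c θ ≠ 0) ∧
      (∀ θ, ∀ᶠ ε : ℝ in 𝓝[>] 0,
        c θ + ε * (I * deriv c θ) ∈ F '' Metric.ball (Λ.center k) |ρ|) ∧
      ∀ θ, c θ = F (circleMap (Λ.center k) |ρ| θ) ∧
        deriv c θ = f' (circleMap (Λ.center k) |ρ| θ) * (circleMap 0 |ρ| θ * I) := by
  have hpos := abs_pos.mpr hρ
  set e : ℝ → ℂ := circleMap (Λ.center k) |ρ| with he
  have hsph : ∀ θ, e θ ∈ Metric.sphere (Λ.center k) |ρ| := circleMap_mem_sphere _ hpos.le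
  have hmem : ∀ θ, e θ ∈ closedCircularDomain Λ.center ρ := fun θ =>
    mem_closed_of_mem_sphere h.disks_disjoint (hsph θ)
  -- The homeomorphism `F` need not be differentiable on the circle. It agrees there with `g`, which
  -- is holomorphic at the boundary points and supplies the tangent.
  have hc : (fun θ => F (e θ)) = fun θ => g (e θ) := funext fun θ => (hg _ (hmem θ)).1.symm
  have hd : ∀ θ, HasDerivAt (fun θ => F (e θ)) (f' (e θ) * (circleMap 0 |ρ| θ * I)) θ :=
    fun θ => by
      rw [hc]
      exact HasDerivAt.comp_of_eq θ (hg _ (hmem θ)).2 (hasDerivAt_circleMap _ _ θ) rfl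
  have hderiv : ∀ θ, deriv (fun θ => F (e θ)) θ = f' (e θ) * (circleMap 0 |ρ| θ * I) :=
    fun θ => (hd θ).deriv
  refine ⟨fun θ => F (e θ), ?_, ?_, ?_, ?_, ?_, ?_, fun θ => ⟨rfl, hderiv θ⟩⟩
  · rw [contDiff_one_iff_deriv]
    refine ⟨fun θ => (hd θ).differentiableAt, ?_⟩
    rw [funext hderiv]
    exact (h.continuousOn_deriv.comp_continuous (continuous_circleMap _ _) hmem).mul
      ((continuous_circleMap _ _).mul continuous_const)
  · intro θ
    change F (e (θ + 2 * Real.pi)) = F (e θ)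
    rw [he, periodic_circleMap]
  · refine F.injective.comp_injOn ?_
    exact injOn_circleMap_of_abs_sub_le' hpos.ne' (by simp)
  · rw [range_comp' F e, he, range_circleMap, abs_abs]
  · intro θ
    rw [hderiv]
    exact mul_ne_zero (h.deriv_ne_zero _ (hmem θ))
      (mul_ne_zero (circleMap_ne_center hpos.ne') I_ne_zero)
  · intro θ
    filter_upwards [Ioo_mem_nhdsGT (zero_lt_one' ℝ)] with ε hε
    rw [hderiv]
    refine ⟨F.symm (F (e θ) + ε * (I * (f' (e θ) * (circleMap 0 |ρ| θ * I)))), ?_,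
      F.apply_symm_apply _⟩
    rw [mem_ball_iff_norm]
    -- `I` times the tangent is minus `f'` times the radius vector, an almost radial direction into
    -- the disk because `f'` is close to `1`.
    refine norm_sub_center_le_of_near_identity hδ hF (mem_sphere_iff_norm.mp (hsph θ)) hpos
      (hf' _ (hmem θ)) hε.1 hε.2 ?_
    rw [F.apply_symm_apply, he, circleMap_sub_center]
    linear_combination (ε * f' (circleMap (Λ.center k) |ρ| θ) * circleMap 0 |ρ| θ : ℂ) * I_sq

theorem circulation_eq (h : IsConformalSolution Λ ρ q F f' w') (k : Fin M) :
    ∫ θ in (0 : ℝ)..(2 * Real.pi), (circleMap 0 |ρ| θ * I * w' (circleMap (Λ.center k) |ρ| θ)).re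
      = Λ.strength k := by
  rw [← h.circulation k, circleIntegral]
  simp only [deriv_circleMap, smul_eq_mul]
  have hc : Continuous fun θ => circleMap 0 |ρ| θ * I * w' (circleMap (Λ.center k) |ρ| θ) :=
    ((continuous_circleMap _ _).mul continuous_const).mul
      (h.potential_continuousOn.comp_continuous (continuous_circleMap _ _) fun θ =>
        mem_closed_of_mem_sphere h.disks_disjoint (circleMap_mem_sphere _ (abs_nonneg ρ) θ))
  exact (reCLM.intervalIntegral_comp_comm (hc.intervalIntegrable _ _))

/-- A conformal solution whose conformal map is close to the identity defines a configuration of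
imploding hollow vortices. -/
theorem isImplodingHollowVortex (h : IsConformalSolution Λ ρ q F f' w') (hρ : ρ ≠ 0) {δ : ℝ}
    (hδ : δ < 1 / 3) (hF : ∀ x y, ‖F x - F y - (x - y)‖ ≤ δ * ‖x - y‖)
    (hf' : ∀ η ∈ closedCircularDomain Λ.center ρ, ‖f' η - 1‖ ≤ δ) {g : ℂ → ℂ}
    (hg : ∀ η ∈ closedCircularDomain Λ.center ρ, g η = F η ∧ HasDerivAt g (f' η) η)
    (hlim : Tendsto f' (cocompact ℂ) (𝓝 1)) (him : Λ.cOmega.im < 0) :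
    IsImplodingHollowVortex Λ.collapseTime Λ.angular Λ.strength
      (fun k => F '' Metric.ball (Λ.center k) |ρ|)
      (frameVelocity ((starRingEnd ℂ) (I * Λ.cOmega)) (inertialVelocity F f' w'))
      (bernoulliPressure ((starRingEnd ℂ) (I * Λ.cOmega))
        (frameVelocity ((starRingEnd ℂ) (I * Λ.cOmega)) (inertialVelocity F f' w'))) := by
  set c := (starRingEnd ℂ) (I * Λ.cOmega) with hc
  set U := frameVelocity c (inertialVelocity F f' w') with hU
  have hκ : Λ.collapseTime = -1 / (2 * Λ.cOmega.im) := rfl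
  have hcim : c.im = -Λ.angular := by simp [hc, VortexParams.angular]
  have hcre : c.re = 1 / (2 * Λ.collapseTime) := by
    rw [hκ, hc]
    have := him.ne
    simp
    field_simp
  have hκpos : 0 < Λ.collapseTime := by
    rw [hκ]; exact div_pos_of_neg_of_neg (by norm_num) (by linarith)
  have hcn : ‖c‖ ^ 2 = 1 / (4 * Λ.collapseTime ^ 2) + Λ.angular ^ 2 := by
    rw [← normSq_eq_norm_sq, normSq_apply, hcre, hcim]
    field_simp
    ring
  have hceq : c = 1 / (2 * Λ.collapseTime) - I * Λ.angular := by
    apply Complex.ext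
    · rw [hcre]; simp
    · rw [hcim]; simp
  have hdom := compl_iUnion_core (ζ := Λ.center) hρ F
  have hopen : IsOpen (F '' circularDomain Λ.center ρ) := F.isOpenMap _ isOpen_circularDomain
  have hh : ∀ ξ ∈ F '' circularDomain Λ.center ρ,
      HasDerivAt (inertialVelocity F f' w') (deriv (inertialVelocity F f' w') ξ) ξ := by
    rintro _ ⟨η, hη, rfl⟩
    exact (h.differentiableAt_inertialVelocity hη).hasDerivAt
  have hUcd : ContDiffOn ℝ 1 U (F '' circularDomain Λ.center ρ) :=
    contDiffOn_frameVelocity hopen fun ξ hξ => (hh ξ hξ).differentiableAt.differentiableWithinAt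
  have hUc : ContinuousOn U (F '' closedCircularDomain Λ.center ρ) :=
    (continuous_conj.comp_continuousOn h.continuousOn_inertialVelocity).add
      (continuousOn_const.mul continuousOn_id)
  have hUF : ∀ η, U (F η) = (starRingEnd ℂ) (conformalVelocity Λ.cOmega F f' w' η) :=
    frameVelocity_map _
  -- Undoing the motion of the frame cancels `c ξ` and leaves the conjugate of the holomorphic
  -- velocity.
  have hin : ∀ ξ, U ξ + Λ.angular * (I * ξ) - ξ / (2 * Λ.collapseTime)
      = (starRingEnd ℂ) (inertialVelocity F f' w' ξ) := fun ξ => by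
    rw [hU, frameVelocity, hceq]
    ring
  have hfd : ∀ ξ ∈ F '' circularDomain Λ.center ρ, fderiv ℝ U ξ = _ := fun ξ hξ =>
    (hasFDerivAt_frameVelocity (c := c) (hh ξ hξ)).fderiv
  refine ⟨hκpos, fun k => F.isOpenMap _ Metric.isOpen_ball, fun k => ?_, fun k => ?_,
    h.disjoint_core hρ, ?_, ?_, ?_, ?_, ?_, ?_, ?_, ?_, fun k => ?_, fun k => ?_⟩
  · exact ((convex_ball _ _).isConnected ⟨_, Metric.mem_ball_self (abs_pos.mpr hρ)⟩).image F
      F.continuous.continuousOn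
  · refine ((isCompact_closedBall (Λ.center k) |ρ|).image F.continuous).isBounded.subset ?_
    exact image_mono Metric.ball_subset_closedBall
  · rw [hdom]; exact hUcd
  · rw [hdom]
    exact (contDiffOn_const.mul (hUcd.norm_sq ℝ)).add
      (contDiffOn_const.mul (contDiffOn_id.norm_sq ℝ))
  · rw [hdom]; exact hUc.mono (closure_fluidDomain_subset F)
  · rw [hdom]
    exact ((continuousOn_const.mul (hUc.norm.pow 2)).add
      (continuousOn_const.mul (continuousOn_id.norm.pow 2))).mono (closure_fluidDomain_subset F)
  · rw [hdom]
    intro ξ hξ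
    have hm := momentum_frameVelocity (c := c) (hh ξ hξ)
    rw [hcim, neg_neg, hcn] at hm
    exact hm
  · rw [hdom]
    intro ξ hξ
    rw [hfd ξ hξ]
    simp [hcre]
    ring
  · rw [hdom]
    intro ξ hξ
    rw [hfd ξ hξ]
    simp [hcim]
    ring
  · simp only [hin]
    have h1 : Tendsto (fun x => w' x / f' x) (cocompact ℂ) (𝓝 0) := by
      have h0 := h.potential_infinity.div hlim one_ne_zero
      rwa [zero_div] at h0
    have h2 := h1.comp F.symm.isClosedEmbedding.tendsto_cocompact
    have h3 := (continuous_conj.tendsto 0).comp h2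
    rw [map_zero] at h3
    exact h3
  · obtain ⟨b, hb1, hb2, hb3, hb4, hb5, hb6, hb7⟩ := h.exists_boundary_curve hρ hδ hF hf' hg k
    have hsph := circleMap_mem_sphere (Λ.center k) (abs_nonneg ρ)
    refine ⟨b, hb1, hb2, hb3, hb4.trans (frontier_core hρ F k).symm, hb5, hb6, fun θ => ?_, ?_⟩
    · have hk := h.kinematic k _ (hsph θ)
      rw [(hb7 θ).1, (hb7 θ).2, hUF, Complex.inner, ← map_mul, conj_re, ← neg_eq_zero, ← hk,
        circleMap_sub_center, ← neg_re]
      congr 1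
      linear_combination (-(conformalVelocity Λ.cOmega F f' w' (circleMap (Λ.center k) |ρ| θ)
        * f' (circleMap (Λ.center k) |ρ| θ) * circleMap 0 |ρ| θ)) * I_sq
    -- The factor `f'` of the tangent cancels the denominator of the velocity, so the circulation is
    -- that of `w'` on the round circle.
    · rw [← h.circulation_eq k]
      refine intervalIntegral.integral_congr fun θ _ => ?_
      have hne := h.deriv_ne_zero _ (mem_closed_of_mem_sphere h.disks_disjoint (hsph θ))
      rw [hin, (hb7 θ).2, (hb7 θ).1, Complex.inner, ← map_mul, conj_re, inertialVelocity,
        F.symm_apply_apply]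
      congr 1
      field_simp
  · refine ⟨-q k, ?_⟩
    intro ξ hξ
    rw [frontier_core hρ] at hξ
    obtain ⟨η, hη, rfl⟩ := hξ
    have hd := h.dynamic k η hη
    have hcΩ : ‖c‖ = ‖Λ.cOmega‖ := by rw [hc, RCLike.norm_conj, norm_mul, norm_I, one_mul]
    rw [bernoulliPressure, hUF, RCLike.norm_conj, hcΩ]
    linarith

end

end IsConformalSolution

/-! ### The bifurcation curve -/

section Bifurcation

open Wiener

variable {M : ℕ}

/-- Apart from `ρ ≠ 0`, the conditions follow from strict or open ones that hold at `ρ = 0`, because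
the centers are distinct there. -/
theorem eventually_admissible {ζ : ℝ → Fin M → ℂ} (hζ : AnalyticAt ℝ ζ 0)
    (hinj : Function.Injective (ζ 0)) : ∀ᶠ ρ in 𝓝 0, ρ ≠ 0 → Admissible ρ (ζ ρ) := by
  have hid : AnalyticAt ℝ (fun ρ : ℝ => ρ) 0 := analyticAt_id
  have key : ∀ k j, ∀ᶠ ρ in 𝓝 0, j ≠ k → 2 * |ρ| < ‖ζ ρ k - ζ ρ j‖ ∧
      IsUnit (cmul (ζ ρ k - ζ ρ j) + ρ • shift) ∧ ‖(ρ / 2) • opInv ρ (ζ ρ) k j‖ ≤ 1 := by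
    intro k j
    by_cases hj : j = k
    · exact Eventually.of_forall fun _ h => absurd hj h
    have hsub : AnalyticAt ℝ (fun ρ => ζ ρ k - ζ ρ j) 0 :=
      (analyticAt_apply hζ k).sub (analyticAt_apply hζ j)
    have hne : ζ 0 k - ζ 0 j ≠ 0 := sub_ne_zero.mpr fun h => hj (hinj h).symm
    have h1 : ∀ᶠ ρ in 𝓝 0, 2 * |ρ| < ‖ζ ρ k - ζ ρ j‖ := by
      have hl : Tendsto (fun ρ : ℝ => 2 * |ρ|) (𝓝 0) (𝓝 (2 * |0|)) :=
        (continuous_const.mul continuous_abs).tendsto 0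
      refine hl.eventually_lt hsub.continuousAt.norm ?_
      simpa using hne
    have h2 : ∀ᶠ ρ in 𝓝 0, IsUnit (cmul (ζ ρ k - ζ ρ j) + ρ • shift) := by
      have hA : AnalyticAt ℝ (fun ρ => cmul (ζ ρ k - ζ ρ j) + ρ • shift) 0 :=
        (analyticAt_cmul hsub).add (hid.smul analyticAt_const)
      refine hA.continuousAt.eventually (p := IsUnit) (Units.isOpen.mem_nhds ?_)
      simp only [zero_smul, add_zero, mem_ofPred_eq]
      exact isUnit_cmul hne
    have h3 : ∀ᶠ ρ in 𝓝 0, ‖(ρ / 2) • opInv ρ (ζ ρ) k j‖ < 1 := by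
      have hA : AnalyticAt ℝ (fun ρ => (ρ / 2) • opInv ρ (ζ ρ) k j) 0 :=
        (hid.div analyticAt_const two_ne_zero).smul (analyticAt_opInv hid hζ rfl hinj hj)
      refine hA.continuousAt.norm.eventually_lt continuousAt_const ?_
      simp
    filter_upwards [h1, h2, h3] with ρ a b c _ using ⟨a, b, c.le⟩
  filter_upwards [eventually_all.mpr fun k => eventually_all.mpr (key k)] with ρ h hρ
  exact ⟨hρ, h⟩

theorem mul_deriv_layerPotential {ℓ : ℕ} {α : ℝ} (hα₀ : 0 < α) (hα₁ : α < 1) {ρ : ℝ}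
    {ζ : Fin M → ℂ} (C : Fin M → Ell ℕ) {η : ℂ} (hρ : ρ ≠ 0) (hη : η ∈ circularDomain ζ ρ) :
    ρ * deriv (layerPotential ρ ζ fun k => holderDensity ℓ hα₀ hα₁ (C k)) η
      = -poleDer ρ ζ C η := by
  have h1 : layerPotential ρ ζ (fun k => holderDensity ℓ hα₀ hα₁ (C k)) =ᶠ[𝓝 η]
      poleSum ρ ζ fun k => Ell.integ (C k) := by
    filter_upwards [isOpen_circularDomain.mem_nhds hη] with x hx
    exact layerPotential_holderDensity hα₀ hα₁ C hx
  rw [h1.deriv_eq, (hasDerivAt_poleSum C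
    (half_lt_of_mem_closed hρ (circularDomain_subset hη))).deriv, mul_neg, mul_sum_eq_poleDer]

/-- Zeros of the defect operators define solutions of the conformal problem. -/
theorem exists_isConformalSolution {ρ : ℝ} {Λ : VortexParams M} (hadm : Admissible ρ Λ.center)
    {C D : Fin M → Ell ℕ} {Q b : Fin M → ℝ} (hγ : ∀ k, Λ.strength k ≠ 0)
    (hzero : ∀ k, decode (opKin ρ Λ C D b k vac, opDyn ρ Λ C D Q b k vac) = 0)
    (hδ : |ρ| * ∑ j, ‖D j‖ < 1) :
    ∃ F : ℂ ≃ₜ ℂ, ⇑F = confExt ρ Λ.center D ∧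
      IsConformalSolution Λ ρ (fun k => Λ.strength k ^ 2 / (8 * Real.pi ^ 2 * ρ ^ 2)
        + Λ.strength k * Q k / (2 * ρ)) F (confDer ρ Λ.center D)
        (confVel ρ Λ.center Λ.strength (fun j => ρ * b j) C) := by
  have hρ := hadm.1
  obtain ⟨F, hF⟩ := exists_homeomorph_of_norm_sub_le (by positivity) hδ
    (norm_confExt_sub_le (ζ := Λ.center) hρ D)
  have hdisj : Pairwise fun j k => 2 * |ρ| < ‖Λ.center j - Λ.center k‖ := fun j k hjk =>
    (hadm.2 j k hjk.symm).1
  have hFc : ∀ η ∈ closedCircularDomain Λ.center ρ, F η = confMap ρ Λ.center D η := fun η hη => by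
    rw [hF, confExt_eq_confMap hρ D hη]
  have hne : ∀ η ∈ closedCircularDomain Λ.center ρ, confDer ρ Λ.center D η ≠ 0 := by
    intro η hη h0
    have h1 := norm_confDer_sub_one_le D hη
    rw [h0, zero_sub, norm_neg, norm_one] at h1
    linarith
  -- The signed parameterization `σ ↦ ζ + ρσ` covers the circle of radius `|ρ|` also when `ρ` is
  -- negative.
  have hsph : ∀ k, ∀ η ∈ Metric.sphere (Λ.center k) |ρ|, ∃ σ : Circle,
      η = Λ.center k + ρ * σ := by
    intro k η hη
    have hρ' : (ρ : ℂ) ≠ 0 := by exact_mod_cast hρ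
    have h1 : (η - Λ.center k) / ρ ∈ Metric.sphere (0 : ℂ) 1 := by
      rw [mem_sphere_zero_iff_norm, norm_div, mem_sphere_iff_norm.mp hη, norm_real,
        Real.norm_eq_abs, div_self (abs_pos.mpr hρ).ne']
    refine ⟨⟨_, (Submonoid.unitSphere ℂ).mem_carrier.mp h1⟩, ?_⟩
    simp only
    field_simp
    ring
  have hmem : ∀ k, ∀ η ∈ Metric.sphere (Λ.center k) |ρ|, η ∈ closedCircularDomain Λ.center ρ :=
    fun k η hη => mem_closed_of_mem_sphere hdisj hη
  have hcv : ∀ η ∈ closedCircularDomain Λ.center ρ,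
      conformalVelocity Λ.cOmega F (confDer ρ Λ.center D)
        (confVel ρ Λ.center Λ.strength (fun j => ρ * b j) C) η =
      conformalVelocity Λ.cOmega (confMap ρ Λ.center D) (confDer ρ Λ.center D)
        (confVel ρ Λ.center Λ.strength (fun j => ρ * b j) C) η := fun η hη => by
    rw [conformalVelocity, conformalVelocity, hFc η hη]
  refine ⟨F, hF, hdisj, ?_, F.continuous.continuousOn, ?_, hne, F.injective.injOn, ?_, ?_, ?_,
    tendsto_confVel _ _ _, fun k => ?_, fun k η hη => ?_, fun k η hη => ?_⟩
  · intro η hη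
    refine (hasDerivAt_confMap D (half_lt_of_mem_closed hρ
      (circularDomain_subset hη))).congr_of_eventuallyEq ?_
    filter_upwards [isOpen_circularDomain.mem_nhds hη] with x hx
    exact hFc x (circularDomain_subset hx)
  · exact fun η hη => (differentiableAt_confDer D
      (half_lt_of_mem_closed hρ hη)).continuousAt.continuousWithinAt
  · have h1 := (tendsto_poleSum (ρ := ρ) (ζ := Λ.center) fun j => Ell.integ (D j)).const_mul
      ((ρ : ℂ) ^ 2)
    rw [mul_zero] at h1
    refine h1.congr' ?_
    have hbdd : ∀ᶠ η in cocompact ℂ, η ∈ circularDomain Λ.center ρ := by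
      refine eventually_all.mpr fun k => ?_
      filter_upwards [(isCompact_closedBall (Λ.center k) |ρ|).compl_mem_cocompact] with η hη
      simpa [dist_eq_norm] using hη
    filter_upwards [hbdd] with η hη
    rw [hFc η (circularDomain_subset hη), confMap, add_sub_cancel_left]
  · exact fun η hη => (differentiableAt_confVel _ _ C (half_lt_of_mem_closed hρ
      (circularDomain_subset hη))).differentiableWithinAt
  · exact fun η hη => (differentiableAt_confVel _ _ C
      (half_lt_of_mem_closed hρ hη)).continuousAt.continuousWithinAt
  · rw [circleIntegral_confVel hρ hdisj]
    simp
  · rw [hcv η (hmem k η hη)]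
    obtain ⟨σ, rfl⟩ := hsph k η hη
    exact (kinematic_and_dynamic hadm (hγ k) (hzero k) σ (hne _ (hmem k _ hη))).1
  · rw [hcv η (hmem k η hη), hFc η (hmem k η hη)]
    obtain ⟨σ, rfl⟩ := hsph k η hη
    exact (kinematic_and_dynamic hadm (hγ k) (hzero k) σ (hne _ (hmem k _ hη))).2

/-- A collapsing point vortex configuration is the limit of imploding hollow vortices along a
real-analytic curve, for each choice of an admissible subspace of parameters. -/
theorem IsCollapsingPointVortex.exists_isImplodingCurve {Λ₀ : VortexParams M}
    (h : IsCollapsingPointVortex Λ₀) (ℓ : ℕ) {α : ℝ} (hα₀ : 0 < α) (hα₁ : α < 1)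
    {E : Submodule ℝ (VortexParams M)} (hE : IsAdmissibleSubspace Λ₀ E) :
    ∃ (ρ₁ : ℝ) (μ ν : ℝ → Fin M → HolderCircle ℓ α) (Q β : ℝ → Fin M → ℝ)
      (Λ : ℝ → VortexParams M), IsImplodingCurve ℓ α Λ₀ E ρ₁ μ ν Q β Λ := by
  obtain ⟨C, D, Q, b, Λ, hC, hD, hQ, hb, hΛ, hC0, hD0, hQ0, hΛ0, hΛE, hzero⟩ :=
    exists_curve h.distinct h.strength_ne_zero h.vortexMap_eq_zero hE
  have hadm := eventually_admissible (analyticAt_center hΛ) (by rw [hΛ0]; exact h.distinct)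
  have hstr : ∀ᶠ ρ in 𝓝 0, ∀ k, (Λ ρ).strength k ≠ 0 := by
    refine eventually_all.mpr fun k => ?_
    refine (analyticAt_apply (analyticAt_strength hΛ) k).continuousAt.eventually_ne ?_
    rw [hΛ0]
    exact h.strength_ne_zero k
  have him : ∀ᶠ ρ in 𝓝 0, (Λ ρ).cOmega.im < 0 := by
    have hc : ContinuousAt (fun ρ => (Λ ρ).cOmega.im) 0 :=
      continuous_im.continuousAt.comp (analyticAt_cOmega hΛ).continuousAt
    refine hc.eventually_lt continuousAt_const ?_
    rw [hΛ0]
    exact h.collapsing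
  -- A bound by `1` suffices for the homeomorphism. The orientation of the boundaries requires
  -- `1/3`.
  have hδ : ∀ᶠ ρ in 𝓝 0, |ρ| * ∑ j, ‖D ρ j‖ < 1 / 3 := by
    have hc : ContinuousAt (fun ρ : ℝ => |ρ| * ∑ j, ‖D ρ j‖) 0 :=
      continuous_abs.continuousAt.mul (tendsto_finsetSum _ fun j _ =>
        (analyticAt_apply hD j).continuousAt.norm)
    refine hc.eventually_lt continuousAt_const ?_
    simp
  obtain ⟨ρ₁, hρ₁, hball⟩ := Metric.eventually_nhds_iff_ball.mp
    (hzero.and (hadm.and (hstr.and (him.and (hδ.and (hC.eventually_analyticAt.and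
      (hD.eventually_analyticAt.and (hQ.eventually_analyticAt.and
        (hb.eventually_analyticAt.and hΛ.eventually_analyticAt)))))))))
  rw [Real.ball_eq_Ioo, zero_sub, zero_add] at hball
  have hemb : ∀ {A : ℝ → Fin M → Ell ℕ} {ρ : ℝ}, AnalyticAt ℝ A ρ →
      AnalyticAt ℝ (fun ρ k => holderDensity ℓ hα₀ hα₁ (A ρ k)) ρ := fun hA =>
    AnalyticAt.pi fun k => ((holderDensity ℓ hα₀ hα₁).analyticAt _).fun_comp (analyticAt_apply hA k)
  -- The coefficients of `f_ζ` give `μ` and those of the velocity give `ν`. The factors `γ` in `Q`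
  -- and `ρ` in `β` undo the normalizations of the unknowns.
  refine ⟨ρ₁, fun ρ k => holderDensity ℓ hα₀ hα₁ (D ρ k),
    fun ρ k => holderDensity ℓ hα₀ hα₁ (C ρ k), fun ρ k => (Λ ρ).strength k * Q ρ k,
    fun ρ k => ρ * b ρ k, Λ, hρ₁, ?_, ?_, ?_, ?_, ?_, ?_, ?_, ?_, ?_, hΛ0, ?_, ?_, ?_, ?_, ?_, ?_⟩
  · exact fun ρ hρ => hemb (hball ρ hρ).2.2.2.2.2.2.1
  · exact fun ρ hρ => hemb (hball ρ hρ).2.2.2.2.2.1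
  · exact fun ρ hρ => AnalyticAt.pi fun k =>
      (analyticAt_apply (analyticAt_strength (hball ρ hρ).2.2.2.2.2.2.2.2.2) k).mul
        (analyticAt_apply (hball ρ hρ).2.2.2.2.2.2.2.1 k)
  · exact fun ρ hρ => AnalyticAt.pi fun k =>
      analyticAt_id.mul (analyticAt_apply (hball ρ hρ).2.2.2.2.2.2.2.2.1 k)
  · exact fun ρ hρ => (hball ρ hρ).2.2.2.2.2.2.2.2.2
  · funext k
    simp [hD0]
  · funext k
    simp [hC0]
  · funext k
    simp [hQ0]
  · funext k
    simp
  · exact fun ρ _ k => integral_density (D ρ k)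
  · exact fun ρ _ k => integral_density (C ρ k)
  · exact fun ρ _ => hΛE ρ
  · exact fun ρ hρ => (hball ρ hρ).2.2.2.1
  · exact fun ρ hρ => (hball ρ hρ).2.2.1
  · intro ρ hρ hρ0
    obtain ⟨hz, ha, hs, hi, hd, -⟩ := hball ρ hρ
    have ha := ha hρ0
    obtain ⟨F, hF, hsol⟩ := exists_isConformalSolution ha hs hz (by linarith)
    refine ⟨F, confDer ρ (Λ ρ).center (D ρ), confVel ρ (Λ ρ).center (Λ ρ).strength
      (fun j => ρ * b ρ j) (C ρ), fun k => F '' Metric.ball ((Λ ρ).center k) |ρ|, _, _, ?_, ?_,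
      hsol, compl_iUnion_core hρ0 F, frontier_core hρ0 F, ?_,
      hsol.isImplodingHollowVortex hρ0 hd (δ := |ρ| * ∑ j, ‖D ρ j‖)
        (g := confMap ρ (Λ ρ).center (D ρ)) ?_ (fun η hη => norm_confDer_sub_one_le _ hη)
        (fun η hη => ⟨?_, hasDerivAt_confMap _ (half_lt_of_mem_closed hρ0 hη)⟩)
        (tendsto_confDer _) hi⟩
    · intro η hη
      rw [layerPotential_holderDensity hα₀ hα₁ (D ρ) hη, hF,
        confExt_eq_confMap hρ0 _ (circularDomain_subset hη), confMap]
    · intro η hη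
      rw [mul_deriv_layerPotential hα₀ hα₁ (C ρ) hρ0 hη, confVel, sub_eq_add_neg]
    · exact fun η _ => IsConformalSolution.frameVelocity_map _ η
    · rw [hF]
      exact norm_confExt_sub_le hρ0 _
    · rw [hF, confExt_eq_confMap hρ0 _ hη]

end Bifurcation

/-! ### Non-degeneracy of point vortex configurations -/

section Nondegenerate

variable {M : ℕ} {Λ : VortexParams M}

theorem fderiv_vortexMap_apply (hinj : Function.Injective Λ.center) (v : VortexParams M)
    (k : Fin M) : fderiv ℝ vortexMap Λ v k =
      ∑ j ∈ Finset.univ.erase k, ((v.strength j : ℂ) / (2 * Real.pi * I)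
          * (1 / (Λ.center k - Λ.center j))
        - (Λ.strength j : ℂ) / (2 * Real.pi * I)
          * ((v.center k - v.center j) / (Λ.center k - Λ.center j) ^ 2))
      + (I * v.cOmega * (starRingEnd ℂ) (Λ.center k)
        + I * Λ.cOmega * (starRingEnd ℂ) (v.center k)) := by
  have hline : HasDerivAt (fun t : ℝ => Λ + t • v) v 0 := by
    simpa using ((hasDerivAt_id (0 : ℝ)).smul_const v).const_add Λ
  have h1 := hasDerivAt_pi.mp (HasFDerivAt.comp_hasDerivAt_of_eq (0 : ℝ)
    (analyticAt_vortexMap hinj).differentiableAt.hasFDerivAt hline (by simp)) k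
  refine h1.unique ?_
  have hz : ∀ j, HasDerivAt (fun t : ℝ => Λ.center j + t • v.center j) (v.center j) 0 :=
    fun j => by
      have := ((hasDerivAt_id (0 : ℝ)).smul_const (v.center j)).const_add (Λ.center j)
      rwa [one_smul] at this
  have hγ : ∀ j, HasDerivAt (fun t : ℝ => ((Λ.strength j + t * v.strength j : ℝ) : ℂ))
      (v.strength j) 0 := fun j => by
    have := ((hasDerivAt_id (0 : ℝ)).mul_const (v.strength j)).const_add (Λ.strength j)
    rw [one_mul] at this
    exact this.ofReal_comp
  have hΩ : HasDerivAt (fun t : ℝ => Λ.cOmega + t • v.cOmega) v.cOmega 0 := by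
    have := ((hasDerivAt_id (0 : ℝ)).smul_const v.cOmega).const_add Λ.cOmega
    rwa [one_smul] at this
  have hconj : HasDerivAt (fun t : ℝ => (starRingEnd ℂ) (Λ.center k + t • v.center k))
      ((starRingEnd ℂ) (v.center k)) 0 :=
    conjCLE.hasFDerivAt.comp_hasDerivAt 0 (hz k)
  change HasDerivAt (fun t : ℝ => (∑ j ∈ Finset.univ.erase k,
    ((Λ.strength j + t * v.strength j : ℝ) : ℂ) / (2 * Real.pi * I)
      * (1 / (Λ.center k + t • v.center k - (Λ.center j + t • v.center j))))
    + I * (Λ.cOmega + t • v.cOmega) * (starRingEnd ℂ) (Λ.center k + t • v.center k)) _ 0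
  refine HasDerivAt.add (HasDerivAt.fun_sum fun j hj => ?_) ?_
  · have hne : Λ.center k - Λ.center j ≠ 0 := sub_ne_zero.mpr fun h =>
      (Finset.ne_of_mem_erase hj) (hinj h).symm
    have h2 := HasDerivAt.fun_inv ((hz k).sub (hz j)) (by simpa using hne)
    simp only [one_div]
    refine (((hγ j).div_const (2 * Real.pi * I)).mul h2).congr_deriv ?_
    simp only [zero_smul, add_zero, Pi.sub_apply, zero_mul]
    ring
  · refine ((hΩ.const_mul I).mul hconj).congr_deriv ?_
    simp

/-- Surjectivity onto `ℂ^M` through the vanishing of the annihilator of the range. -/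
theorem surjective_of_annihilator {V : Type*} [AddCommGroup V] [Module ℝ V]
    (L : V →ₗ[ℝ] Fin M → ℂ)
    (h : ∀ p q : Fin M → ℝ, (∀ v, ∑ k, (p k * (L v k).re + q k * (L v k).im) = 0) →
      ∀ k, p k = 0 ∧ q k = 0) : Function.Surjective L := by
  rw [← LinearMap.range_eq_top]
  by_contra hne
  obtain ⟨f, hf0, hf⟩ := Submodule.exists_le_ker_of_lt_top _ (lt_top_iff_ne_top.mpr hne)
  have hrep : ∀ w : Fin M → ℂ, f w = ∑ k, (f (Pi.single k 1) * (w k).re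
      + f (Pi.single k I) * (w k).im) := by
    intro w
    have hw : w = ∑ k, ((w k).re • (Pi.single k 1 : Fin M → ℂ)
        + (w k).im • (Pi.single k I : Fin M → ℂ)) := by
      funext j
      rw [Finset.sum_apply, Finset.sum_eq_single j]
      · simp [re_add_im]
      · intro k _ hk
        simp [Pi.single_eq_of_ne hk.symm]
      · simp
    conv_lhs => rw [hw]
    simp only [map_sum, map_add, map_smul, smul_eq_mul, mul_comm]
  have hz := h (fun k => f (Pi.single k (1 : ℂ))) (fun k => f (Pi.single k I)) fun v => by
    rw [← hrep]
    exact hf (LinearMap.mem_range_self L v)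
  refine hf0 (LinearMap.ext fun w => ?_)
  rw [hrep]
  simp [fun k => (hz k).1, fun k => (hz k).2]

/-- The form suited to explicit arithmetic: the equations are multiplied by `2π` and split into real
and imaginary parts. The sums run over all `j`, since the self-interaction is `0` by the convention
`0⁻¹ = 0`. -/
theorem vortexMap_eq_zero_of_real {x y : Fin M → ℝ} (hc : ∀ k, Λ.center k = ⟨x k, y k⟩)
    (hre : ∀ k, ∑ j, Λ.strength j * ((y k - y j) / ((x k - x j) ^ 2 + (y k - y j) ^ 2))
      = 2 * Real.pi * (Λ.cOmega.re * y k - Λ.cOmega.im * x k))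
    (him : ∀ k, ∑ j, Λ.strength j * ((x k - x j) / ((x k - x j) ^ 2 + (y k - y j) ^ 2))
      = 2 * Real.pi * (Λ.cOmega.re * x k + Λ.cOmega.im * y k)) : vortexMap Λ = 0 := by
  have hpi := Real.pi_pos.ne'
  funext k
  have hsum : (∑ j ∈ Finset.univ.erase k, (Λ.strength j : ℂ) / (2 * Real.pi * I)
      * (1 / (Λ.center k - Λ.center j))) = ∑ j, ((1 / (2 * Real.pi) : ℝ) : ℂ) *
        (-I * (Λ.strength j * (Λ.center k - Λ.center j)⁻¹)) := by
    rw [← Finset.add_sum_erase _ _ (Finset.mem_univ k), sub_self, inv_zero, mul_zero, mul_zero,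
      mul_zero, zero_add]
    refine Finset.sum_congr rfl fun j _ => ?_
    push_cast
    rw [div_eq_mul_inv, mul_inv, inv_I]
    ring
  have h1 := hre k
  have h2 := him k
  rw [vortexMap, hsum, ← Finset.mul_sum, ← Finset.mul_sum, Pi.zero_apply]
  have hR : (∑ j, (Λ.strength j : ℂ) * (Λ.center k - Λ.center j)⁻¹).re =
      2 * Real.pi * (Λ.cOmega.re * x k + Λ.cOmega.im * y k) := by
    rw [← h2, re_sum]
    refine Finset.sum_congr rfl fun j _ => ?_
    rw [re_ofReal_mul, inv_re, normSq_apply, hc, hc]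
    simp [pow_two]
  have hI : (∑ j, (Λ.strength j : ℂ) * (Λ.center k - Λ.center j)⁻¹).im =
      -(2 * Real.pi * (Λ.cOmega.re * y k - Λ.cOmega.im * x k)) := by
    rw [← h1, im_sum, ← Finset.sum_neg_distrib]
    refine Finset.sum_congr rfl fun j _ => ?_
    rw [im_ofReal_mul, inv_im, normSq_apply, hc, hc]
    simp [pow_two]
    ring
  apply Complex.ext
  · rw [add_re, re_ofReal_mul, neg_mul, neg_re, I_mul_re, hI, hc]
    simp
    field_simp
    ring
  · rw [add_im, im_ofReal_mul, neg_mul, neg_im, I_mul_im, hR, hc]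
    simp
    field_simp
    ring

/-! ### Equations satisfied by a functional that kills the range. -/

variable (hinj : Function.Injective Λ.center) {p q : Fin M → ℝ}
  (h : ∀ v, ∑ k, (p k * (fderiv ℝ vortexMap Λ v k).re + q k * (fderiv ℝ vortexMap Λ v k).im) = 0)

include hinj h

/-- Variation of the strength `γ j`. -/
theorem annihilator_strength (j : Fin M) :
    ∑ k, (p k * (Λ.center k - Λ.center j).im + q k * (Λ.center k - Λ.center j).re)
      / normSq (Λ.center k - Λ.center j) = 0 := by
  -- The increment `2π` normalizes the column to `-i / (zₖ - zⱼ)`, a formula that includes `k = j`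
  -- because `0⁻¹ = 0`.
  have h1 := h (0, Pi.single j (2 * Real.pi), 0)
  have hpi : (Real.pi : ℂ) ≠ 0 := by exact_mod_cast Real.pi_ne_zero
  have hcol : ∀ k, fderiv ℝ vortexMap Λ (0, Pi.single j (2 * Real.pi), 0) k
      = -I * (Λ.center k - Λ.center j)⁻¹ := by
    intro k
    rw [fderiv_vortexMap_apply hinj]
    simp only [VortexParams.center, VortexParams.strength, VortexParams.cOmega, Pi.zero_apply,
      sub_zero, zero_div, mul_zero, zero_mul, map_zero, add_zero]
    by_cases hk : j = k
    · subst hk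
      rw [sub_self, inv_zero, mul_zero]
      refine Finset.sum_eq_zero fun i hi => ?_
      rw [Pi.single_eq_of_ne (Finset.ne_of_mem_erase hi)]
      simp
    · rw [Finset.sum_eq_single_of_mem j (Finset.mem_erase.mpr ⟨hk, Finset.mem_univ _⟩)]
      · rw [Pi.single_eq_same, one_div]
        push_cast
        rw [← div_div, div_self (mul_ne_zero two_ne_zero hpi), one_div, inv_I]
      · intro i _ hi
        rw [Pi.single_eq_of_ne hi]
        simp
  simp only [hcol] at h1
  rw [← neg_eq_zero, ← h1, ← Finset.sum_neg_distrib]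
  refine Finset.sum_congr rfl fun k _ => ?_
  simp [inv_re, inv_im]
  ring

/-- Translation of all centers. -/
theorem annihilator_translation (hΩ : Λ.cOmega ≠ 0) : ∑ k, p k = 0 ∧ ∑ k, q k = 0 := by
  -- The pair interactions do not see translations, so only the frame term varies. The shift is
  -- chosen so that this term equals the constant `a`.
  have hcol : ∀ a : ℂ, ∀ k, fderiv ℝ vortexMap Λ
      (fun _ => (starRingEnd ℂ) (a / (I * Λ.cOmega)), 0, 0) k = a := by
    intro a k
    rw [fderiv_vortexMap_apply hinj]
    have h0 : I * Λ.cOmega ≠ 0 := mul_ne_zero I_ne_zero hΩ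
    rw [Finset.sum_eq_zero fun j _ => by simp [VortexParams.center, VortexParams.strength]]
    simp only [VortexParams.center, VortexParams.cOmega, conj_conj, mul_zero, zero_mul, zero_add]
    exact mul_div_cancel₀ a h0
  have h1 := h (fun _ => (starRingEnd ℂ) (1 / (I * Λ.cOmega)), 0, 0)
  have h2 := h (fun _ => (starRingEnd ℂ) (I / (I * Λ.cOmega)), 0, 0)
  simp only [hcol] at h1 h2
  exact ⟨by simpa using h1, by simpa using h2⟩

/-- Variation of `𝛀`. -/
theorem annihilator_cOmega :
    ∑ k, (p k * (Λ.center k).re - q k * (Λ.center k).im) = 0 ∧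
      ∑ k, (p k * (Λ.center k).im + q k * (Λ.center k).re) = 0 := by
  have hcol : ∀ a : ℂ, ∀ k, fderiv ℝ vortexMap Λ (0, 0, a) k
      = I * a * (starRingEnd ℂ) (Λ.center k) := by
    intro a k
    rw [fderiv_vortexMap_apply hinj]
    simp [VortexParams.center, VortexParams.strength, VortexParams.cOmega]
  have h1 := h (0, 0, -I)
  have h2 := h (0, 0, 1)
  simp only [hcol] at h1 h2
  refine ⟨?_, ?_⟩
  · rw [← h1]
    refine Finset.sum_congr rfl fun k _ => ?_
    simp
    ring
  · rw [← h2]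
    refine Finset.sum_congr rfl fun k _ => ?_
    simp

/-- Horizontal variation of the center `m`. -/
theorem annihilator_center (m : Fin M) :
    ∑ k ∈ Finset.univ.erase m, (Λ.strength m * (p k * ((Λ.center k - Λ.center m)⁻¹ ^ 2).im
        - q k * ((Λ.center k - Λ.center m)⁻¹ ^ 2).re)
      - Λ.strength k * (p m * ((Λ.center k - Λ.center m)⁻¹ ^ 2).im
        - q m * ((Λ.center k - Λ.center m)⁻¹ ^ 2).re))
      + 2 * Real.pi * (q m * Λ.cOmega.re - p m * Λ.cOmega.im) = 0 := by
  have hpi := Real.pi_pos.ne'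
  have h1 := h (Pi.single m 1, 0, 0)
  have hI : ∀ a : ℂ, a / (2 * Real.pi * I) = a / (2 * Real.pi) * -I := fun a => by
    rw [← div_div, div_I, mul_neg]
  have hself : fderiv ℝ vortexMap Λ (Pi.single m 1, 0, 0) m
      = (∑ k ∈ Finset.univ.erase m, ((Λ.strength k / (2 * Real.pi) : ℝ) : ℂ)
        * (I * (Λ.center k - Λ.center m)⁻¹ ^ 2)) + I * Λ.cOmega := by
    rw [fderiv_vortexMap_apply hinj]
    congr 1
    · refine Finset.sum_congr rfl fun j hj => ?_
      simp only [VortexParams.center, VortexParams.strength, Pi.zero_apply, Pi.single_eq_same,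
        Pi.single_eq_of_ne (Finset.ne_of_mem_erase hj)]
      rw [hI, hI, ← neg_sub (Λ.1 j), neg_sq, inv_pow]
      push_cast
      ring
    · simp [VortexParams.center, VortexParams.cOmega]
  have hother : ∀ k ∈ Finset.univ.erase m, fderiv ℝ vortexMap Λ (Pi.single m 1, 0, 0) k
      = ((Λ.strength m / (2 * Real.pi) : ℝ) : ℂ)
        * (-(I * (Λ.center k - Λ.center m)⁻¹ ^ 2)) := by
    intro k hk
    have hk := Finset.ne_of_mem_erase hk
    rw [fderiv_vortexMap_apply hinj, Finset.sum_eq_single_of_mem m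
      (Finset.mem_erase.mpr ⟨hk.symm, Finset.mem_univ _⟩)]
    · simp only [VortexParams.center, VortexParams.strength, VortexParams.cOmega, Pi.zero_apply,
        Pi.single_eq_same, Pi.single_eq_of_ne hk, map_zero]
      rw [hI, hI, inv_pow]
      push_cast
      ring
    · intro j _ hj
      simp [VortexParams.center, VortexParams.strength, Pi.single_eq_of_ne hk,
        Pi.single_eq_of_ne hj]
  have hre : (fderiv ℝ vortexMap Λ (Pi.single m 1, 0, 0) m).re = -(∑ k ∈ Finset.univ.erase m,
      Λ.strength k / (2 * Real.pi) * ((Λ.center k - Λ.center m)⁻¹ ^ 2).im) - Λ.cOmega.im := by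
    rw [hself, add_re, re_sum, I_mul_re, ← Finset.sum_neg_distrib, ← sub_eq_add_neg]
    congr 1
    exact Finset.sum_congr rfl fun k _ => by rw [re_ofReal_mul, I_mul_re, mul_neg]
  have him : (fderiv ℝ vortexMap Λ (Pi.single m 1, 0, 0) m).im = (∑ k ∈ Finset.univ.erase m,
      Λ.strength k / (2 * Real.pi) * ((Λ.center k - Λ.center m)⁻¹ ^ 2).re) + Λ.cOmega.re := by
    rw [hself, add_im, im_sum, I_mul_im]
    congr 1
    exact Finset.sum_congr rfl fun k _ => by rw [im_ofReal_mul, I_mul_im]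
  have hsum : ∑ k ∈ Finset.univ.erase m, (p k * (fderiv ℝ vortexMap Λ (Pi.single m 1, 0, 0) k).re
      + q k * (fderiv ℝ vortexMap Λ (Pi.single m 1, 0, 0) k).im) = ∑ k ∈ Finset.univ.erase m,
      Λ.strength m / (2 * Real.pi) * (p k * ((Λ.center k - Λ.center m)⁻¹ ^ 2).im
        - q k * ((Λ.center k - Λ.center m)⁻¹ ^ 2).re) := by
    refine Finset.sum_congr rfl fun k hk => ?_
    rw [hother k hk, re_ofReal_mul, im_ofReal_mul, neg_re, neg_im, I_mul_re, I_mul_im]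
    ring
  rw [← Finset.add_sum_erase _ _ (Finset.mem_univ m), hre, him, hsum] at h1
  have h2 := congrArg (fun t => 2 * Real.pi * t) h1
  simp only [mul_zero] at h2
  rw [← h2]
  have e2 : ∀ k t, Λ.strength k / (2 * Real.pi) * t = 1 / (2 * Real.pi) * (Λ.strength k * t) :=
    fun k t => by ring
  simp only [e2, ← Finset.mul_sum]
  rw [Finset.sum_sub_distrib]
  have e3 : ∑ k ∈ Finset.univ.erase m, Λ.strength k *
      (p m * ((Λ.center k - Λ.center m)⁻¹ ^ 2).im - q m * ((Λ.center k - Λ.center m)⁻¹ ^ 2).re)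
      = p m * ∑ k ∈ Finset.univ.erase m, Λ.strength k * ((Λ.center k - Λ.center m)⁻¹ ^ 2).im
        - q m * ∑ k ∈ Finset.univ.erase m,
          Λ.strength k * ((Λ.center k - Λ.center m)⁻¹ ^ 2).re := by
    rw [Finset.mul_sum, Finset.mul_sum, ← Finset.sum_sub_distrib]
    exact Finset.sum_congr rfl fun k _ => by ring
  rw [e3, ← Finset.mul_sum]
  field_simp
  ring

end Nondegenerate

/-! ### The trio and the quartet -/

theorem pointVortexTrio_center (k : Fin 3) : pointVortexTrio.center k =
    ⟨(![-2, 1, 0] : Fin 3 → ℝ) k, (![2 * √7 / 7, 2 * √7 / 7, 9 * √7 / 7] : Fin 3 → ℝ) k⟩ := by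
  have hs : √7 ^ 2 = (7 : ℝ) := Real.sq_sqrt (by norm_num)
  have hs0 : √7 ≠ (0 : ℝ) := by positivity
  have h2 : 2 / √7 = 2 * √7 / 7 := by field_simp; linarith
  have hc : (2 / (√7 : ℂ)) = ((2 * √7 / 7 : ℝ) : ℂ) := by rw [← h2]; push_cast; rfl
  fin_cases k <;> apply Complex.ext <;>
    simp [pointVortexTrio, VortexParams.center, hc, -ofReal_mul, -ofReal_div]
  ring

theorem isCollapsing_pointVortexTrio : IsCollapsingPointVortex pointVortexTrio := by
  have hs : √7 ^ 2 = (7 : ℝ) := Real.sq_sqrt (by norm_num)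
  have hs0 : (0 : ℝ) < √7 := by positivity
  have e1 : 9 * √7 / 7 - 2 * √7 / 7 = √7 := by ring
  have e2 : 2 * √7 / 7 - 9 * √7 / 7 = -√7 := by ring
  have hpi := Real.pi_pos
  have hre : pointVortexTrio.cOmega.re = 35 / (264 * Real.pi) := by
    rw [pointVortexTrio, VortexParams.cOmega]
    simp [-ofReal_div, -ofReal_mul]
  have him : pointVortexTrio.cOmega.im = -(√7 / (264 * Real.pi)) := by
    rw [pointVortexTrio, VortexParams.cOmega]
    simp [-ofReal_div, -ofReal_mul]
    ring
  refine ⟨fun i j hij => ?_, fun k => ?_, ?_, vortexMap_eq_zero_of_real pointVortexTrio_center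
    (fun k => ?_) (fun k => ?_)⟩
  · rw [pointVortexTrio_center, pointVortexTrio_center] at hij
    have h := congrArg Complex.re hij
    revert h
    fin_cases i <;> fin_cases j <;> norm_num
  · fin_cases k <;> simp [pointVortexTrio, VortexParams.strength]
  · rw [him]
    exact neg_neg_of_pos (by positivity)
  · rw [hre, him]
    fin_cases k <;> simp [Fin.sum_univ_three, pointVortexTrio, VortexParams.strength]
    all_goals
      simp only [e1, e2, neg_sq, hs]
      field_simp
      norm_num [hs]
  · rw [hre, him]
    fin_cases k <;> simp [Fin.sum_univ_three, pointVortexTrio, VortexParams.strength]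
    all_goals
      simp only [e1, e2, neg_sq, hs]
      field_simp
      norm_num [hs]

/-- Two strengths, the complex translation and the complex `𝛀` give six real equations for the six
components of the functional. They already force it to vanish. -/
theorem isNondegenerate_pointVortexTrio : IsNondegenerate pointVortexTrio := by
  have hinj := isCollapsing_pointVortexTrio.distinct
  refine ⟨(analyticAt_vortexMap hinj).differentiableAt,
    surjective_of_annihilator (fderiv ℝ vortexMap pointVortexTrio).toLinearMap fun p q h => ?_⟩
  have hs : √7 ^ 2 = (7 : ℝ) := Real.sq_sqrt (by norm_num)
  have e1 : 9 * √7 / 7 - 2 * √7 / 7 = √7 := by ring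
  have h1 := annihilator_strength hinj h 0
  have h2 := annihilator_strength hinj h 1
  obtain ⟨h3, h4⟩ := annihilator_translation hinj h fun h0 => by
    have := isCollapsing_pointVortexTrio.collapsing
    rw [h0] at this
    simp at this
  obtain ⟨h5, h6⟩ := annihilator_cOmega hinj h
  simp only [pointVortexTrio_center, Fin.sum_univ_three, normSq_apply, sub_re, sub_im]
    at h1 h2 h3 h4 h5 h6
  simp [e1, ← pow_two, hs] at h1 h2 h5 h6
  have q1 : q 1 = 0 := by grind
  have q0 : q 0 = 0 := by grind
  have q2 : q 2 = 0 := by grind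
  have p2 : p 2 = 0 := by grind
  have p1 : p 1 = 0 := by grind
  have p0 : p 0 = 0 := by grind
  intro k
  fin_cases k
  exacts [⟨p0, q0⟩, ⟨p1, q1⟩, ⟨p2, q2⟩]

theorem pointVortexQuartet_center (k : Fin 4) : pointVortexQuartet.center k =
    ⟨(![√3 / 2, 1 + √3 / 2, -√3 / 2 - 1, -√3 / 2] : Fin 4 → ℝ) k,
      (![-1 / 2, -1 / 2, 1 / 2, 1 / 2] : Fin 4 → ℝ) k⟩ := by
  fin_cases k <;> apply Complex.ext <;> simp [pointVortexQuartet, VortexParams.center] <;> ring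

/-- The inverse squared distances of the vortices of the quartet. -/
noncomputable def quartetInvSq : Fin 4 → Fin 4 → ℝ :=
  ![![0, 1, (5 - 2 * √3) / 13, 1 / 4], ![1, 0, (2 - √3) / 4, (5 - 2 * √3) / 13],
    ![(5 - 2 * √3) / 13, (2 - √3) / 4, 0, 1], ![1 / 4, (5 - 2 * √3) / 13, 1, 0]]

/-- Tabulating the reciprocals with rationalized denominators reduces the later checks to polynomial
identities in `√3`. -/
theorem inv_normSq_pointVortexQuartet (j k : Fin 4) :
    (normSq (pointVortexQuartet.center k - pointVortexQuartet.center j))⁻¹ = quartetInvSq k j := by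
  have hs : √3 ^ 2 = (3 : ℝ) := Real.sq_sqrt (by norm_num)
  rw [pointVortexQuartet_center, pointVortexQuartet_center, normSq_apply]
  simp only [sub_re, sub_im]
  fin_cases j <;> fin_cases k
  all_goals first
    | (simp [quartetInvSq]; done)
    | (refine inv_eq_of_mul_eq_one_left ?_; simp [quartetInvSq]; grind)

theorem isCollapsing_pointVortexQuartet : IsCollapsingPointVortex pointVortexQuartet := by
  have hs : √3 ^ 2 = (3 : ℝ) := Real.sq_sqrt (by norm_num)
  have hs0 : (0 : ℝ) < √3 := by positivity
  have hpi := Real.pi_pos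
  have hre : pointVortexQuartet.cOmega.re = 2 * √3 - 3 / 4 := by
    rw [pointVortexQuartet, VortexParams.cOmega]
    simp
  have him : pointVortexQuartet.cOmega.im = -(1 / 2) := by
    rw [pointVortexQuartet, VortexParams.cOmega]
    simp
  have hd : ∀ j k, ((((![√3 / 2, 1 + √3 / 2, -√3 / 2 - 1, -√3 / 2] : Fin 4 → ℝ) k
      - (![√3 / 2, 1 + √3 / 2, -√3 / 2 - 1, -√3 / 2] : Fin 4 → ℝ) j)) ^ 2
      + ((![-1 / 2, -1 / 2, 1 / 2, 1 / 2] : Fin 4 → ℝ) k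
        - (![-1 / 2, -1 / 2, 1 / 2, 1 / 2] : Fin 4 → ℝ) j) ^ 2)⁻¹ = quartetInvSq k j :=
      fun j k => by
    rw [← inv_normSq_pointVortexQuartet j k, pointVortexQuartet_center, pointVortexQuartet_center,
      normSq_apply, pow_two, pow_two]
    rfl
  refine ⟨fun i j hij => ?_, fun k => ?_, ?_, vortexMap_eq_zero_of_real pointVortexQuartet_center
    (fun k => ?_) (fun k => ?_)⟩
  -- Coinciding centers would make the tabulated inverse square vanish, whereas its off-diagonal
  -- entries are nonzero.
  · have h := inv_normSq_pointVortexQuartet j i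
    rw [hij, sub_self, map_zero, inv_zero] at h
    revert h
    fin_cases i <;> fin_cases j <;> simp [quartetInvSq] <;> grind
  · fin_cases k <;> simp [pointVortexQuartet, VortexParams.strength] <;> grind
  · rw [him]
    norm_num
  · rw [hre, him]
    simp only [div_eq_mul_inv _ (_ ^ 2 + _), hd]
    fin_cases k <;> simp [Fin.sum_univ_four, quartetInvSq, pointVortexQuartet,
      VortexParams.strength]
    all_goals grind
  · rw [hre, him]
    simp only [div_eq_mul_inv _ (_ ^ 2 + _), hd]
    fin_cases k <;> simp [Fin.sum_univ_four, quartetInvSq, pointVortexQuartet,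
      VortexParams.strength]
    all_goals grind

/-- Three strengths, the horizontal displacement of one center, the translations and `𝛀` give eight
real equations for eight unknowns, with only the zero solution. -/
theorem isNondegenerate_pointVortexQuartet : IsNondegenerate pointVortexQuartet := by
  have hinj := isCollapsing_pointVortexQuartet.distinct
  refine ⟨(analyticAt_vortexMap hinj).differentiableAt,
    surjective_of_annihilator (fderiv ℝ vortexMap pointVortexQuartet).toLinearMap fun p q h => ?_⟩
  have hs : √3 ^ 2 = (3 : ℝ) := Real.sq_sqrt (by norm_num)
  have h1 := annihilator_strength hinj h 0
  have h2 := annihilator_strength hinj h 1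
  have h3 := annihilator_strength hinj h 2
  have h4 := annihilator_center hinj h 0
  obtain ⟨h5, h6⟩ := annihilator_translation hinj h fun h0 => by
    have := isCollapsing_pointVortexQuartet.collapsing
    rw [h0] at this
    simp at this
  obtain ⟨h7, h8⟩ := annihilator_cOmega hinj h
  have hu : (Finset.univ.erase 0 : Finset (Fin 4)) = {1, 2, 3} := rfl
  have hre : pointVortexQuartet.cOmega.re = 2 * √3 - 3 / 4 := by
    rw [pointVortexQuartet, VortexParams.cOmega]
    simp
  have him : pointVortexQuartet.cOmega.im = -(1 / 2) := by
    rw [pointVortexQuartet, VortexParams.cOmega]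
    simp
  have hsqre : ∀ z : ℂ, (z⁻¹ ^ 2).re = (z.re ^ 2 - z.im ^ 2) * (normSq z)⁻¹ ^ 2 := fun z => by
    rw [pow_two, mul_re, inv_re, inv_im]; ring
  have hsqim : ∀ z : ℂ, (z⁻¹ ^ 2).im = -(2 * z.re * z.im) * (normSq z)⁻¹ ^ 2 := fun z => by
    rw [pow_two, mul_im, inv_re, inv_im]; ring
  simp only [hsqre, hsqim, hu, hre, him, div_eq_mul_inv _ (normSq _),
    inv_normSq_pointVortexQuartet] at h1 h2 h3 h4
  simp only [pointVortexQuartet_center, Fin.sum_univ_four, sub_re, sub_im]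
    at h1 h2 h3 h4 h5 h6 h7 h8
  simp [quartetInvSq, pointVortexQuartet, VortexParams.strength] at h1 h2 h3 h4 h7 h8
  have hpi := Real.pi_pos.ne'
  field_simp at h4
  -- All strengths are multiples of `π`, which therefore factors out of the equation of the center.
  have h4 := (mul_eq_zero.mp (h4.trans (mul_zero _))).resolve_left hpi
  clear h hinj hu hre him hsqre hsqim hpi
  have p0 : p 0 = 0 := by grind
  have q0 : q 0 = 0 := by grind
  have p1 : p 1 = 0 := by grind
  have q1 : q 1 = 0 := by grind
  have p2 : p 2 = 0 := by grind
  have q2 : q 2 = 0 := by grind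
  have p3 : p 3 = 0 := by grind
  have q3 : q 3 = 0 := by grind
  intro k
  fin_cases k
  exacts [⟨p0, q0⟩, ⟨p1, q1⟩, ⟨p2, q2⟩, ⟨p3, q3⟩]

theorem corollary4p3 (ℓ : ℕ) (hℓ : 1 ≤ ℓ) (α : ℝ) (hα₀ : 0 < α) (hα₁ : α < 1) :
    (IsCollapsingPointVortex pointVortexTrio ∧ IsNondegenerate pointVortexTrio ∧
      ∀ E : Submodule ℝ (VortexParams 3), IsAdmissibleSubspace pointVortexTrio E →
        ∃ (ρ₁ : ℝ) (μ ν : ℝ → Fin 3 → HolderCircle ℓ α) (Q β : ℝ → Fin 3 → ℝ)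
          (Λ : ℝ → VortexParams 3),
          IsImplodingCurve ℓ α pointVortexTrio E ρ₁ μ ν Q β Λ) ∧
    (IsCollapsingPointVortex pointVortexQuartet ∧ IsNondegenerate pointVortexQuartet ∧
      ∀ E : Submodule ℝ (VortexParams 4), IsAdmissibleSubspace pointVortexQuartet E →
        ∃ (ρ₁ : ℝ) (μ ν : ℝ → Fin 4 → HolderCircle ℓ α) (Q β : ℝ → Fin 4 → ℝ)
          (Λ : ℝ → VortexParams 4),
          IsImplodingCurve ℓ α pointVortexQuartet E ρ₁ μ ν Q β Λ) := by
  have trio := isCollapsing_pointVortexTrio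
  have quartet := isCollapsing_pointVortexQuartet
  exact ⟨⟨trio, isNondegenerate_pointVortexTrio, fun _ hE =>
      trio.exists_isImplodingCurve ℓ hα₀ hα₁ hE⟩,
    ⟨quartet, isNondegenerate_pointVortexQuartet, fun _ hE =>
      quartet.exists_isImplodingCurve ℓ hα₀ hα₁ hE⟩⟩
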